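/- **Setting.** Let $X, Y$ be finite non-empty sets, $Z$ a set, $f : X\times Y\to Z$. A *shared randomness SMP protocol* $\Pi$ consists of five mutually independent random strings $r_A, r_B, r_C, r_{AC}, r_{BC}$ (arbitrary probability spaces), message sets $M_A, M_B$, and (measurable) maps giving Alice's message $m_A=\Pi_A(x,r_A,r_{AC})$, Bob's message $m_B=\Pi_B(y,r_B,r_{BC})$ and the referee's output $\Pi(x,y)=\Pi_C(m_A,m_B,r_C,r_{AC},r_{BC})$; Alice and Bob share no randomness. $\Pi$ *computes $f$ with error $\epsilon$* if $\Pr[\Pi(x,y)\ne f(x,y)]\le\epsilon$ for all $(x,y)$. For a joint distribution $\mu$ of the inputs $(X,Y)$, independent of the random strings, let $$IC(\Pi,\mu)=I(X;M_A\mid R_{AC})+I(Y;M_B\mid R_{BC}),\quad IC(\Pi)=\max_{\mu} IC(\Pi,\mu),\quad IC(f,\epsilon)=\inf_{\Pi} IC(\Pi),$$ where mutual information is in bits, the maximum is over all distributions $\mu$ on $X\times Y$ and the infimum is over all shared randomness SMP protocols with finite message sets that compute $f$ with error $\epsilon$. An *average length* SMP protocol is a shared randomness SMP protocol whose message sets may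 be countably infinite, with a prefix-free binary encoding of each message set; $\ell_A,\ell_B$ denote the lengths of the codewords. Its cost is $CC_{av}(\Pi)=\max_{(x,y)}\mathbb E[\ell_A(M_A(x))+\ell_B(M_B(y))]$ (a supremum in $[0,\infty]$). For $n\ge 1$ let $CC_{av}(f^{n},\epsilon)$ be the infimum of $CC_{av}(\Pi)$ over all average length protocols $\Pi$ with inputs in $X^n$ and $Y^n$ and output in $Z^n$ that solve $n$ copies of $f$ with error $\epsilon$ on each copy: $\Pr[\Pi(x,y)_i\neq f(x_i,y_i)]\le\epsilon$ for all $x\in X^n$, $y\in Y^n$ and $1\le i\le n$. The *amortized average-length communication complexity* is $$ACC(f,\epsilon)=\limsup_{n\to\infty}\frac1n\,CC_{av}(f^{n},\epsilon).$$ **Theorem.** For every such $f$ and every $\epsilon\in(0,\tfrac12)$, $$IC(f,\epsilon)=ACC(f,\epsilon),$$ and the limit superior defining $ACC(f,\epsilon)$ is a limit. -/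

import Mathlib

open MeasureTheory ProbabilityTheory InformationTheory Filter Topology
open scoped ENNReal

noncomputable section

/-- Conditional mutual information `I(U; V | W)`, in bits, of random variables on a probability
space: the Kullback-Leibler divergence between the joint law of `(W, U, V)` and the law under which
`U` and `V` are conditionally independent given `W` with the same conditional marginals.
(`klDiv` is in nats, hence the division by `log 2`.) -/
def condMutualInfo {Ω 𝓤 𝓥 𝓦 : Type*} [MeasurableSpace Ω]
    [MeasurableSpace 𝓤] [StandardBorelSpace 𝓤] [Nonempty 𝓤]
    [MeasurableSpace 𝓥] [StandardBorelSpace 𝓥] [Nonempty 𝓥] [MeasurableSpace 𝓦]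
    (U : Ω → 𝓤) (V : Ω → 𝓥) (W : Ω → 𝓦) (P : Measure Ω) [IsFiniteMeasure P] : ℝ≥0∞ :=
  klDiv (P.map fun ω => (W ω, U ω, V ω))
      (P.map W ⊗ₘ (condDistrib U W P ×ₖ condDistrib V W P)) /
    ENNReal.ofReal (Real.log 2)

/-- A simultaneous message passing protocol with inputs in `X` (Alice) and `Y` (Bob) and output in
`Z` (referee). `RA`, `RB`, `RC` are the private random strings of Alice, Bob and the referee, `RAC`
(`RBC`) is shared by Alice (Bob) and the referee; the five are mutually independent, and there is
no randomness shared by Alice and Bob. Message sets are countable. -/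
structure SMPProtocol (X Y Z : Type*) where
  RA : Type
  RB : Type
  RC : Type
  RAC : Type
  RBC : Type
  [measRA : MeasurableSpace RA]
  [measRB : MeasurableSpace RB]
  [measRC : MeasurableSpace RC]
  [measRAC : MeasurableSpace RAC]
  [measRBC : MeasurableSpace RBC]
  lawA : Measure RA
  lawB : Measure RB
  lawC : Measure RC
  lawAC : Measure RAC
  lawBC : Measure RBC
  [probA : IsProbabilityMeasure lawA]
  [probB : IsProbabilityMeasure lawB]
  [probC : IsProbabilityMeasure lawC]
  [probAC : IsProbabilityMeasure lawAC]
  [probBC : IsProbabilityMeasure lawBC]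
  MA : Type
  MB : Type
  [countableMA : Countable MA]
  [countableMB : Countable MB]
  [nonemptyMA : Nonempty MA]
  [nonemptyMB : Nonempty MB]
  [measMA : MeasurableSpace MA]
  [measMB : MeasurableSpace MB]
  [discreteMA : DiscreteMeasurableSpace MA]
  [discreteMB : DiscreteMeasurableSpace MB]
  alice : X → RA × RAC → MA
  bob : Y → RB × RBC → MB
  referee : MA × MB × RC × RAC × RBC → Z
  measurable_alice : ∀ x, Measurable (alice x)
  measurable_bob : ∀ y, Measurable (bob y)
  measurable_referee : Measurable[_, ⊤] referee

namespace SMPProtocol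

attribute [instance] measRA measRB measRC measRAC measRBC probA probB probC probAC probBC
  countableMA countableMB nonemptyMA nonemptyMB measMA measMB discreteMA discreteMB

variable {X Y Z : Type*}

/-- The tuple `(r_A, r_B, r_C, r_AC, r_BC)` of all random strings. -/
abbrev Coins (P : SMPProtocol X Y Z) : Type := P.RA × P.RB × P.RC × P.RAC × P.RBC

/-- The five random strings are independent. -/
def coinLaw (P : SMPProtocol X Y Z) : Measure P.Coins :=
  P.lawA.prod (P.lawB.prod (P.lawC.prod (P.lawAC.prod P.lawBC)))

instance (P : SMPProtocol X Y Z) : IsProbabilityMeasure P.coinLaw := by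
  unfold coinLaw; infer_instance

/-- Shared randomness of Alice and the referee. -/
def sharedA (P : SMPProtocol X Y Z) (r : P.Coins) : P.RAC := r.2.2.2.1

/-- Shared randomness of Bob and the referee. -/
def sharedB (P : SMPProtocol X Y Z) (r : P.Coins) : P.RBC := r.2.2.2.2

/-- Alice's message on input `x`. -/
def msgA (P : SMPProtocol X Y Z) (x : X) (r : P.Coins) : P.MA := P.alice x (r.1, P.sharedA r)

/-- Bob's message on input `y`. -/
def msgB (P : SMPProtocol X Y Z) (y : Y) (r : P.Coins) : P.MB := P.bob y (r.2.1, P.sharedB r)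

/-- The referee's output on inputs `x` and `y`. -/
def output (P : SMPProtocol X Y Z) (x : X) (y : Y) (r : P.Coins) : Z :=
  P.referee (P.msgA x r, P.msgB y r, r.2.2.1, P.sharedA r, P.sharedB r)

/-- `P` computes `f` with (worst-case) error at most `ε`. -/
def Computes (P : SMPProtocol X Y Z) (f : X → Y → Z) (ε : ℝ) : Prop :=
  ∀ x y, P.coinLaw.real {r | P.output x y r ≠ f x y} ≤ ε

/-- `P` computes `n` copies of `f` in parallel, each copy with (worst-case) error at most `ε`. -/
def ComputesCopies {n : ℕ} (P : SMPProtocol (Fin n → X) (Fin n → Y) (Fin n → Z))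
    (f : X → Y → Z) (ε : ℝ) : Prop :=
  ∀ x y i, P.coinLaw.real {r | P.output x y r i ≠ f (x i) (y i)} ≤ ε

section Information

variable [Finite X] [Nonempty X] [MeasurableSpace X] [DiscreteMeasurableSpace X]
  [Finite Y] [Nonempty Y] [MeasurableSpace Y] [DiscreteMeasurableSpace Y]

/-- `IC(P, μ) = I(X; M_A | R_AC) + I(Y; M_B | R_BC)`, where the inputs `(X, Y)` have law `μ` and are
independent of the coins. -/
def infoCostAt (P : SMPProtocol X Y Z) (μ : Measure (X × Y)) [IsProbabilityMeasure μ] : ℝ≥0∞ :=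
  condMutualInfo (fun ω : (X × Y) × P.Coins => ω.1.1) (fun ω => P.msgA ω.1.1 ω.2)
      (fun ω => P.sharedA ω.2) (μ.prod P.coinLaw) +
    condMutualInfo (fun ω : (X × Y) × P.Coins => ω.1.2) (fun ω => P.msgB ω.1.2 ω.2)
      (fun ω => P.sharedB ω.2) (μ.prod P.coinLaw)

/-- `IC(P)`, the maximum of `IC(P, μ)` over all joint input distributions. -/
def infoCost (P : SMPProtocol X Y Z) : ℝ≥0∞ :=
  ⨆ (μ : Measure (X × Y)) (_ : IsProbabilityMeasure μ), P.infoCostAt μ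

end Information

end SMPProtocol

/-- A binary encoding of the elements of `M` by pairwise distinct words, none of which is a prefix
of another. -/
def IsPrefixCode {M : Type*} (enc : M → List Bool) : Prop :=
  ∀ m m', enc m <+: enc m' → m = m'

/-- A protocol in the average length model: the (possibly infinitely many) messages
carry the bit lengths of a variable-length prefix-free binary encoding. -/
structure AvgSMPProtocol (X Y Z : Type*) extends SMPProtocol X Y Z where
  encA : MA → List Bool
  encB : MB → List Bool
  prefixA : IsPrefixCode encA
  prefixB : IsPrefixCode encB

namespace AvgSMPProtocol

variable {X Y Z : Type*}

/-- Expected total length of the two messages on inputs `x` and `y`. -/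
def avgCostAt (P : AvgSMPProtocol X Y Z) (x : X) (y : Y) : ℝ≥0∞ :=
  ∫⁻ r, (((P.encA (P.msgA x r)).length + (P.encB (P.msgB y r)).length : ℕ) : ℝ≥0∞) ∂P.coinLaw

/-- Average communication cost `CC_av(P)`, on worst-case inputs. -/
def avgCost (P : AvgSMPProtocol X Y Z) : ℝ≥0∞ :=
  ⨆ (x : X) (y : Y), P.avgCostAt x y

end AvgSMPProtocol

/-- Information complexity `IC(f, ε)`: the least information cost of a shared randomness
protocol (with finite message sets) that computes `f` with error at most `ε`. -/
def infoComplexity {X Y Z : Type*}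
    [Finite X] [Nonempty X] [MeasurableSpace X] [DiscreteMeasurableSpace X]
    [Finite Y] [Nonempty Y] [MeasurableSpace Y] [DiscreteMeasurableSpace Y]
    (f : X → Y → Z) (ε : ℝ) : ℝ≥0∞ :=
  ⨅ (P : SMPProtocol X Y Z) (_ : Finite P.MA) (_ : Finite P.MB) (_ : P.Computes f ε), P.infoCost

/-- Average-length communication complexity of computing `n` copies of `f` in parallel, with error
at most `ε` on each copy. -/
def avgCommCopies {X Y Z : Type*} (f : X → Y → Z) (ε : ℝ) (n : ℕ) : ℝ≥0∞ :=
  ⨅ (P : AvgSMPProtocol (Fin n → X) (Fin n → Y) (Fin n → Z)) (_ : P.ComputesCopies f ε), P.avgCost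

/-- Amortized average-length communication complexity `ACC(f, ε)`: the asymptotic cost per copy. -/
def amortizedComm {X Y Z : Type*} (f : X → Y → Z) (ε : ℝ) : ℝ≥0∞ :=
  limsup (fun n : ℕ => avgCommCopies f ε n / n) atTop

end

/-! ### Entropy and mutual information of finite channels -/

namespace SMP

open Real (negMulLog log)

noncomputable section

/-! The statement is about channels whose state (the string shared with the referee) is known to the
receiver. The information cost depends on the input law only through its two marginals, and these
can be chosen independently. Hence it is the sum of the capacities of Alice's and Bob's channels
(`infoCost_eq_capacity`). The error depends only on the joint law of each message with its shared
string (`coinLaw_output`), so a protocol may be replaced by any other that induces the same two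
channels.

`IC ≤ ACC`. Take a protocol for `n` copies. Kraft's and Gibbs' inequalities bound the information
that a message carries about its word, under any word distribution, by the expected length
(`IsChannel.avgInfo_le_length`). To reach single-letter capacities, and not just informations for
one fixed distribution, the word distribution is built letter by letter along the chain rule. The
result (`exists_singleLetter`) gives, for each position, a random filling of the other positions
such that the capacities of the `n` resulting channels have total at most the information of the
word, up to an arbitrarily small slack. Alice and Bob fill independently with private coins, so no
randomness common to both is needed, and some position costs at most the average. Infinite message
sets are first cut down to finite ones, which raises the error slightly. This is repaired by letting
each party reveal its input with a small probability `δ`: the error shrinks by the factor `1 - δ ^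
2`, at an extra information cost of order `δ` (`infoComplexity_le_add`).

`ACC ≤ IC`. Take a one-copy protocol and use one draw of its shared strings for all `n` copies.
Given the string, Alice needs the referee to obtain messages with the product law `P` belonging to
her word. She sends the empirical distribution of the word, which takes `O(log n)` bits. The referee
then knows the product `Q` of the corresponding output distribution, and the divergence of `P` from
`Q` is exactly `n` times the mutual information for the empirical distribution
(`sum_wordDist_log_empDist`); averaged over the string, this is at most `n` times the capacity.
Shared randomness supplies a sequence of samples from `Q` with uniform heights, and Alice sends the
index of one that she accepts. Plain rejection sampling would pay for the largest likelihood ratio.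
Drawing first the rounded logarithm of the ratio (the level) and then sampling inside that level
makes the expected index length close to the divergence (`lintegral_simIndex_le`,
`exists_simulation`). The simulation is exact, so the error on each copy does not grow. The overhead
is sublinear in `n`, apart from a factor `(1 + 1 / b) ^ 2`, where the block size `b` is arbitrary.
-/

/-- Shannon entropy, in nats. -/
def entropy {M : Type*} [Fintype M] (p : M → ℝ) : ℝ := ∑ m, negMulLog (p m)

/-- The output distribution of the channel `p` on an input with distribution `μ`. -/
def mixture {X M : Type*} [Fintype X] (μ : X → ℝ) (p : X → M → ℝ) (m : M) : ℝ := ∑ x, μ x * p x m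

/-- Mutual information, in nats, between the input and the output of the channel `p`, when the
input has distribution `μ`. -/
def mutualInfo {X M : Type*} [Fintype X] [Fintype M] (μ : X → ℝ) (p : X → M → ℝ) : ℝ :=
  entropy (mixture μ p) - ∑ x, μ x * entropy (p x)

section Finite

variable {X M : Type*} [Fintype X] [Fintype M]

lemma le_one_of_mem_stdSimplex {p : M → ℝ} (hp : p ∈ stdSimplex ℝ M) (m : M) : p m ≤ 1 :=
  (mem_Icc_of_mem_stdSimplex hp m).2

lemma entropy_nonneg {p : M → ℝ} (hp : p ∈ stdSimplex ℝ M) : 0 ≤ entropy p :=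
  Finset.sum_nonneg fun m _ => Real.negMulLog_nonneg (hp.1 m) (le_one_of_mem_stdSimplex hp m)

lemma mixture_mem_stdSimplex {μ : X → ℝ} {p : X → M → ℝ} (hμ : μ ∈ stdSimplex ℝ X)
    (hp : ∀ x, p x ∈ stdSimplex ℝ M) : mixture μ p ∈ stdSimplex ℝ M := by
  refine ⟨fun m => Finset.sum_nonneg fun x _ => mul_nonneg (hμ.1 x) ((hp x).1 m), ?_⟩
  simp only [mixture]
  rw [Finset.sum_comm]
  simp [← Finset.mul_sum, (hp _).2, hμ.2]

/-- Gibbs' inequality: the entropy is at most the cross entropy. -/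
lemma entropy_le_crossEntropy {p q : M → ℝ} (hp : p ∈ stdSimplex ℝ M) (hq : ∀ m, 0 < q m)
    (hq1 : ∑ m, q m ≤ 1) : entropy p ≤ ∑ m, p m * (-log (q m)) := by
  -- This is `log t ≤ t - 1` at `t = q m / p m`; the right-hand sides have a sum of at most zero.
  have key : ∀ m, negMulLog (p m) - p m * (-log (q m)) ≤ q m - p m := by
    intro m
    rcases (hp.1 m).eq_or_lt with h | h
    · simp [← h, (hq m).le]
    · have h1 := Real.log_le_sub_one_of_pos (div_pos (hq m) h)
      rw [Real.log_div (hq m).ne' h.ne'] at h1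
      have h2 := mul_le_mul_of_nonneg_left h1 h.le
      have h3 : p m * (q m / p m - 1) = q m - p m := by field_simp
      rw [h3] at h2
      simp only [negMulLog]
      linarith
  have := Finset.sum_le_sum fun m (_ : m ∈ Finset.univ) => key m
  simp only [Finset.sum_sub_distrib, hp.2] at this
  simp only [entropy]
  linarith

lemma entropy_le_log_card {p : M → ℝ} (hp : p ∈ stdSimplex ℝ M) :
    entropy p ≤ log (Fintype.card M) := by
  have hM : Nonempty M := by
    by_contra h
    rw [not_nonempty_iff] at h
    simpa using hp.2
  have hc : (0 : ℝ) < Fintype.card M := by exact_mod_cast Fintype.card_pos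
  have := entropy_le_crossEntropy (q := fun _ => (Fintype.card M : ℝ)⁻¹) hp (fun _ => by positivity)
    (by simp [hc.ne'])
  simpa [← Finset.sum_mul, hp.2] using this

/-- Jensen's inequality for the concave function `negMulLog`, one output letter at a time. -/
lemma mutualInfo_nonneg {μ : X → ℝ} {p : X → M → ℝ} (hμ : μ ∈ stdSimplex ℝ X)
    (hp : ∀ x, p x ∈ stdSimplex ℝ M) : 0 ≤ mutualInfo μ p := by
  have key : ∀ m, ∑ x, μ x * negMulLog (p x m) ≤ negMulLog (mixture μ p m) := fun m => by
    simpa [mixture, smul_eq_mul] using Real.concaveOn_negMulLog.le_map_sum (t := Finset.univ)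
      (w := μ) (p := fun x => p x m) (fun x _ => hμ.1 x) hμ.2 (fun x _ => (hp x).1 m)
  have := Finset.sum_le_sum fun m (_ : m ∈ Finset.univ) => key m
  rw [Finset.sum_comm] at this
  simp only [← Finset.mul_sum] at this
  simpa [mutualInfo, entropy] using this

/-- Drop the conditional entropies and apply Gibbs' inequality to the mixture. With `q m = 2 ^ (-ℓ
m)` the right-hand side is an expected codeword length in nats. -/
lemma mutualInfo_le_crossEntropy {μ : X → ℝ} {p : X → M → ℝ} {q : M → ℝ}
    (hμ : μ ∈ stdSimplex ℝ X) (hp : ∀ x, p x ∈ stdSimplex ℝ M) (hq : ∀ m, 0 < q m)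
    (hq1 : ∑ m, q m ≤ 1) : mutualInfo μ p ≤ ∑ x, μ x * ∑ m, p x m * (-log (q m)) := by
  have h1 := entropy_le_crossEntropy (mixture_mem_stdSimplex hμ hp) hq hq1
  have h2 : 0 ≤ ∑ x, μ x * entropy (p x) :=
    Finset.sum_nonneg fun x _ => mul_nonneg (hμ.1 x) (entropy_nonneg (hp x))
  have h3 : ∑ m, mixture μ p m * (-log (q m)) = ∑ x, μ x * ∑ m, p x m * (-log (q m)) := by
    simp only [mixture, Finset.sum_mul, Finset.mul_sum]
    rw [Finset.sum_comm]
    simp only [mul_assoc]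
  unfold mutualInfo
  linarith

lemma mutualInfo_le_log_card {μ : X → ℝ} {p : X → M → ℝ} (hμ : μ ∈ stdSimplex ℝ X)
    (hp : ∀ x, p x ∈ stdSimplex ℝ M) : mutualInfo μ p ≤ log (Fintype.card M) := by
  have h1 := entropy_le_log_card (mixture_mem_stdSimplex hμ hp)
  have h2 : 0 ≤ ∑ x, μ x * entropy (p x) :=
    Finset.sum_nonneg fun x _ => mul_nonneg (hμ.1 x) (entropy_nonneg (hp x))
  unfold mutualInfo
  linarith

/-- With probability `δ`, the input is sent along with the message of the channel `p`. -/
def reveal [DecidableEq X] (δ : ℝ) (p : X → M → ℝ) (x : X) (m : M × Option X) : ℝ :=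
  m.2.elim ((1 - δ) * p x m.1) fun x' => if x' = x then δ * p x m.1 else 0

lemma sum_reveal [DecidableEq X] (δ : ℝ) (p : X → M → ℝ) (x : X) (F : M × Option X → ℝ) :
    ∑ m, reveal δ p x m * F m =
      (1 - δ) * ∑ m, p x m * F (m, none) + δ * ∑ m, p x m * F (m, some x) := by
  simp [Fintype.sum_prod_type, Fintype.sum_option, reveal, Finset.sum_add_distrib, Finset.mul_sum,
    mul_assoc]

lemma reveal_mem_stdSimplex [DecidableEq X] {δ : ℝ} (h0 : 0 ≤ δ) (h1 : δ ≤ 1) {p : X → M → ℝ}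
    (hp : ∀ x, p x ∈ stdSimplex ℝ M) (x : X) : reveal δ p x ∈ stdSimplex ℝ (M × Option X) := by
  refine ⟨?_, ?_⟩
  · rintro ⟨m, _ | x'⟩
    · exact mul_nonneg (by linarith) ((hp x).1 m)
    · simp only [reveal, Option.elim]
      split_ifs
      · exact mul_nonneg h0 ((hp x).1 m)
      · exact le_rfl
  · have := sum_reveal δ p x 1
    simp only [Pi.one_apply, mul_one, (hp x).2] at this
    linarith

lemma entropy_reveal [DecidableEq X] (δ : ℝ) {p : X → M → ℝ}
    (hp : ∀ x, p x ∈ stdSimplex ℝ M) (x : X) :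
    entropy (reveal δ p x) = negMulLog (1 - δ) + negMulLog δ + entropy (p x) := by
  have h : ∀ m (o : Option X), negMulLog (reveal δ p x (m, o)) =
      o.elim (p x m * negMulLog (1 - δ) + (1 - δ) * negMulLog (p x m))
        fun x' => if x' = x then p x m * negMulLog δ + δ * negMulLog (p x m) else 0 := by
    rintro m (_ | x')
    · simp [reveal, Real.negMulLog_mul]
    · by_cases h : x' = x <;> simp [reveal, h, Real.negMulLog_mul]
  simp only [entropy, Fintype.sum_prod_type, h, Fintype.sum_option, Option.elim,
    Finset.sum_ite_eq', Finset.mem_univ, if_true, Finset.sum_add_distrib, ← Finset.sum_mul,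
    (hp x).2, ← Finset.mul_sum]
  ring

/-- Whether the input is revealed is decided independently of the input and of the message. If it
is, the output determines the input and the information is the full entropy of the input. -/
lemma mutualInfo_reveal [DecidableEq X] (δ : ℝ) {μ : X → ℝ} {p : X → M → ℝ}
    (hμ : μ ∈ stdSimplex ℝ X) (hp : ∀ x, p x ∈ stdSimplex ℝ M) :
    mutualInfo μ (reveal δ p) = (1 - δ) * mutualInfo μ p + δ * entropy μ := by
  have h : ∀ m (o : Option X), negMulLog (mixture μ (reveal δ p) (m, o)) =
      o.elim (mixture μ p m * negMulLog (1 - δ) + (1 - δ) * negMulLog (mixture μ p m))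
        fun x => μ x * p x m * negMulLog δ + δ * (p x m * negMulLog (μ x) +
          μ x * negMulLog (p x m)) := by
    rintro m (_ | x)
    · have : mixture μ (reveal δ p) (m, none) = (1 - δ) * mixture μ p m := by
        simp only [mixture, reveal, Option.elim, Finset.mul_sum]
        exact Finset.sum_congr rfl fun _ _ => by ring
      rw [this, Real.negMulLog_mul]
      rfl
    · have : mixture μ (reveal δ p) (m, some x) = δ * (μ x * p x m) := by
        simp only [mixture, reveal, Option.elim, mul_ite, mul_zero, Finset.sum_ite_eq,
          Finset.mem_univ, if_true]
        ring
      rw [this, Real.negMulLog_mul, Real.negMulLog_mul]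
      rfl
  have e1 : entropy (mixture μ (reveal δ p)) = negMulLog (1 - δ) + (1 - δ) * entropy (mixture μ p) +
      negMulLog δ + δ * (entropy μ + ∑ x, μ x * entropy (p x)) := by
    simp only [entropy, Fintype.sum_prod_type, h, Fintype.sum_option, Option.elim,
      Finset.sum_add_distrib, ← Finset.sum_mul, (mixture_mem_stdSimplex hμ hp).2, ← Finset.mul_sum,
      one_mul]
    rw [Finset.sum_comm (f := fun m x => μ x * p x m), Finset.sum_comm (f := fun m x => p x m * _),
      Finset.sum_comm (f := fun m x => μ x * negMulLog (p x m))]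
    simp only [← Finset.sum_mul, ← Finset.mul_sum, (hp _).2, mul_one, hμ.2, one_mul]
    ring
  simp only [mutualInfo, e1, entropy_reveal δ hp, mul_add, Finset.sum_add_distrib,
    ← Finset.sum_mul, hμ.2]
  ring

end Finite

/-! ### Channels with a random state known to the receiver -/

/-- A channel from `X` to a finite set `M` with a state in `S`, given by its transition
probabilities. -/
structure IsChannel {X S M : Type*} [Fintype M] [MeasurableSpace S] (p : X → S → M → ℝ) : Prop where
  mem : ∀ x s, p x s ∈ stdSimplex ℝ M
  meas : ∀ x m, Measurable fun s => p x s m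

/-- Conditional mutual information, in nats, of the input and the output of a channel with state
distribution `ν` given the state. -/
def avgInfo {X S M : Type*} [Fintype X] [Fintype M] [MeasurableSpace S] (ν : Measure S)
    (μ : X → ℝ) (p : X → S → M → ℝ) : ℝ :=
  ∫ s, mutualInfo μ (fun x => p x s) ∂ν

/-- The random choice of `w` belongs to the channel and not to the state: it is private to the
sender. -/
lemma IsChannel.mixture {X S M W : Type*} [Fintype M] [MeasurableSpace S] [Fintype W]
    {p : W → S → M → ℝ} (hp : IsChannel p) {c : X → W → ℝ} (hc : ∀ x, c x ∈ stdSimplex ℝ W) :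
    IsChannel fun x s => mixture (c x) fun w => p w s where
  mem x s := mixture_mem_stdSimplex (hc x) fun w => hp.mem w s
  meas _ m := Finset.measurable_sum _ fun w _ => (hp.meas w m).const_mul _

section Channel

variable {X S M : Type*} [Fintype X] [Fintype M] [MeasurableSpace S]

lemma IsChannel.measurable_mutualInfo {p : X → S → M → ℝ} (hp : IsChannel p) (μ : X → ℝ) :
    Measurable fun s => mutualInfo μ (fun x => p x s) := by
  have := hp.meas
  unfold mutualInfo entropy SMP.mixture
  refine Measurable.sub ?_ ?_
  · exact Finset.measurable_sum _ fun m _ => Real.continuous_negMulLog.measurable.comp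
      (Finset.measurable_sum _ fun x _ => (this x m).const_mul _)
  · exact Finset.measurable_sum _ fun x _ => Measurable.const_mul
      (Finset.measurable_sum _ fun m _ => Real.continuous_negMulLog.measurable.comp (this x m)) _

lemma IsChannel.avgInfo_nonneg (ν : Measure S) {p : X → S → M → ℝ} (hp : IsChannel p) {μ : X → ℝ}
    (hμ : μ ∈ stdSimplex ℝ X) : 0 ≤ avgInfo ν μ p :=
  integral_nonneg fun s => mutualInfo_nonneg hμ fun x => hp.mem x s

variable (ν : Measure S) [IsProbabilityMeasure ν]

lemma IsChannel.integrable_mutualInfo {p : X → S → M → ℝ} (hp : IsChannel p) {μ : X → ℝ}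
    (hμ : μ ∈ stdSimplex ℝ X) : Integrable (fun s => mutualInfo μ (fun x => p x s)) ν := by
  refine Integrable.of_bound (hp.measurable_mutualInfo μ).aestronglyMeasurable
    (log (Fintype.card M)) (ae_of_all _ fun s => ?_)
  rw [Real.norm_of_nonneg (mutualInfo_nonneg hμ fun x => hp.mem x s)]
  exact mutualInfo_le_log_card hμ fun x => hp.mem x s

lemma IsChannel.avgInfo_le_log_card {p : X → S → M → ℝ} (hp : IsChannel p) {μ : X → ℝ}
    (hμ : μ ∈ stdSimplex ℝ X) : avgInfo ν μ p ≤ log (Fintype.card M) := by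
  refine (integral_mono (hp.integrable_mutualInfo ν hμ) (integrable_const _)
    fun s => mutualInfo_le_log_card hμ fun x => hp.mem x s).trans ?_
  simp

lemma IsChannel.reveal [DecidableEq X] {p : X → S → M → ℝ} (hp : IsChannel p) {δ : ℝ} (h0 : 0 ≤ δ)
    (h1 : δ ≤ 1) : IsChannel fun x s => SMP.reveal δ (fun x => p x s) x where
  mem x s := reveal_mem_stdSimplex h0 h1 (fun x => hp.mem x s) x
  meas := by
    rintro x ⟨m, _ | x'⟩
    · exact (hp.meas x m).const_mul _
    · by_cases h : x' = x
      · simpa [SMP.reveal, h] using (hp.meas x m).const_mul _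
      · simp [SMP.reveal, h]

lemma IsChannel.avgInfo_reveal_le [DecidableEq X] {p : X → S → M → ℝ} (hp : IsChannel p) {δ : ℝ}
    (h0 : 0 ≤ δ) {μ : X → ℝ} (hμ : μ ∈ stdSimplex ℝ X) :
    avgInfo ν μ (fun x s => SMP.reveal δ (fun x => p x s) x) ≤
      avgInfo ν μ p + δ * log (Fintype.card X) := by
  have hi := hp.integrable_mutualInfo ν hμ
  calc _ = ∫ s, ((1 - δ) * mutualInfo μ (fun x => p x s) + δ * entropy μ) ∂ν :=
        integral_congr_ae (ae_of_all _ fun s => mutualInfo_reveal δ hμ fun x => hp.mem x s)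
    _ ≤ ∫ s, (mutualInfo μ (fun x => p x s) + δ * log (Fintype.card X)) ∂ν := by
        refine integral_mono ((hi.const_mul _).add (integrable_const _))
          (hi.add (integrable_const _)) fun s => ?_
        have := mul_nonneg h0 (mutualInfo_nonneg hμ fun x => hp.mem x s)
        have := mul_le_mul_of_nonneg_left (entropy_le_log_card hμ) h0
        simp only
        linarith
    _ = _ := by
        rw [integral_add hi (integrable_const _)]
        simp [avgInfo]

end Channel

/-! ### Single-letterization -/

/-- Extension of a distribution on words of length `n` by the first letter `a`. -/
def consDist {X : Type*} [DecidableEq X] {n : ℕ} (a : X) (τ : (Fin n → X) → ℝ)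
    (w : Fin (n + 1) → X) : ℝ :=
  if w 0 = a then τ (Fin.tail w) else 0

section Words

variable {X : Type*} [Fintype X] {n : ℕ}

lemma sum_words_succ (F : (Fin (n + 1) → X) → ℝ) :
    ∑ w, F w = ∑ a, ∑ w : Fin n → X, F (Fin.cons a w) := by
  rw [← Fintype.sum_prod_type']
  exact (Fintype.sum_equiv (Fin.consEquiv fun _ => X) _ _ fun _ => rfl).symm

/-- The chain rule `I(X₀ X'; M) = I(X₀; M) + I(X'; M | X₀)`. -/
lemma mutualInfo_cons {M : Type*} [Fintype M] (ν₀ : X → ℝ) (σ : X → (Fin n → X) → ℝ)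
    (p : (Fin (n + 1) → X) → M → ℝ) :
    mutualInfo (fun w => ν₀ (w 0) * σ (w 0) (Fin.tail w)) p =
      mutualInfo ν₀ (fun a => mixture (σ a) fun w => p (Fin.cons a w)) +
        ∑ a, ν₀ a * mutualInfo (σ a) (fun w => p (Fin.cons a w)) := by
  have h1 : mixture (fun w => ν₀ (w 0) * σ (w 0) (Fin.tail w)) p =
      mixture ν₀ (fun a => mixture (σ a) fun w => p (Fin.cons a w)) := by
    ext m
    simp [mixture, sum_words_succ, Finset.mul_sum, mul_assoc]
  simp only [mutualInfo, h1, sum_words_succ, Fin.cons_zero, Fin.tail_cons, mul_sub,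
    Finset.sum_sub_distrib, Finset.mul_sum, mul_assoc]
  ring

variable [DecidableEq X]

lemma sum_consDist (a : X) (τ : (Fin n → X) → ℝ) (F : (Fin (n + 1) → X) → ℝ) :
    ∑ w, consDist a τ w * F w = ∑ w, τ w * F (Fin.cons a w) := by
  rw [sum_words_succ, Finset.sum_eq_single a]
  · simp [consDist]
  · intro b _ hb
    simp [consDist, hb]
  · simp

lemma consDist_mem_stdSimplex {a : X} {τ : (Fin n → X) → ℝ} (hτ : τ ∈ stdSimplex ℝ (Fin n → X)) :
    consDist a τ ∈ stdSimplex ℝ (Fin (n + 1) → X) := by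
  refine ⟨fun w => ?_, ?_⟩
  · unfold consDist
    split_ifs
    · exact hτ.1 _
    · exact le_rfl
  · simpa [hτ.2] using sum_consDist a τ 1

lemma mixture_consDist {M : Type*} (a : X) (τ : (Fin n → X) → ℝ)
    (p : (Fin (n + 1) → X) → M → ℝ) :
    mixture (consDist a τ) p = mixture τ fun w => p (Fin.cons a w) := by
  ext m
  exact sum_consDist a τ fun w => p w m

end Words

/-- The averaging argument that fixes the first letter in `exists_singleLetter`. -/
lemma exists_le_weighted_sum {X : Type*} [Fintype X] {μ : X → ℝ} (hμ : μ ∈ stdSimplex ℝ X)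
    (v : X → ℝ) : ∃ a, v a ≤ ∑ x, μ x * v x := by
  by_contra! h
  have h1 : ∑ x, μ x * ∑ x, μ x * v x < ∑ x, μ x * v x := by
    obtain ⟨a, ha⟩ : ∃ a, 0 < μ a := by
      by_contra! h0
      have := Finset.sum_nonpos fun x (_ : x ∈ Finset.univ) => h0 x
      rw [hμ.2] at this
      linarith
    exact Finset.sum_lt_sum (fun x _ => mul_le_mul_of_nonneg_left (h x).le (hμ.1 x))
      ⟨a, Finset.mem_univ _, mul_lt_mul_of_pos_left (h a) ha⟩
  rw [← Finset.sum_mul, hμ.2, one_mul] at h1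
  exact lt_irrefl _ h1

/-- Every channel `p` whose inputs are words of length `n` gives for each position `i` a channel
with single letters as inputs, in which the other positions are filled in at random (with a
distribution that may depend on the input letter), such that the sum of the capacities of the `n`
single-letter channels is at most the information of `p` for a suitable distribution `σ`. -/
theorem exists_singleLetter {X S M : Type*} [Fintype X] [Nonempty X] [Fintype M]
    [MeasurableSpace S] (ν : Measure S) [IsProbabilityMeasure ν] {η : ℝ} (hη : 0 < η) (n : ℕ)
    (p : (Fin n → X) → S → M → ℝ) (hp : IsChannel p) :
    ∃ σ ∈ stdSimplex ℝ (Fin n → X), ∃ c : Fin n → X → (Fin n → X) → ℝ, ∃ v : Fin n → ℝ,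
      (∀ i x, c i x ∈ stdSimplex ℝ (Fin n → X)) ∧ (∀ i x w, c i x w ≠ 0 → w i = x) ∧
      (∀ i, ∀ μ ∈ stdSimplex ℝ X,
        avgInfo ν μ (fun x s => mixture (c i x) fun w => p w s) ≤ v i) ∧
      ∑ i, v i ≤ avgInfo ν σ p + n * η := by
  classical
  induction n with
  | zero =>
    refine ⟨Pi.single default 1, single_mem_stdSimplex ℝ _, fun i => i.elim0, fun i => i.elim0,
      fun i => i.elim0, fun i => i.elim0, fun i => i.elim0, ?_⟩
    simpa using hp.avgInfo_nonneg ν (single_mem_stdSimplex ℝ _)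
  | succ n ih =>
    have hpa : ∀ a : X, IsChannel fun w => p (Fin.cons a w) := fun a =>
      ⟨fun w => hp.mem _, fun w => hp.meas _⟩
    -- Induction on the channels with first letter fixed to `a`: the distribution of the remaining
    -- letters may depend on `a`.
    choose σ hσ c v hc hcs hv hsum using fun a => ih (fun w => p (Fin.cons a w)) (hpa a)
    -- The channel of the first letter. Its filling is the very `σ a` used in the word distribution,
    -- so that its information is the first term of the chain rule.
    set K : X → S → M → ℝ := fun a s => mixture (σ a) fun w => p (Fin.cons a w) s with hK
    have hKc : IsChannel K := ⟨fun a s => mixture_mem_stdSimplex (hσ a) fun w => hp.mem _ s,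
      fun a m => Finset.measurable_sum _ fun w _ => (hp.meas _ m).const_mul _⟩
    set T : Set ℝ := (fun μ => avgInfo ν μ K) '' stdSimplex ℝ X with hT
    have hTb : BddAbove T := ⟨log (Fintype.card M), by
      rintro _ ⟨μ, hμ, rfl⟩
      exact hKc.avgInfo_le_log_card ν hμ⟩
    have hTn : T.Nonempty := Set.Nonempty.image _
      ⟨_, single_mem_stdSimplex ℝ (Classical.arbitrary X)⟩
    -- An input distribution for `K` within `η` of the capacity; each position contributes one such
    -- `η`.
    obtain ⟨_, ⟨ν₀, hν₀, rfl⟩, hlt⟩ := exists_lt_of_lt_csSup hTn (sub_lt_self (sSup T) hη)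
    -- Every later position gets its own first letter `a i`, for which its capacity bound is at most
    -- the average under `ν₀`.
    choose a ha using fun i => exists_le_weighted_sum hν₀ (fun x => v x i)
    have hσ' : (fun w : Fin (n + 1) → X => ν₀ (w 0) * σ (w 0) (Fin.tail w)) ∈
        stdSimplex ℝ (Fin (n + 1) → X) := by
      refine ⟨fun w => mul_nonneg (hν₀.1 _) ((hσ _).1 _), ?_⟩
      simp [sum_words_succ, ← Finset.mul_sum, (hσ _).2, hν₀.2]
    refine ⟨_, hσ', Fin.cons (fun x => consDist x (σ x)) fun i x => consDist (a i) (c (a i) i x),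
      Fin.cons (sSup T) fun i => v (a i) i, ?_, ?_, ?_, ?_⟩
    · intro i x
      refine Fin.cases ?_ (fun i => ?_) i
      · exact consDist_mem_stdSimplex (hσ x)
      · exact consDist_mem_stdSimplex (hc (a i) i x)
    · intro i x w
      refine Fin.cases ?_ (fun i => ?_) i
      · intro h
        by_contra h'
        simp [consDist, h'] at h
      · simp only [Fin.cons_succ, consDist]
        split_ifs with h
        · exact hcs (a i) i x (Fin.tail w)
        · simp
    · intro i μ hμ
      refine Fin.cases ?_ (fun i => ?_) i
      · simp only [Fin.cons_zero, mixture_consDist]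
        exact le_csSup hTb ⟨μ, hμ, rfl⟩
      · simp only [Fin.cons_succ, mixture_consDist]
        exact hv (a i) i μ hμ
    · have hchain : avgInfo ν (fun w => ν₀ (w 0) * σ (w 0) (Fin.tail w)) p =
          avgInfo ν ν₀ K + ∑ x, ν₀ x * avgInfo ν (σ x) (fun w => p (Fin.cons x w)) := by
        unfold avgInfo
        simp_rw [mutualInfo_cons]
        rw [integral_add (hKc.integrable_mutualInfo ν hν₀), integral_finsetSum]
        · simp only [integral_const_mul]
        · exact fun x _ => ((hpa x).integrable_mutualInfo ν (hσ x)).const_mul _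
        · exact integrable_finsetSum _ fun x _ =>
            ((hpa x).integrable_mutualInfo ν (hσ x)).const_mul _
      have h1 : ∑ i, v (a i) i ≤ ∑ x, ν₀ x * ∑ i, v x i := by
        refine (Finset.sum_le_sum fun i _ => ha i).trans_eq ?_
        rw [Finset.sum_comm]
        simp only [Finset.mul_sum]
      have h2 : ∑ x, ν₀ x * ∑ i, v x i ≤
          ∑ x, ν₀ x * (avgInfo ν (σ x) (fun w => p (Fin.cons x w)) + n * η) :=
        Finset.sum_le_sum fun x _ => mul_le_mul_of_nonneg_left (hsum x) (hν₀.1 x)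
      simp only [mul_add, Finset.sum_add_distrib, ← Finset.sum_mul, hν₀.2] at h2
      rw [hchain, Fin.sum_univ_succ]
      simp only [Fin.cons_zero, Fin.cons_succ]
      push_cast
      linarith

end

end SMP

/-! ### Conditional mutual information of messages -/

namespace SMP

open Real (negMulLog log)

noncomputable section

/-- As `D` is countable, a measurable set is the countable disjoint union of its slices. -/
lemma ext_of_prod_singleton {S D : Type*} [MeasurableSpace S] [MeasurableSpace D] [Countable D]
    [MeasurableSingletonClass D] {μ ν : Measure (S × D)}
    (h : ∀ t, MeasurableSet t → ∀ d, μ (t ×ˢ {d}) = ν (t ×ˢ {d})) : μ = ν := by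
  ext B hB
  have hm : ∀ d : D, MeasurableSet ((fun s => (s, d)) ⁻¹' B) := fun d => measurable_prodMk_right hB
  have hU : B = ⋃ d : D, ((fun s => (s, d)) ⁻¹' B) ×ˢ {d} := by
    ext ⟨s, d⟩
    simp
  have hd : Pairwise (Function.onFun Disjoint fun d : D => ((fun s => (s, d)) ⁻¹' B) ×ˢ {d}) := by
    intro d d' hdd
    rw [Function.onFun, Set.disjoint_left]
    rintro ⟨s, e⟩ h1 h2
    exact hdd (h1.2.symm.trans h2.2)
  have hmm : ∀ d : D, MeasurableSet (((fun s => (s, d)) ⁻¹' B) ×ˢ ({d} : Set D)) := fun d =>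
    (hm d).prod (measurableSet_singleton d)
  rw [hU, measure_iUnion hd hmm, measure_iUnion hd hmm]
  exact tsum_congr fun d => h _ (hm d) d

/-- The kernel with the given point masses. -/
def weightKernel {S M : Type*} [MeasurableSpace S] [MeasurableSpace M] [Fintype M]
    (p : S → M → ℝ) (hp : ∀ m, Measurable fun s => p s m) : Kernel S M where
  toFun s := ∑ m, ENNReal.ofReal (p s m) • Measure.dirac m
  measurable' := by
    refine Measure.measurable_of_measurable_coe _ fun t ht => ?_
    simp only [Measure.coe_finsetSum, Measure.coe_smul, Finset.sum_apply, Pi.smul_apply,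
      smul_eq_mul]
    exact Finset.measurable_sum _ fun m _ => (hp m).ennreal_ofReal.mul_const _

section WeightKernel

variable {S M : Type*} [MeasurableSpace S] [MeasurableSpace M] [Fintype M] {p : S → M → ℝ}
  (hp : ∀ m, Measurable fun s => p s m)

lemma weightKernel_singleton [MeasurableSingletonClass M] (s : S) (m : M) :
    weightKernel p hp s {m} = ENNReal.ofReal (p s m) := by
  classical
  change (∑ m, ENNReal.ofReal (p s m) • Measure.dirac m) {m} = _
  simp only [Measure.coe_finsetSum, Measure.coe_smul, Finset.sum_apply, Pi.smul_apply,
      smul_eq_mul, Measure.dirac_apply' _ (measurableSet_singleton m)]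
  rw [Finset.sum_eq_single m] <;> simp +contextual [Set.indicator]

lemma lintegral_weightKernel [MeasurableSingletonClass M] (s : S) (f : M → ℝ≥0∞) :
    ∫⁻ m, f m ∂weightKernel p hp s = ∑ m, ENNReal.ofReal (p s m) * f m := by
  change ∫⁻ m, f m ∂(∑ m, ENNReal.ofReal (p s m) • Measure.dirac m) = _
  simp

lemma isMarkovKernel_weightKernel (h : ∀ s, p s ∈ stdSimplex ℝ M) :
    IsMarkovKernel (weightKernel p hp) := by
  refine ⟨fun s => ⟨?_⟩⟩
  change (∑ m, ENNReal.ofReal (p s m) • Measure.dirac m) Set.univ = 1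
  simp only [Measure.coe_finsetSum, Measure.coe_smul, Finset.sum_apply, Pi.smul_apply,
      smul_eq_mul, measure_univ, mul_one]
  rw [← ENNReal.ofReal_sum_of_nonneg fun m _ => (h s).1 m, (h s).2, ENNReal.ofReal_one]

end WeightKernel

/-- The integrand of the Kullback-Leibler divergence that is equal to the mutual information. -/
lemma sum_klFun_eq_mutualInfo {X M : Type*} [Fintype X] [Fintype M] {μ : X → ℝ} {p : X → M → ℝ}
    (hμ : μ ∈ stdSimplex ℝ X) (hp : ∀ x, p x ∈ stdSimplex ℝ M) :
    ∑ x, ∑ m, μ x * (mixture μ p m * klFun (p x m / mixture μ p m)) = mutualInfo μ p := by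
  have hmix := mixture_mem_stdSimplex hμ hp
  -- Since `klFun t = t * log t + 1 - t`, the last two terms are the linear part, and they cancel
  -- after summation. Where the mixture vanishes, `μ x * p x m` vanishes too.
  have key : ∀ x m, μ x * (mixture μ p m * klFun (p x m / mixture μ p m)) =
      μ x * p x m * (-log (mixture μ p m)) - μ x * negMulLog (p x m) + μ x * mixture μ p m -
        μ x * p x m := by
    intro x m
    rcases (hmix.1 m).eq_or_lt with h | h
    · have h0 : μ x * p x m = 0 := by
        have := (Finset.sum_eq_zero_iff_of_nonneg fun x _ => mul_nonneg (hμ.1 x) ((hp x).1 m)).1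
          (show ∑ x, μ x * p x m = 0 from h.symm)
        exact this x (Finset.mem_univ _)
      rw [← h, h0]
      rcases mul_eq_zero.1 h0 with h1 | h1 <;> simp [h1]
    · rcases ((hp x).1 m).eq_or_lt with h1 | h1
      · simp [← h1, klFun]
      · simp only [klFun, negMulLog]
        rw [Real.log_div h1.ne' h.ne']
        field_simp
        ring
  simp only [key, Finset.sum_sub_distrib, Finset.sum_add_distrib]
  have e1 : ∑ x, ∑ m, μ x * p x m * (-log (mixture μ p m)) = entropy (mixture μ p) := by
    rw [Finset.sum_comm]
    simp only [← Finset.sum_mul, entropy, negMulLog]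
    exact Finset.sum_congr rfl fun m _ => by simp [mixture]
  rw [e1]
  simp [← Finset.mul_sum, (hp _).2, hμ.2, hmix.2, mutualInfo, entropy]

section CondMutualInfo

variable {Ω X S M : Type*} [MeasurableSpace Ω] [MeasurableSpace S]
  [Fintype X] [Nonempty X] [MeasurableSpace X] [DiscreteMeasurableSpace X]
  [Fintype M] [Nonempty M] [MeasurableSpace M] [DiscreteMeasurableSpace M]

/-- The conditional mutual information of the input and the output of a channel, given the
state. -/
theorem condMutualInfo_eq_avgInfo (P : Measure Ω) [IsProbabilityMeasure P]
    {U : Ω → X} {V : Ω → M} {W : Ω → S} (hU : Measurable U) (hV : Measurable V)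
    (hW : Measurable W) {ν : Measure S} [IsProbabilityMeasure ν] {μ : X → ℝ}
    (hμ : μ ∈ stdSimplex ℝ X) {p : X → S → M → ℝ} (hp : IsChannel p)
    (hlaw : ∀ t, MeasurableSet t → ∀ x m, P.map (fun ω => (W ω, U ω, V ω)) (t ×ˢ {(x, m)}) =
      ENNReal.ofReal (μ x) * ∫⁻ s in t, ENNReal.ofReal (p x s m) ∂ν) :
    condMutualInfo U V W P = ENNReal.ofReal (avgInfo ν μ p) / ENNReal.ofReal (log 2) := by
  set q : S → M → ℝ := fun s => mixture μ fun x => p x s with hq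
  have hqm : ∀ m, Measurable fun s => q s m := fun m =>
    Finset.measurable_sum _ fun x _ => (hp.meas x m).const_mul _
  have hqs : ∀ s, q s ∈ stdSimplex ℝ M := fun s => mixture_mem_stdSimplex hμ fun x => hp.mem x s
  -- The input is independent of the state, so its conditional law is constant. `κ` below is the
  -- conditional law of the pair, with marginals `κX` and `κM`; uniqueness of disintegrations
  -- identifies these with the `condDistrib` kernels.
  let κX : Kernel S X := weightKernel (fun _ => μ) fun _ => measurable_const
  let κM : Kernel S M := weightKernel q hqm
  have : IsMarkovKernel κX := isMarkovKernel_weightKernel _ fun _ => hμ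
  have : IsMarkovKernel κM := isMarkovKernel_weightKernel _ hqs
  have hmeas : Measurable fun ω => (W ω, U ω, V ω) := hW.prodMk (hU.prodMk hV)
  let κ : Kernel S (X × M) := weightKernel (fun s (z : X × M) => μ z.1 * p z.1 s z.2)
    fun z => (hp.meas z.1 z.2).const_mul _
  have hκs : ∀ s, (fun z : X × M => μ z.1 * p z.1 s z.2) ∈ stdSimplex ℝ (X × M) := fun s =>
    ⟨fun z => mul_nonneg (hμ.1 _) ((hp.mem _ _).1 _), by
      simp [Fintype.sum_prod_type, ← Finset.mul_sum, (hp.mem _ s).2, hμ.2]⟩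
  have : IsMarkovKernel κ := isMarkovKernel_weightKernel _ hκs
  have hJ : P.map (fun ω => (W ω, U ω, V ω)) = ν ⊗ₘ κ := by
    refine ext_of_prod_singleton ?_
    rintro t ht ⟨x, m⟩
    rw [hlaw t ht x m, Measure.compProd_apply_prod ht (measurableSet_singleton _)]
    simp only [κ, weightKernel_singleton]
    simp_rw [ENNReal.ofReal_mul (hμ.1 _)]
    rw [lintegral_const_mul]
    exact (hp.meas x m).ennreal_ofReal
  have hWmap : P.map W = ν := by
    have : P.map W = (P.map fun ω => (W ω, U ω, V ω)).fst := by
      rw [Measure.fst_map_prodMk (hU.prodMk hV)]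
    rw [this, hJ, Measure.fst_compProd]
  have hκfst : κ.map Prod.fst = κX := by
    ext1 s
    refine Measure.ext_of_singleton fun x => ?_
    rw [Kernel.map_apply _ measurable_fst, ← lintegral_indicator_one (measurableSet_singleton x),
      lintegral_map (measurable_of_countable _) measurable_fst]
    simp only [κ, κX]
    rw [lintegral_weightKernel, weightKernel_singleton, Fintype.sum_prod_type,
      Finset.sum_eq_single x]
    · simp only [Set.mem_singleton_iff, Set.indicator_of_mem, Pi.one_apply, mul_one]
      rw [← ENNReal.ofReal_sum_of_nonneg fun m _ => (hκs s).1 (x, m)]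
      simp only [← Finset.mul_sum, (hp.mem x s).2, mul_one]
    · intro b _ hb
      simp [hb]
    · simp
  have hκsnd : κ.map Prod.snd = κM := by
    ext1 s
    refine Measure.ext_of_singleton fun m => ?_
    rw [Kernel.map_apply _ measurable_snd, ← lintegral_indicator_one (measurableSet_singleton m),
      lintegral_map (measurable_of_countable _) measurable_snd]
    simp only [κ, κM]
    rw [lintegral_weightKernel, weightKernel_singleton, Fintype.sum_prod_type_right,
      Finset.sum_eq_single m]
    · simp only [Set.mem_singleton_iff, Set.indicator_of_mem, Pi.one_apply, mul_one]
      rw [← ENNReal.ofReal_sum_of_nonneg fun x _ => (hκs s).1 (x, m)]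
      rfl
    · intro b _ hb
      simp [hb]
    · simp
  have hcU : condDistrib U W P =ᵐ[P.map W] κX := by
    refine condDistrib_ae_eq_of_measure_eq_compProd _ hU.aemeasurable ?_
    have : P.map (fun ω => (W ω, U ω)) =
        (P.map fun ω => (W ω, U ω, V ω)).map (Prod.map id Prod.fst) := by
      rw [Measure.map_map (by fun_prop) hmeas]
      rfl
    rw [this, hJ, hWmap, ← Measure.compProd_map measurable_fst, hκfst]
  have hcV : condDistrib V W P =ᵐ[P.map W] κM := by
    refine condDistrib_ae_eq_of_measure_eq_compProd _ hV.aemeasurable ?_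
    have : P.map (fun ω => (W ω, V ω)) =
        (P.map fun ω => (W ω, U ω, V ω)).map (Prod.map id Prod.snd) := by
      rw [Measure.map_map (by fun_prop) hmeas]
      rfl
    rw [this, hJ, hWmap, ← Measure.compProd_map measurable_snd, hκsnd]
  have hR : P.map W ⊗ₘ (condDistrib U W P ×ₖ condDistrib V W P) = ν ⊗ₘ (κX ×ₖ κM) := by
    have : condDistrib U W P ×ₖ condDistrib V W P =ᵐ[P.map W] κX ×ₖ κM := by
      filter_upwards [hcU, hcV] with s h1 h2
      rw [Kernel.prod_apply, Kernel.prod_apply, h1, h2]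
    rw [Measure.compProd_congr this, hWmap]
  have hRint : ∀ f : S × X × M → ℝ≥0∞, Measurable f → ∫⁻ z, f z ∂(ν ⊗ₘ (κX ×ₖ κM)) =
      ∫⁻ s, ∑ x, ∑ m, ENNReal.ofReal (μ x) * (ENNReal.ofReal (q s m) * f (s, x, m)) ∂ν := by
    intro f hf
    rw [Measure.lintegral_compProd hf]
    refine lintegral_congr fun s => ?_
    rw [Kernel.lintegral_prod _ _ _ (measurable_of_countable _)]
    simp only [κX, κM, lintegral_weightKernel, Finset.mul_sum]
  set g : S × X × M → ℝ := fun z => p z.2.1 z.1 z.2.2 / q z.1 z.2.2 with hg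
  have hgm : Measurable g := by
    have h : ∀ z : X × M, Measurable fun s => g (s, z) := fun z =>
      (hp.meas z.1 z.2).div (hqm z.2)
    exact measurable_from_prod_countable_left h
  have hg0 : ∀ z, 0 ≤ g z := fun z => div_nonneg ((hp.mem _ _).1 _) ((hqs _).1 _)
  -- An explicit density `p / q` gives both absolute continuity and the Radon–Nikodym derivative.
  -- Where `q = 0` the quotient has the junk value `0`, which is right because `μ x * p x s m = 0`
  -- there.
  have hdens : ν ⊗ₘ κ = (ν ⊗ₘ (κX ×ₖ κM)).withDensity fun z => ENNReal.ofReal (g z) := by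
    refine ext_of_prod_singleton ?_
    rintro t ht ⟨x, m⟩
    have htx : MeasurableSet (t ×ˢ ({(x, m)} : Set (X × M))) := ht.prod (measurableSet_singleton _)
    rw [withDensity_apply _ htx, ← lintegral_indicator htx,
      hRint _ (hgm.ennreal_ofReal.indicator htx),
      Measure.compProd_apply_prod ht (measurableSet_singleton _), ← lintegral_indicator ht]
    refine lintegral_congr fun s => ?_
    by_cases hs : s ∈ t
    · rw [Set.indicator_of_mem hs, Finset.sum_eq_single x, Finset.sum_eq_single m]
      · rw [Set.indicator_of_mem (by simp [hs])]
        simp only [κ, weightKernel_singleton, hg]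
        rw [← ENNReal.ofReal_mul ((hqs s).1 m), ← ENNReal.ofReal_mul (hμ.1 x)]
        congr 1
        by_cases h : q s m = 0
        · have := (Finset.sum_eq_zero_iff_of_nonneg fun x _ =>
            mul_nonneg (hμ.1 x) ((hp.mem x s).1 m)).1 (show ∑ x, μ x * p x s m = 0 from h)
          simp [h, this x (Finset.mem_univ _)]
        · field_simp
      · intro m' _ h
        simp [h]
      · simp
      · intro x' _ h
        simp [h]
      · simp
    · rw [Set.indicator_of_notMem hs]
      simp [hs]
  have hac : ν ⊗ₘ κ ≪ ν ⊗ₘ (κX ×ₖ κM) := by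
    rw [hdens]
    exact withDensity_absolutelyContinuous _ _
  have hkl : klDiv (ν ⊗ₘ κ) (ν ⊗ₘ (κX ×ₖ κM)) = ENNReal.ofReal (avgInfo ν μ p) := by
    rw [klDiv_eq_lintegral_klFun_of_ac hac]
    have h1 : (ν ⊗ₘ κ).rnDeriv (ν ⊗ₘ (κX ×ₖ κM)) =ᵐ[ν ⊗ₘ (κX ×ₖ κM)]
        fun z => ENNReal.ofReal (g z) := by
      rw [hdens]
      exact Measure.rnDeriv_withDensity _ hgm.ennreal_ofReal
    have h2 : ∀ᵐ z ∂(ν ⊗ₘ (κX ×ₖ κM)), ENNReal.ofReal (klFun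
        ((ν ⊗ₘ κ).rnDeriv (ν ⊗ₘ (κX ×ₖ κM)) z).toReal) = ENNReal.ofReal (klFun (g z)) := by
      filter_upwards [h1] with z hz
      rw [hz, ENNReal.toReal_ofReal (hg0 z)]
    have hkm : Measurable fun z => ENNReal.ofReal (klFun (g z)) :=
      (measurable_klFun.comp hgm).ennreal_ofReal
    rw [lintegral_congr_ae h2, hRint _ hkm, avgInfo,
      ofReal_integral_eq_lintegral_ofReal (hp.integrable_mutualInfo ν hμ)
        (ae_of_all _ fun s => mutualInfo_nonneg hμ fun x => hp.mem x s)]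
    refine lintegral_congr fun s => ?_
    rw [← sum_klFun_eq_mutualInfo hμ fun x => hp.mem x s]
    have hnn : ∀ x m, 0 ≤ μ x * (q s m * klFun (g (s, x, m))) := fun x m =>
      mul_nonneg (hμ.1 x) (mul_nonneg ((hqs s).1 m) (klFun_nonneg (hg0 _)))
    rw [ENNReal.ofReal_sum_of_nonneg fun x _ => Finset.sum_nonneg fun m _ => hnn x m]
    refine Finset.sum_congr rfl fun x _ => ?_
    rw [ENNReal.ofReal_sum_of_nonneg fun m _ => hnn x m]
    refine Finset.sum_congr rfl fun m _ => ?_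
    rw [ENNReal.ofReal_mul (hμ.1 x), ENNReal.ofReal_mul ((hqs s).1 m)]
  rw [condMutualInfo, hR, hJ, hkl]

end CondMutualInfo

end

end SMP

/-! ### Joint laws of shared randomness and messages -/

namespace SMP

open Real (negMulLog log)
open scoped unitInterval

noncomputable section

/-- The law of the state and the output of a channel with transition probabilities `p`. -/
def chanLaw {S M : Type*} [MeasurableSpace S] [MeasurableSpace M] [Fintype M] (ν : Measure S)
    (p : S → M → ℝ) : Measure (S × M) :=
  ∑ m, (ν.withDensity fun s => ENNReal.ofReal (p s m)).map fun s => (s, m)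

/-- The probability, over the private randomness, that the message is `m`. -/
def msgProb {X R S M : Type*} [MeasurableSpace R] (lawR : Measure R) (enc : X → R × S → M)
    (x : X) (s : S) (m : M) : ℝ :=
  lawR.real {ρ | enc x (ρ, s) = m}

/-- The joint law of the shared randomness and the message on input `x`. -/
def jointLaw {X R S M : Type*} [MeasurableSpace R] [MeasurableSpace S] [MeasurableSpace M]
    (lawR : Measure R) (lawS : Measure S) (enc : X → R × S → M) (x : X) : Measure (S × M) :=
  (lawR.prod lawS).map fun r => (r.2, enc x r)

/-- The maximum over all input distributions, in bits, of the conditional mutual information of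
input and output given the state. -/
def capacity {X S M : Type*} [Fintype X] [Fintype M] [MeasurableSpace S] (ν : Measure S)
    (p : X → S → M → ℝ) : ℝ≥0∞ :=
  ⨆ μ ∈ stdSimplex ℝ X, ENNReal.ofReal (avgInfo ν μ p) / ENNReal.ofReal (log 2)

section ChanLaw

variable {S M : Type*} [MeasurableSpace S] [MeasurableSpace M] [Fintype M] {ν : Measure S}

lemma lintegral_chanLaw {p : S → M → ℝ} (hp : ∀ m, Measurable fun s => p s m)
    {f : S × M → ℝ≥0∞} (hf : Measurable f) :
    ∫⁻ z, f z ∂chanLaw ν p = ∑ m, ∫⁻ s, ENNReal.ofReal (p s m) * f (s, m) ∂ν := by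
  rw [chanLaw, lintegral_finsetSum_measure]
  refine Finset.sum_congr rfl fun m _ => ?_
  have hfm : Measurable fun s => f (s, m) := hf.comp measurable_prodMk_right
  rw [lintegral_map hf measurable_prodMk_right,
    lintegral_withDensity_eq_lintegral_mul _ (hp m).ennreal_ofReal hfm]
  rfl

lemma chanLaw_prod_singleton [MeasurableSingletonClass M] {p : S → M → ℝ}
    (hp : ∀ m, Measurable fun s => p s m) {t : Set S} (ht : MeasurableSet t) (m : M) :
    chanLaw ν p (t ×ˢ {m}) = ∫⁻ s in t, ENNReal.ofReal (p s m) ∂ν := by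
  have htm : MeasurableSet (t ×ˢ ({m} : Set M)) := ht.prod (measurableSet_singleton m)
  rw [← lintegral_indicator_one htm, lintegral_chanLaw hp (measurable_one.indicator htm),
    Finset.sum_eq_single m, ← lintegral_indicator ht]
  · refine lintegral_congr fun s => ?_
    by_cases hs : s ∈ t <;> simp [hs]
  · intro m' _ h
    simp [h]
  · simp

/-- The joint law of state and output is linear in the transition probabilities; this makes the
error bilinear in the fillings of the two parties. -/
lemma lintegral_chanLaw_mixture {W : Type*} [Fintype W] {c : W → ℝ} (hc : ∀ w, 0 ≤ c w)
    {p : W → S → M → ℝ} (hp : IsChannel p) {f : S × M → ℝ≥0∞} (hf : Measurable f) :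
    ∫⁻ z, f z ∂chanLaw ν (fun s => mixture c fun w => p w s) =
      ∑ w, ENNReal.ofReal (c w) * ∫⁻ z, f z ∂chanLaw ν (p w) := by
  have hfm : ∀ m, Measurable fun s => f (s, m) := fun m => hf.comp measurable_prodMk_right
  have h1 := lintegral_chanLaw (ν := ν) (p := fun s => mixture c fun w => p w s)
    (fun m => Finset.measurable_sum _ fun w _ => (hp.meas w m).const_mul _) hf
  rw [h1]
  simp_rw [lintegral_chanLaw (hp.meas _) hf, Finset.mul_sum]
  rw [Finset.sum_comm]
  refine Finset.sum_congr rfl fun m _ => ?_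
  have h2 : ∀ w, ENNReal.ofReal (c w) * ∫⁻ s, ENNReal.ofReal (p w s m) * f (s, m) ∂ν =
      ∫⁻ s, ENNReal.ofReal (c w) * (ENNReal.ofReal (p w s m) * f (s, m)) ∂ν := fun w =>
    (lintegral_const_mul _ ((hp.meas w m).ennreal_ofReal.mul (hfm m))).symm
  simp_rw [h2]
  rw [← lintegral_finsetSum]
  · refine lintegral_congr fun s => ?_
    rw [mixture, ENNReal.ofReal_sum_of_nonneg fun w _ => mul_nonneg (hc w) ((hp.mem w s).1 m),
      Finset.sum_mul]
    refine Finset.sum_congr rfl fun w _ => ?_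
    rw [ENNReal.ofReal_mul (hc w), mul_assoc]
  · exact fun w _ => ((hp.meas w m).ennreal_ofReal.mul (hfm m)).const_mul _

end ChanLaw

lemma lintegral_chanLaw_reveal {X S M : Type*} [MeasurableSpace S] [MeasurableSpace M] [Fintype M]
    {ν : Measure S} [Fintype X] [DecidableEq X] [MeasurableSpace (Option X)] {p : X → S → M → ℝ}
    (hp : IsChannel p) {δ : ℝ} (h0 : 0 ≤ δ) (h1 : δ ≤ 1) (x : X) {f : S × M × Option X → ℝ≥0∞}
    (hf : Measurable f) :
    ∫⁻ z, f z ∂chanLaw ν (fun s => reveal δ (fun x => p x s) x) =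
      ENNReal.ofReal (1 - δ) * ∫⁻ z, f (z.1, z.2, none) ∂chanLaw ν (p x) +
        ENNReal.ofReal δ * ∫⁻ z, f (z.1, z.2, some x) ∂chanLaw ν (p x) := by
  have hfo : ∀ o, Measurable fun z : S × M => f (z.1, z.2, o) := fun o => by fun_prop
  have hfm : ∀ m o, Measurable fun s => f (s, m, o) := fun m o => by fun_prop
  rw [lintegral_chanLaw ((hp.reveal h0 h1).meas x) hf, lintegral_chanLaw (hp.meas x) (hfo none),
    lintegral_chanLaw (hp.meas x) (hfo (some x)), Fintype.sum_prod_type, Finset.mul_sum,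
    Finset.mul_sum, ← Finset.sum_add_distrib]
  refine Finset.sum_congr rfl fun m _ => ?_
  have h2 : ∀ (a : ℝ≥0∞) (o : Option X), a * ∫⁻ s, ENNReal.ofReal (p x s m) * f (s, m, o) ∂ν =
      ∫⁻ s, a * (ENNReal.ofReal (p x s m) * f (s, m, o)) ∂ν := fun a o =>
    (lintegral_const_mul _ ((hp.meas x m).ennreal_ofReal.mul (hfm m o))).symm
  rw [Fintype.sum_option, Finset.sum_eq_single x, h2, h2]
  · congr 1
    · refine lintegral_congr fun s => ?_
      simp only [reveal, Option.elim]
      rw [ENNReal.ofReal_mul (by linarith), mul_assoc]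
    · refine lintegral_congr fun s => ?_
      simp only [reveal, Option.elim, if_true]
      rw [ENNReal.ofReal_mul h0, mul_assoc]
  · intro x' _ h
    simp [reveal, h]
  · simp

section JointLaw

variable {X R S M : Type*} [MeasurableSpace R] [MeasurableSpace S] [MeasurableSpace M]
  {lawR : Measure R} [IsProbabilityMeasure lawR] {lawS : Measure S} [IsProbabilityMeasure lawS]
  {enc : X → R × S → M}

lemma measurableSet_enc_eq [DiscreteMeasurableSpace M] (henc : ∀ x, Measurable (enc x)) (x : X)
    (m : M) : MeasurableSet {r : R × S | enc x r = m} :=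
  henc x (.of_discrete (s := {m}))

lemma jointLaw_prod_singleton [DiscreteMeasurableSpace M] (henc : ∀ x, Measurable (enc x)) (x : X)
    {t : Set S} (ht : MeasurableSet t) (m : M) :
    jointLaw lawR lawS enc x (t ×ˢ {m}) =
      ∫⁻ s in t, ENNReal.ofReal (msgProb lawR enc x s m) ∂lawS := by
  have hx := henc x
  have htm : MeasurableSet (t ×ˢ ({m} : Set M)) := ht.prod .of_discrete
  rw [jointLaw, Measure.map_apply (by fun_prop) htm,
    Measure.prod_apply_symm ((by fun_prop : Measurable fun r : R × S => (r.2, enc x r)) htm),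
    ← lintegral_indicator ht]
  refine lintegral_congr fun s => ?_
  by_cases hs : s ∈ t
  · simp [hs, msgProb, Set.preimage, ofReal_measureReal]
  · have h : (fun ρ => (ρ, s)) ⁻¹' ((fun r : R × S => (r.2, enc x r)) ⁻¹' t ×ˢ {m}) = ∅ := by
      ext ρ
      simp [hs]
    rw [h, measure_empty, Set.indicator_of_notMem hs]

lemma isProbabilityMeasure_jointLaw (henc : ∀ x, Measurable (enc x)) (x : X) :
    IsProbabilityMeasure (jointLaw lawR lawS enc x) :=
  Measure.isProbabilityMeasure_map (measurable_snd.prodMk (henc x)).aemeasurable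

variable [Fintype M] [DiscreteMeasurableSpace M]

lemma isChannel_msgProb (henc : ∀ x, Measurable (enc x)) : IsChannel (msgProb lawR enc) where
  mem x s := by
    refine ⟨fun m => measureReal_nonneg, ?_⟩
    have hm : Measurable fun ρ => enc x (ρ, s) := (henc x).comp measurable_prodMk_right
    have h := measureReal_biUnion_finset (μ := lawR) (s := Finset.univ)
      (f := fun m => {ρ | enc x (ρ, s) = m}) (fun m _ m' _ hmm => ?_)
      (fun m _ => hm (.of_discrete (s := {m})))
    · simp only [msgProb]
      rw [← h]
      convert probReal_univ (μ := lawR)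
      ext ρ
      simp
    · rw [Function.onFun, Set.disjoint_left]
      rintro ρ h1 h2
      exact hmm (h1.symm.trans h2)
  meas x m := (measurable_measure_prodMk_right (measurableSet_enc_eq henc x m)).ennreal_toReal

/-- Integrating out the private randomness leaves only the channel. -/
lemma jointLaw_eq_chanLaw (henc : ∀ x, Measurable (enc x)) (x : X) :
    jointLaw lawR lawS enc x = chanLaw lawS (msgProb lawR enc x) :=
  ext_of_prod_singleton fun _ ht m => by
    rw [jointLaw_prod_singleton henc x ht,
      chanLaw_prod_singleton ((isChannel_msgProb henc).meas x) ht]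

/-- The conditional mutual information of the input and the message given the shared randomness. -/
lemma condMutualInfo_message [Fintype X] [Nonempty X] [MeasurableSpace X]
    [DiscreteMeasurableSpace X] [Nonempty M] {Ω : Type*} [MeasurableSpace Ω] (P : Measure Ω)
    [IsProbabilityMeasure P] {U : Ω → X} {r : Ω → R × S} (hU : Measurable U) (hr : Measurable r)
    (henc : ∀ x, Measurable (enc x)) {μ : Measure X} [IsProbabilityMeasure μ]
    (hlaw : P.map (fun ω => (U ω, r ω)) = μ.prod (lawR.prod lawS)) :
    condMutualInfo U (fun ω => enc (U ω) (r ω)) (fun ω => (r ω).2) P =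
      ENNReal.ofReal (avgInfo lawS (fun x => μ.real {x}) (msgProb lawR enc)) /
        ENNReal.ofReal (log 2) := by
  have hm : Measurable fun z : X × R × S => enc z.1 z.2 :=
    measurable_from_prod_countable_right henc
  have hμ : (fun x => μ.real {x}) ∈ stdSimplex ℝ X :=
    ⟨fun _ => measureReal_nonneg, by simp⟩
  refine condMutualInfo_eq_avgInfo P hU (hm.comp (hU.prodMk hr)) (measurable_snd.comp hr) hμ
    (isChannel_msgProb henc) fun t ht x m => ?_
  have htm : MeasurableSet (t ×ˢ ({(x, m)} : Set (X × M))) := ht.prod (measurableSet_singleton _)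
  have hx := henc x
  have hg : Measurable fun r : R × S => (r.2, enc x r) := by fun_prop
  have h1 : P.map (fun ω => ((r ω).2, U ω, enc (U ω) (r ω))) =
      (P.map fun ω => (U ω, r ω)).map fun z => (z.2.2, z.1, enc z.1 z.2) := by
    rw [Measure.map_map (by fun_prop) (by fun_prop)]
    rfl
  change P.map (fun ω => ((r ω).2, U ω, enc (U ω) (r ω))) _ = _
  rw [h1, hlaw, Measure.map_apply (by fun_prop) htm, ← jointLaw_prod_singleton henc x ht, jointLaw,
    Measure.map_apply hg (ht.prod .of_discrete)]
  have h2 : (fun z : X × R × S => (z.2.2, z.1, enc z.1 z.2)) ⁻¹' (t ×ˢ {(x, m)}) =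
      {x} ×ˢ ((fun r : R × S => (r.2, enc x r)) ⁻¹' (t ×ˢ {m})) := by
    ext ⟨x', ρ, s⟩
    simp only [Set.mem_preimage, Set.mem_prod, Set.mem_singleton_iff, Prod.mk.injEq]
    constructor
    · rintro ⟨a, rfl, c⟩
      exact ⟨rfl, a, c⟩
    · rintro ⟨rfl, a, c⟩
      exact ⟨a, rfl, c⟩
  rw [h2, Measure.prod_prod, ofReal_measureReal]

end JointLaw

/-- Every channel to a finite set is realized by a function of the state and private randomness. -/
lemma exists_enc_of_channel {X S M : Type*} [MeasurableSpace S] [Fintype M] [Nonempty M]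
    [MeasurableSpace M] [DiscreteMeasurableSpace M] {p : X → S → M → ℝ} (hp : IsChannel p) :
    ∃ enc : X → I × S → M, (∀ x, Measurable (enc x)) ∧ msgProb volume enc = p := by
  have hk : ∀ x, IsMarkovKernel (weightKernel (p x) (hp.meas x)) := fun x =>
    isMarkovKernel_weightKernel _ (hp.mem x)
  choose f hf hmap using fun x =>
    Kernel.exists_measurable_map_eq_unitInterval (weightKernel (p x) (hp.meas x))
  refine ⟨fun x r => f x r.2 r.1, fun x => (hf x).comp measurable_swap, ?_⟩
  ext x s m
  have h := congrArg (fun μ => μ {m}) (hmap x s)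
  simp only [weightKernel_singleton] at h
  have hfs : Measurable (f x s) := (hf x).comp measurable_prodMk_left
  rw [Measure.map_apply hfs .of_discrete] at h
  rw [msgProb, measureReal_def]
  change (volume (f x s ⁻¹' {m})).toReal = _
  rw [h, ENNReal.toReal_ofReal ((hp.mem x s).1 m)]

/-! ### Protocols -/

section Protocol

variable {X Y Z : Type*} (P : SMPProtocol X Y Z)

/-- The rearrangement of the random strings that puts together those known to Alice and those
known to Bob. -/
lemma map_coinLaw : P.coinLaw.map (fun r : P.Coins => (((r.1, r.2.2.2.1), (r.2.1, r.2.2.2.2)),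
    r.2.2.1)) = ((P.lawA.prod P.lawAC).prod (P.lawB.prod P.lawBC)).prod P.lawC := by
  have idA := MeasurePreserving.id P.lawA
  have idB := MeasurePreserving.id P.lawB
  have idC := MeasurePreserving.id P.lawC
  have idD := MeasurePreserving.id P.lawAC
  have idE := MeasurePreserving.id P.lawBC
  have e1 := idA.prod (idB.prod (Measure.measurePreserving_swap (μ := P.lawC)
    (ν := P.lawAC.prod P.lawBC)))
  have e2 := idA.prod ((measurePreserving_prodAssoc P.lawB (P.lawAC.prod P.lawBC) P.lawC).symm)
  have e3 := idA.prod (((measurePreserving_prodAssoc P.lawB P.lawAC P.lawBC).symm).prod idC)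
  have e4 := idA.prod (((Measure.measurePreserving_swap (μ := P.lawB) (ν := P.lawAC)).prod
    idE).prod idC)
  have e5 := idA.prod ((measurePreserving_prodAssoc P.lawAC P.lawB P.lawBC).prod idC)
  have e6 := (measurePreserving_prodAssoc P.lawA (P.lawAC.prod (P.lawB.prod P.lawBC)) P.lawC).symm
  have e7 := ((measurePreserving_prodAssoc P.lawA P.lawAC (P.lawB.prod P.lawBC)).symm).prod idC
  exact (e7.comp (e6.comp (e5.comp (e4.comp (e3.comp (e2.comp e1)))))).map_eq

lemma map_coinLaw_alice : P.coinLaw.map (fun r : P.Coins => (r.1, P.sharedA r)) =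
    P.lawA.prod P.lawAC := by
  have h := congrArg (Measure.map fun z => z.1.1) (map_coinLaw P)
  rw [Measure.map_map (by fun_prop) (by fun_prop)] at h
  have h2 : (((P.lawA.prod P.lawAC).prod (P.lawB.prod P.lawBC)).prod P.lawC).map (fun z => z.1.1) =
      P.lawA.prod P.lawAC := by
    have := (measurePreserving_fst (μ := P.lawA.prod P.lawAC) (ν := P.lawB.prod P.lawBC)).comp
      (measurePreserving_fst (μ := (P.lawA.prod P.lawAC).prod (P.lawB.prod P.lawBC))
        (ν := P.lawC))
    exact this.map_eq
  exact h.trans h2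

lemma map_coinLaw_bob : P.coinLaw.map (fun r : P.Coins => (r.2.1, P.sharedB r)) =
    P.lawB.prod P.lawBC := by
  have h := congrArg (Measure.map fun z => z.1.2) (map_coinLaw P)
  rw [Measure.map_map (by fun_prop) (by fun_prop)] at h
  have h2 : (((P.lawA.prod P.lawAC).prod (P.lawB.prod P.lawBC)).prod P.lawC).map (fun z => z.1.2) =
      P.lawB.prod P.lawBC := by
    have := (measurePreserving_snd (μ := P.lawA.prod P.lawAC) (ν := P.lawB.prod P.lawBC)).comp
      (measurePreserving_fst (μ := (P.lawA.prod P.lawAC).prod (P.lawB.prod P.lawBC))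
        (ν := P.lawC))
    exact this.map_eq
  exact h.trans h2

/-- The probability that the output is not `z`, or more generally has an undesirable property,
given the joint laws `JA` and `JB` of the message of each party and the randomness that it shares
with the referee. -/
def errProb {SA SB RC MA MB : Type*} [MeasurableSpace SA] [MeasurableSpace SB] [MeasurableSpace RC]
    [MeasurableSpace MA] [MeasurableSpace MB] (JA : Measure (SA × MA)) (JB : Measure (SB × MB))
    (νC : Measure RC) (bad : Set (MA × MB × RC × SA × SB)) : ℝ≥0∞ :=
  ∫⁻ a, ∫⁻ b, νC {c | (a.2, b.2, c, a.1, b.1) ∈ bad} ∂JB ∂JA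

/-- With the inputs fixed, Alice's pair of shared string and message, Bob's pair and the coins of
the referee are independent. Hence the error is a function of the two joint laws. -/
lemma coinLaw_output (x : X) (y : Y) (bad : Set Z) :
    P.coinLaw {r | P.output x y r ∈ bad} = errProb (jointLaw P.lawA P.lawAC P.alice x)
      (jointLaw P.lawB P.lawBC P.bob y) P.lawC (P.referee ⁻¹' bad) := by
  have hb : MeasurableSet (P.referee ⁻¹' bad) := P.measurable_referee trivial
  have hx := P.measurable_alice x
  have hy := P.measurable_bob y
  have hpA := isProbabilityMeasure_jointLaw (lawR := P.lawA) (lawS := P.lawAC)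
    P.measurable_alice x
  have hpB := isProbabilityMeasure_jointLaw (lawR := P.lawB) (lawS := P.lawBC)
    P.measurable_bob y
  set B : Set (((P.RAC × P.MA) × (P.RBC × P.MB)) × P.RC) :=
    {z | (z.1.1.2, z.1.2.2, z.2, z.1.1.1, z.1.2.1) ∈ P.referee ⁻¹' bad} with hB
  have hBm : MeasurableSet B := (by fun_prop : Measurable
    fun z : ((P.RAC × P.MA) × (P.RBC × P.MB)) × P.RC =>
      (z.1.1.2, z.1.2.2, z.2, z.1.1.1, z.1.2.1)) hb
  have h1 : (((jointLaw P.lawA P.lawAC P.alice x).prod (jointLaw P.lawB P.lawBC P.bob y)).prod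
      P.lawC) B = errProb (jointLaw P.lawA P.lawAC P.alice x)
      (jointLaw P.lawB P.lawBC P.bob y) P.lawC (P.referee ⁻¹' bad) := by
    rw [Measure.prod_apply hBm, lintegral_prod _ (measurable_measure_prodMk_left hBm).aemeasurable]
    rfl
  rw [← h1, jointLaw, jointLaw, Measure.map_prod_map _ _ (by fun_prop) (by fun_prop)]
  have h2 := Measure.map_prod_map ((P.lawA.prod P.lawAC).prod (P.lawB.prod P.lawBC)) P.lawC
    (f := Prod.map (fun r : P.RA × P.RAC => (r.2, P.alice x r))
      fun r : P.RB × P.RBC => (r.2, P.bob y r)) (g := id) (by fun_prop) measurable_id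
  rw [Measure.map_id] at h2
  rw [h2, ← map_coinLaw, Measure.map_map (by fun_prop) (by fun_prop),
    Measure.map_apply (by fun_prop) hBm]
  rfl

/-- The information cost is the sum of the capacities of the channels used by the two parties. -/
theorem infoCost_eq_capacity [Fintype X] [Nonempty X] [MeasurableSpace X]
    [DiscreteMeasurableSpace X] [Fintype Y] [Nonempty Y] [MeasurableSpace Y]
    [DiscreteMeasurableSpace Y] [Fintype P.MA] [Fintype P.MB] :
    P.infoCost = capacity P.lawAC (msgProb P.lawA P.alice) +
      capacity P.lawBC (msgProb P.lawB P.bob) := by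
  have hat : ∀ (μ : Measure (X × Y)) [IsProbabilityMeasure μ], P.infoCostAt μ =
      ENNReal.ofReal (avgInfo P.lawAC (fun x => (μ.map Prod.fst).real {x})
        (msgProb P.lawA P.alice)) / ENNReal.ofReal (log 2) +
      ENNReal.ofReal (avgInfo P.lawBC (fun y => (μ.map Prod.snd).real {y})
        (msgProb P.lawB P.bob)) / ENNReal.ofReal (log 2) := by
    intro μ _
    have : IsProbabilityMeasure (μ.map Prod.fst) :=
      Measure.isProbabilityMeasure_map measurable_fst.aemeasurable
    have : IsProbabilityMeasure (μ.map Prod.snd) :=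
      Measure.isProbabilityMeasure_map measurable_snd.aemeasurable
    unfold SMPProtocol.infoCostAt
    have hsA : Measurable fun r : P.Coins => (r.1, P.sharedA r) := by
      unfold SMPProtocol.sharedA
      fun_prop
    have hsB : Measurable fun r : P.Coins => (r.2.1, P.sharedB r) := by
      unfold SMPProtocol.sharedB
      fun_prop
    congr 1
    · refine condMutualInfo_message (lawR := P.lawA) (lawS := P.lawAC) (enc := P.alice)
        (μ.prod P.coinLaw) (U := fun ω => ω.1.1) (r := fun ω => (ω.2.1, P.sharedA ω.2))
        (by fun_prop) (hsA.comp measurable_snd) P.measurable_alice ?_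
      rw [← map_coinLaw_alice, Measure.map_prod_map _ _ measurable_fst hsA]
      rfl
    · refine condMutualInfo_message (lawR := P.lawB) (lawS := P.lawBC) (enc := P.bob)
        (μ.prod P.coinLaw) (U := fun ω => ω.1.2) (r := fun ω => (ω.2.2.1, P.sharedB ω.2))
        (by fun_prop) (hsB.comp measurable_snd) P.measurable_bob ?_
      rw [← map_coinLaw_bob, Measure.map_prod_map _ _ measurable_snd hsB]
      rfl
  apply le_antisymm
  · refine iSup₂_le fun μ hμ => ?_
    have : IsProbabilityMeasure (μ.map Prod.fst) :=
      Measure.isProbabilityMeasure_map measurable_fst.aemeasurable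
    have : IsProbabilityMeasure (μ.map Prod.snd) :=
      Measure.isProbabilityMeasure_map measurable_snd.aemeasurable
    rw [hat μ]
    exact add_le_add
      (le_iSup₂_of_le (fun x => (μ.map Prod.fst).real {x})
        ⟨fun _ => measureReal_nonneg, by simp⟩ le_rfl)
      (le_iSup₂_of_le (fun y => (μ.map Prod.snd).real {y})
        ⟨fun _ => measureReal_nonneg, by simp⟩ le_rfl)
  · classical
    unfold capacity
    refine ENNReal.biSup_add_biSup_le ⟨_, single_mem_stdSimplex ℝ (Classical.arbitrary X)⟩
      ⟨_, single_mem_stdSimplex ℝ (Classical.arbitrary Y)⟩ fun a ha b hb => ?_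
    let κA : Kernel Unit X := weightKernel (fun _ => a) fun _ => measurable_const
    let κB : Kernel Unit Y := weightKernel (fun _ => b) fun _ => measurable_const
    have : IsMarkovKernel κA := isMarkovKernel_weightKernel _ fun _ => ha
    have : IsMarkovKernel κB := isMarkovKernel_weightKernel _ fun _ => hb
    -- The product of the two marginals serves both channels at once.
    refine le_iSup₂_of_le ((κA ()).prod (κB ())) inferInstance ?_
    rw [hat]
    have hA : (fun x => (((κA ()).prod (κB ())).map Prod.fst).real {x}) = a := by
      ext x
      rw [Measure.map_fst_prod, measure_univ, one_smul, measureReal_def, weightKernel_singleton,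
        ENNReal.toReal_ofReal (ha.1 x)]
    have hB : (fun y => (((κA ()).prod (κB ())).map Prod.snd).real {y}) = b := by
      ext y
      rw [Measure.map_snd_prod, measure_univ, one_smul, measureReal_def, weightKernel_singleton,
        ENNReal.toReal_ofReal (hb.1 y)]
    rw [hA, hB]

end Protocol

end

end SMP

/-! ### The information complexity is at most the communication cost per copy -/

namespace SMP

open Real (negMulLog log)
open scoped unitInterval

noncomputable section

lemma log_two_pos : 0 < log 2 := Real.log_pos one_lt_two

/-! #### Kraft's inequality -/

/-- The first codewords of two factorizations are prefixes of one word, so one is a prefix of the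
other and they agree; then cancel them. -/
lemma eq_of_flatten_eq {α : Type*} {S : Set (List α)} (hnil : [] ∉ S)
    (hS : ∀ w ∈ S, ∀ w' ∈ S, w <+: w' → w = w') : UniquelyDecodable S := by
  intro L₁
  induction L₁ with
  | nil =>
    intro L₂ _ h2 h
    cases L₂ with
    | nil => rfl
    | cons w L =>
      have : w = [] := by simp at h; exact h.1
      exact absurd (this ▸ h2 w (by simp)) hnil
  | cons w L ih =>
    intro L₂ h1 h2 h
    cases L₂ with
    | nil =>
      have : w = [] := by simp at h; exact h.1
      exact absurd (this ▸ h1 w (by simp)) hnil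
    | cons w' L' =>
      have hw := h1 w (by simp)
      have hw' := h2 w' (by simp)
      simp only [List.flatten_cons] at h
      have hww : w = w' := by
        rcases List.prefix_or_prefix_of_prefix (List.prefix_append w L.flatten)
          (h ▸ List.prefix_append w' L'.flatten) with h3 | h3
        · exact hS w hw w' hw' h3
        · exact (hS w' hw' w hw h3).symm
      subst hww
      rw [ih L' (fun v hv => h1 v (by simp [hv])) (fun v hv => h2 v (by simp [hv]))
        (List.append_cancel_left h)]

/-- Kraft's inequality for prefix codes. -/
lemma kraft_inequality {M : Type*} [Fintype M] {enc : M → List Bool} (h : IsPrefixCode enc) :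
    ∑ m, (1 / 2 : ℝ) ^ (enc m).length ≤ 1 := by
  classical
  have hinj : Function.Injective enc := fun m m' hm => h m m' (hm ▸ List.prefix_rfl)
  -- The empty word is a prefix of everything, so it can be a codeword only if there is a single
  -- message.
  by_cases hnil : ∃ m, enc m = []
  · obtain ⟨m, hm⟩ := hnil
    have hall : ∀ m', m' = m := fun m' => (h m m' (by simp [hm])).symm
    rw [Finset.sum_eq_single m (fun b _ hb => absurd (hall b) hb) (by simp), hm]
    simp
  · push Not at hnil
    have hud : UniquelyDecodable ((Finset.univ.image enc : Finset (List Bool)) :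
        Set (List Bool)) := by
      refine eq_of_flatten_eq (by simpa using hnil) ?_
      simp only [Finset.coe_image, Finset.coe_univ, Set.image_univ, Set.mem_range]
      rintro _ ⟨m, rfl⟩ _ ⟨m', rfl⟩ hp
      rw [h m m' hp]
    have := kraft_mcmillan_inequality hud
    rw [Finset.sum_image fun m _ m' _ hm => hinj hm] at this
    simpa using this

/-! #### Capacities -/

section Capacity

variable {X S M : Type*} [Fintype X] [Fintype M] [MeasurableSpace S] {ν : Measure S}

lemma capacity_le_ofReal {p : X → S → M → ℝ} {v : ℝ}
    (h : ∀ μ ∈ stdSimplex ℝ X, avgInfo ν μ p ≤ v) : capacity ν p ≤ ENNReal.ofReal (v / log 2) := by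
  refine iSup₂_le fun μ hμ => ?_
  rw [← ENNReal.ofReal_div_of_pos log_two_pos]
  exact ENNReal.ofReal_le_ofReal (div_le_div_of_nonneg_right (h μ hμ) log_two_pos.le)

lemma capacity_le_comp_equiv {X' : Type*} [Fintype X'] (e : X ≃ X') (q : X' → S → M → ℝ) :
    capacity ν q ≤ capacity ν (fun x => q (e x)) := by
  refine iSup₂_le fun μ hμ => le_iSup₂_of_le (fun x => μ (e x))
    ⟨fun x => hμ.1 _, (e.sum_comp μ).trans hμ.2⟩ (le_of_eq ?_)
  have : ∀ s, mutualInfo μ (fun x => q x s) =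
      mutualInfo (fun x => μ (e x)) (fun x => q (e x) s) := fun s => by
    simp only [mutualInfo]
    congr 1
    · congr 1
      ext m
      exact (e.sum_comp fun x => μ x * q x s m).symm
    · exact (e.sum_comp fun x => μ x * entropy (q x s)).symm
  simp only [avgInfo, this]

lemma capacity_comp_equiv {X' : Type*} [Fintype X'] (e : X ≃ X') (q : X' → S → M → ℝ) :
    capacity ν (fun x => q (e x)) = capacity ν q := by
  refine le_antisymm ?_ (capacity_le_comp_equiv e q)
  simpa using capacity_le_comp_equiv e.symm fun x => q (e x)

variable [IsProbabilityMeasure ν]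

lemma IsChannel.capacity_reveal_le [DecidableEq X] {p : X → S → M → ℝ} (hp : IsChannel p) {δ : ℝ}
    (h0 : 0 ≤ δ) : capacity ν (fun x s => SMP.reveal δ (fun x => p x s) x) ≤
      capacity ν p + ENNReal.ofReal (δ * log (Fintype.card X) / log 2) := by
  refine iSup₂_le fun μ hμ => ?_
  have h := hp.avgInfo_reveal_le ν h0 hμ
  rw [← ENNReal.ofReal_div_of_pos log_two_pos]
  refine (ENNReal.ofReal_le_ofReal (div_le_div_of_nonneg_right h log_two_pos.le)).trans ?_
  rw [add_div]
  refine ENNReal.ofReal_add_le.trans (add_le_add ?_ le_rfl)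
  rw [ENNReal.ofReal_div_of_pos log_two_pos]
  exact le_iSup₂_of_le μ hμ le_rfl

/-- The information that messages give is at most their average length, for every encoding with
lengths that satisfy Kraft's inequality. -/
lemma IsChannel.avgInfo_le_length [MeasurableSpace M] [DiscreteMeasurableSpace M]
    {p : X → S → M → ℝ} (hp : IsChannel p) {ℓ : M → ℕ}
    (hℓ : ∑ m, (1 / 2 : ℝ) ^ ℓ m ≤ 1) {L : ℝ} (hL : 0 ≤ L)
    (h : ∀ x, ∫⁻ z, (ℓ z.2 : ℝ≥0∞) ∂chanLaw ν (p x) ≤ ENNReal.ofReal L) {μ : X → ℝ}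
    (hμ : μ ∈ stdSimplex ℝ X) : avgInfo ν μ p ≤ L * log 2 := by
  have hint : ∀ x m, Integrable (fun s => p x s m) ν := fun x m =>
    Integrable.of_bound (hp.meas x m).aestronglyMeasurable 1 (ae_of_all _ fun s => by
      rw [Real.norm_of_nonneg ((hp.mem x s).1 m)]
      exact le_one_of_mem_stdSimplex (hp.mem x s) m)
  have hx : ∀ x, ∑ m, (∫ s, p x s m ∂ν) * ℓ m ≤ L := by
    intro x
    have h1 := h x
    rw [lintegral_chanLaw (hp.meas x) (by fun_prop)] at h1
    have h2 : ∀ m, ∫⁻ s, ENNReal.ofReal (p x s m) * (ℓ m : ℝ≥0∞) ∂ν =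
        ENNReal.ofReal ((∫ s, p x s m ∂ν) * ℓ m) := by
      intro m
      rw [lintegral_mul_const _ (hp.meas x m).ennreal_ofReal,
        ENNReal.ofReal_mul (integral_nonneg fun s => (hp.mem x s).1 m), ENNReal.ofReal_natCast,
        ofReal_integral_eq_lintegral_ofReal (hint x m) (ae_of_all _ fun s => (hp.mem x s).1 m)]
    simp only [h2] at h1
    rw [← ENNReal.ofReal_sum_of_nonneg] at h1
    · exact (ENNReal.ofReal_le_ofReal_iff hL).1 h1
    · exact fun m _ => mul_nonneg (integral_nonneg fun s => (hp.mem x s).1 m) (Nat.cast_nonneg _)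
  have hint2 : ∀ x, Integrable (fun s => ∑ m, p x s m * (ℓ m * log 2)) ν := fun x =>
    integrable_finsetSum _ fun m _ => (hint x m).mul_const _
  calc avgInfo ν μ p ≤ ∫ s, ∑ x, μ x * ∑ m, p x s m * (ℓ m * log 2) ∂ν := by
        refine integral_mono (hp.integrable_mutualInfo ν hμ)
          (integrable_finsetSum _ fun x _ => (hint2 x).const_mul _) fun s => ?_
        have := mutualInfo_le_crossEntropy hμ (fun x => hp.mem x s)
          (q := fun m => (1 / 2 : ℝ) ^ ℓ m) (fun m => by positivity) hℓ
        simpa using this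
    _ = ∑ x, μ x * ((∑ m, (∫ s, p x s m ∂ν) * ℓ m) * log 2) := by
        rw [integral_finsetSum _ fun x _ => (hint2 x).const_mul _]
        refine Finset.sum_congr rfl fun x _ => ?_
        rw [integral_const_mul, integral_finsetSum _ fun m _ => (hint x m).mul_const _,
          Finset.sum_mul]
        congr 1
        refine Finset.sum_congr rfl fun m _ => ?_
        rw [integral_mul_const]
        ring
    _ ≤ ∑ x, μ x * (L * log 2) := Finset.sum_le_sum fun x _ =>
        mul_le_mul_of_nonneg_left (mul_le_mul_of_nonneg_right (hx x) log_two_pos.le) (hμ.1 x)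
    _ = L * log 2 := by rw [← Finset.sum_mul, hμ.2, one_mul]

lemma isProbabilityMeasure_chanLaw [MeasurableSpace M] {p : S → M → ℝ}
    (hp : ∀ m, Measurable fun s => p s m) (hs : ∀ s, p s ∈ stdSimplex ℝ M) :
    IsProbabilityMeasure (chanLaw ν p) := by
  refine ⟨?_⟩
  rw [← lintegral_one, lintegral_chanLaw hp measurable_const]
  simp only [mul_one]
  rw [← lintegral_finsetSum _ fun m _ => (hp m).ennreal_ofReal]
  simp [← ENNReal.ofReal_sum_of_nonneg fun m _ => (hs _).1 m, (hs _).2]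

end Capacity

/-! #### Error probabilities -/

section ErrProb

variable {SA SB RC MA MB : Type*} [MeasurableSpace SA] [MeasurableSpace SB] [MeasurableSpace RC]
  [MeasurableSpace MA] [MeasurableSpace MB] {νC : Measure RC} [SFinite νC]
  {bad : Set (MA × MB × RC × SA × SB)}

lemma measurable_prob_bad (hbad : MeasurableSet bad) :
    Measurable fun z : (SA × MA) × (SB × MB) =>
      νC {c | (z.1.2, z.2.2, c, z.1.1, z.2.1) ∈ bad} := by
  have h : MeasurableSet {w : ((SA × MA) × (SB × MB)) × RC |
      (w.1.1.2, w.1.2.2, w.2, w.1.1.1, w.1.2.1) ∈ bad} :=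
    (by fun_prop : Measurable fun w : ((SA × MA) × (SB × MB)) × RC =>
      (w.1.1.2, w.1.2.2, w.2, w.1.1.1, w.1.2.1)) hbad
  exact measurable_measure_prodMk_left h

lemma measurable_prob_bad_right (hbad : MeasurableSet bad) (a : SA × MA) :
    Measurable fun b : SB × MB => νC {c | (a.2, b.2, c, a.1, b.1) ∈ bad} :=
  (measurable_prob_bad hbad).comp measurable_prodMk_left

lemma measurable_lintegral_bad (hbad : MeasurableSet bad) (JB : Measure (SB × MB)) [SFinite JB] :
    Measurable fun a : SA × MA => ∫⁻ b, νC {c | (a.2, b.2, c, a.1, b.1) ∈ bad} ∂JB :=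
  (measurable_prob_bad hbad).lintegral_prod_right'

variable [Fintype MA] [Fintype MB] {νA : Measure SA} {νB : Measure SB}
  [IsProbabilityMeasure νB]

/-- The error is an average over independent `w` and `v`, so it suffices to bound it on pairs of
positive weight, that is, on fillings which carry the correct letter at the chosen position. -/
lemma errProb_mixture_le {W V : Type*} [Fintype W] [Fintype V] {c : W → ℝ} {d : V → ℝ}
    (hc : c ∈ stdSimplex ℝ W) (hd : d ∈ stdSimplex ℝ V) {pA : W → SA → MA → ℝ}
    {pB : V → SB → MB → ℝ} (hpA : IsChannel pA) (hpB : IsChannel pB) (hbad : MeasurableSet bad)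
    {E : ℝ≥0∞} (h : ∀ w v, c w ≠ 0 → d v ≠ 0 →
      errProb (chanLaw νA (pA w)) (chanLaw νB (pB v)) νC bad ≤ E) :
    errProb (chanLaw νA fun s => mixture c fun w => pA w s)
      (chanLaw νB fun s => mixture d fun v => pB v s) νC bad ≤ E := by
  have hB : ∀ v, IsProbabilityMeasure (chanLaw νB (pB v)) := fun v =>
    isProbabilityMeasure_chanLaw (hpB.meas v) (hpB.mem v)
  have hm : ∀ v, Measurable fun a : SA × MA =>
      ∫⁻ b, νC {c | (a.2, b.2, c, a.1, b.1) ∈ bad} ∂chanLaw νB (pB v) := fun v =>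
    measurable_lintegral_bad hbad _
  unfold errProb
  simp_rw [lintegral_chanLaw_mixture hd.1 hpB (measurable_prob_bad_right hbad _)]
  rw [lintegral_chanLaw_mixture hc.1 hpA
    (Finset.measurable_sum _ fun v _ => (hm v).const_mul _)]
  have h1 : ∀ w, ENNReal.ofReal (c w) * ∫⁻ a, ∑ v, ENNReal.ofReal (d v) *
      ∫⁻ b, νC {c | (a.2, b.2, c, a.1, b.1) ∈ bad} ∂chanLaw νB (pB v) ∂chanLaw νA (pA w) ≤
      ENNReal.ofReal (c w) * E := by
    intro w
    by_cases hw : c w = 0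
    · simp [hw]
    refine mul_le_mul_right ?_ _
    rw [lintegral_finsetSum _ fun v _ => (hm v).const_mul _]
    calc _ ≤ ∑ v, ENNReal.ofReal (d v) * E := by
          refine Finset.sum_le_sum fun v _ => ?_
          rw [lintegral_const_mul _ (hm v)]
          by_cases hv : d v = 0
          · simp [hv]
          · exact mul_le_mul_right (h w v hw hv) _
      _ = E := by
          rw [← Finset.sum_mul, ← ENNReal.ofReal_sum_of_nonneg fun v _ => hd.1 v, hd.2]
          simp
  refine (Finset.sum_le_sum fun w _ => h1 w).trans_eq ?_
  rw [← Finset.sum_mul, ← ENNReal.ofReal_sum_of_nonneg fun v _ => hc.1 v, hc.2]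
  simp

end ErrProb

/-! ### Protocols from channels, and the trade of information for error -/

section Upper

variable {X Y Z : Type*} [Fintype X] [Nonempty X] [MeasurableSpace X] [DiscreteMeasurableSpace X]
  [Fintype Y] [Nonempty Y] [MeasurableSpace Y] [DiscreteMeasurableSpace Y] {f : X → Y → Z} {ε : ℝ}

/-- The information complexity is at most the sum of the capacities of two channels from which the
referee can compute the function. -/
theorem infoComplexity_le_capacity {SA SB RC MA MB : Type} [MeasurableSpace SA]
    [MeasurableSpace SB] [MeasurableSpace RC] [MeasurableSpace MA] [DiscreteMeasurableSpace MA]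
    [MeasurableSpace MB] [DiscreteMeasurableSpace MB] [Fintype MA] [Nonempty MA] [Fintype MB]
    [Nonempty MB] (νA : Measure SA) [IsProbabilityMeasure νA] (νB : Measure SB)
    [IsProbabilityMeasure νB] (νC : Measure RC) [IsProbabilityMeasure νC]
    {pA : X → SA → MA → ℝ} {pB : Y → SB → MB → ℝ} (hpA : IsChannel pA) (hpB : IsChannel pB)
    {g : MA × MB × RC × SA × SB → Z} (hg : Measurable[_, ⊤] g) (hε : 0 ≤ ε)
    (herr : ∀ x y, errProb (chanLaw νA (pA x)) (chanLaw νB (pB y)) νC (g ⁻¹' {f x y}ᶜ) ≤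
      ENNReal.ofReal ε) : infoComplexity f ε ≤ capacity νA pA + capacity νB pB := by
  obtain ⟨encA, hencA, hA⟩ := exists_enc_of_channel hpA
  obtain ⟨encB, hencB, hB⟩ := exists_enc_of_channel hpB
  let P : SMPProtocol X Y Z :=
    { RA := I, RB := I, RC := RC, RAC := SA, RBC := SB, lawA := volume, lawB := volume,
      lawC := νC, lawAC := νA, lawBC := νB, MA := MA, MB := MB, alice := encA, bob := encB,
      referee := g, measurable_alice := hencA, measurable_bob := hencB, measurable_referee := hg }
  let _ : Fintype P.MA := ‹Fintype MA›
  let _ : Fintype P.MB := ‹Fintype MB›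
  refine iInf_le_of_le P (iInf_le_of_le (Finite.of_fintype MA) (iInf_le_of_le
    (Finite.of_fintype MB) (iInf_le_of_le ?_ ?_)))
  · intro x y
    refine ENNReal.toReal_le_of_le_ofReal hε ((coinLaw_output P x y {f x y}ᶜ).trans_le ?_)
    refine le_trans (le_of_eq ?_) (herr x y)
    change errProb (jointLaw volume νA encA x) (jointLaw volume νB encB y) νC (g ⁻¹' {f x y}ᶜ) = _
    rw [jointLaw_eq_chanLaw hencA, jointLaw_eq_chanLaw hencB, hA, hB]
  · rw [infoCost_eq_capacity P, ← hA, ← hB]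

/-- A small increase of the information cost decreases the error. -/
theorem infoComplexity_le_add {ε' δ : ℝ} (h0 : 0 ≤ δ) (h1 : δ ≤ 1) (hε : 0 ≤ ε)
    (hε' : (1 - δ ^ 2) * ε' ≤ ε) : infoComplexity f ε ≤ infoComplexity f ε' +
      ENNReal.ofReal (δ * (log (Fintype.card X) + log (Fintype.card Y)) / log 2) := by
  have hcX : (1 : ℝ) ≤ Fintype.card X := by exact_mod_cast Fintype.card_pos
  have hcY : (1 : ℝ) ≤ Fintype.card Y := by exact_mod_cast Fintype.card_pos
  conv_rhs => rw [infoComplexity]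
  simp only [ENNReal.iInf_add]
  refine le_iInf fun P => le_iInf fun hMA => le_iInf fun hMB => le_iInf fun hP => ?_
  let _ : Fintype P.MA := Fintype.ofFinite _
  let _ : Fintype P.MB := Fintype.ofFinite _
  -- Messages must live in `Type`, so a revealed input is sent as its number in `Fin`.
  let eX := Fintype.equivFin X
  let eY := Fintype.equivFin Y
  set pA : Fin (Fintype.card X) → P.RAC → P.MA → ℝ := fun i => msgProb P.lawA P.alice (eX.symm i)
    with hpAdef
  set pB : Fin (Fintype.card Y) → P.RBC → P.MB → ℝ := fun i => msgProb P.lawB P.bob (eY.symm i)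
    with hpBdef
  have hpA : IsChannel pA := ⟨fun i => (isChannel_msgProb P.measurable_alice).mem _,
    fun i => (isChannel_msgProb P.measurable_alice).meas _⟩
  have hpB : IsChannel pB := ⟨fun i => (isChannel_msgProb P.measurable_bob).mem _,
    fun i => (isChannel_msgProb P.measurable_bob).meas _⟩
  have hrA := hpA.reveal h0 h1
  have hrB := hpB.reveal h0 h1
  let _ : MeasurableSpace (Option (Fin (Fintype.card X))) := ⊤
  let _ : MeasurableSpace (Option (Fin (Fintype.card Y))) := ⊤
  have : DiscreteMeasurableSpace (Option (Fin (Fintype.card X))) := ⟨fun _ => trivial⟩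
  have : DiscreteMeasurableSpace (Option (Fin (Fintype.card Y))) := ⟨fun _ => trivial⟩
  let _ : MeasurableSpace Z := ⊤
  -- If both inputs are revealed, which has probability `δ ^ 2`, the referee evaluates `f` itself;
  -- otherwise it ignores what was revealed.
  let g : (P.MA × Option (Fin (Fintype.card X))) × (P.MB × Option (Fin (Fintype.card Y))) ×
      P.RC × P.RAC × P.RBC → Z := fun z =>
    if z.1.2.isSome ∧ z.2.1.2.isSome then
      f (z.1.2.elim (Classical.arbitrary X) eX.symm) (z.2.1.2.elim (Classical.arbitrary Y) eY.symm)
    else P.referee (z.1.1, z.2.1.1, z.2.2)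
  have hg : Measurable g := by
    have hpr : Measurable fun z : (P.MA × Option (Fin (Fintype.card X))) ×
        (P.MB × Option (Fin (Fintype.card Y))) × P.RC × P.RAC × P.RBC => (z.1.2, z.2.1.2) := by
      fun_prop
    refine Measurable.ite (hpr (.of_discrete (s := {o : Option (Fin (Fintype.card X)) ×
      Option (Fin (Fintype.card Y)) | o.1.isSome ∧ o.2.isSome}))) ?_
      (P.measurable_referee.comp (by fun_prop))
    have hd : Measurable fun o : Option (Fin (Fintype.card X)) × Option (Fin (Fintype.card Y)) =>
        f (o.1.elim (Classical.arbitrary X) eX.symm) (o.2.elim (Classical.arbitrary Y) eY.symm) :=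
      .of_discrete
    exact hd.comp hpr
  have hle := infoComplexity_le_capacity (f := f) (ε := ε) P.lawAC P.lawBC P.lawC
    (pA := fun x s => reveal δ (fun i => pA i s) (eX x))
    (pB := fun y s => reveal δ (fun i => pB i s) (eY y))
    ⟨fun x => hrA.mem _, fun x => hrA.meas _⟩ ⟨fun x => hrB.mem _, fun x => hrB.meas _⟩ hg hε ?_
  · refine hle.trans ?_
    rw [capacity_comp_equiv eX (ν := P.lawAC) fun i s => reveal δ (fun i => pA i s) i,
      capacity_comp_equiv eY (ν := P.lawBC) fun i s => reveal δ (fun i => pB i s) i]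
    refine (add_le_add (hpA.capacity_reveal_le h0) (hpB.capacity_reveal_le h0)).trans_eq ?_
    rw [capacity_comp_equiv eX.symm, capacity_comp_equiv eY.symm, infoCost_eq_capacity P,
      add_add_add_comm, ← ENNReal.ofReal_add]
    · congr 2
      simp only [Fintype.card_fin]
      ring
    · exact div_nonneg (mul_nonneg h0 (Real.log_nonneg (by simpa using hcX))) log_two_pos.le
    · exact div_nonneg (mul_nonneg h0 (Real.log_nonneg (by simpa using hcY))) log_two_pos.le
  · intro x y
    have hbad : MeasurableSet (g ⁻¹' {f x y}ᶜ) := hg trivial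
    have hPB : IsProbabilityMeasure (chanLaw P.lawBC (pB (eY y))) :=
      isProbabilityMeasure_chanLaw (hpB.meas _) (hpB.mem _)
    have hPB' : IsProbabilityMeasure
        (chanLaw P.lawBC fun s => reveal δ (fun i => pB i s) (eY y)) :=
      isProbabilityMeasure_chanLaw (hrB.meas _) (hrB.mem _)
    set E : ℝ≥0∞ := errProb (chanLaw P.lawAC (pA (eX x))) (chanLaw P.lawBC (pB (eY y))) P.lawC
      (P.referee ⁻¹' {f x y}ᶜ) with hE
    have hE' : E ≤ ENNReal.ofReal ε' := by
      have h2 := coinLaw_output P x y {f x y}ᶜ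
      rw [jointLaw_eq_chanLaw P.measurable_alice, jointLaw_eq_chanLaw P.measurable_bob] at h2
      simp only [hE, hpAdef, hpBdef, Equiv.symm_apply_apply]
      rw [← h2]
      refine ENNReal.le_ofReal_iff_toReal_le (measure_ne_top _ _) ?_ |>.2 (hP x y)
      exact measureReal_nonneg.trans (hP x y)
    have hmeas : ∀ o o', Measurable fun a : P.RAC × P.MA => ∫⁻ b, P.lawC {c |
        ((a.2, o), (b.2, o'), c, a.1, b.1) ∈ g ⁻¹' {f x y}ᶜ} ∂chanLaw P.lawBC (pB (eY y)) := by
      intro o o'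
      exact measurable_lintegral_bad
        (bad := {z | ((z.1, o), (z.2.1, o'), z.2.2) ∈ g ⁻¹' {f x y}ᶜ})
        ((by fun_prop : Measurable fun z : P.MA × P.MB × P.RC × P.RAC × P.RBC =>
          (((z.1, o), (z.2.1, o'), z.2.2) : (P.MA × Option (Fin (Fintype.card X))) ×
            (P.MB × Option (Fin (Fintype.card Y))) × P.RC × P.RAC × P.RBC)) hbad) _
    -- The value `⊤` stands for pairs in which both parties reveal and at least one reveals a wrong
    -- input; these have probability zero and are never used.
    have hval : ∀ o o', ∫⁻ a, ∫⁻ b, P.lawC {c |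
        ((a.2, o), (b.2, o'), c, a.1, b.1) ∈ g ⁻¹' {f x y}ᶜ} ∂chanLaw P.lawBC (pB (eY y))
          ∂chanLaw P.lawAC (pA (eX x)) ≤ if o = some (eX x) ∧ o' = some (eY y) then 0 else
        if o = none ∨ o' = none then E else ⊤ := by
      intro o o'
      split_ifs with h h'
      · obtain ⟨rfl, rfl⟩ := h
        simp [g]
      · refine le_of_eq ?_
        rw [hE, errProb]
        have : ¬ (o.isSome ∧ o'.isSome) := by
          rcases h' with rfl | rfl <;> simp
        simp [g, this]
      · exact le_top
    have h2 : errProb (chanLaw P.lawAC fun s => reveal δ (fun i => pA i s) (eX x))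
        (chanLaw P.lawBC fun s => reveal δ (fun i => pB i s) (eY y)) P.lawC (g ⁻¹' {f x y}ᶜ) ≤
        ENNReal.ofReal (1 - δ) * (ENNReal.ofReal (1 - δ) * E + ENNReal.ofReal δ * E) +
          ENNReal.ofReal δ * (ENNReal.ofReal (1 - δ) * E + ENNReal.ofReal δ * 0) := by
      unfold errProb
      have hin := fun a => lintegral_chanLaw_reveal (ν := P.lawBC) hpB h0 h1 (eY y)
        (measurable_prob_bad_right (νC := P.lawC) hbad a)
      have hm := measurable_lintegral_bad (νC := P.lawC) hbad
        (chanLaw P.lawBC fun s => reveal δ (fun i => pB i s) (eY y))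
      rw [funext hin] at hm
      rw [lintegral_congr hin, lintegral_chanLaw_reveal hpA h0 h1 _ hm]
      rw [lintegral_add_left ((hmeas _ _).const_mul _),
        lintegral_add_left ((hmeas _ _).const_mul _),
        lintegral_const_mul _ (hmeas _ _), lintegral_const_mul _ (hmeas _ _),
        lintegral_const_mul _ (hmeas _ _), lintegral_const_mul _ (hmeas _ _)]
      gcongr
      · simpa using hval none none
      · simpa using hval none (some (eY y))
      · simpa using hval (some (eX x)) none
      · simpa using hval (some (eX x)) (some (eY y))
    -- The four cases add up to `(1 - δ) * E + δ * (1 - δ) * E = (1 - δ ^ 2) * E`.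
    refine h2.trans ?_
    rw [← add_mul, ← ENNReal.ofReal_add (by linarith) h0, sub_add_cancel, ENNReal.ofReal_one,
      one_mul, mul_zero, add_zero, ← mul_assoc, ← add_mul, ← ENNReal.ofReal_mul h0,
      ← ENNReal.ofReal_add (by linarith) (mul_nonneg h0 (by linarith))]
    refine (mul_le_mul_right hE' _).trans ?_
    rw [← ENNReal.ofReal_mul (by nlinarith)]
    refine ENNReal.ofReal_le_ofReal (le_trans (le_of_eq ?_) hε')
    ring

end Upper

end

end SMP

namespace SMP

open Real (negMulLog log)

noncomputable section

/-! ### From `n` copies with finitely many messages to one copy -/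

section Copies

variable {X Y Z : Type*} [Fintype X] [Nonempty X] [MeasurableSpace X] [DiscreteMeasurableSpace X]
  [Fintype Y] [Nonempty Y] [MeasurableSpace Y] [DiscreteMeasurableSpace Y] {f : X → Y → Z} {ε : ℝ}

lemma lintegral_jointLaw_alice {X Y Z : Type*} (P : SMPProtocol X Y Z) (x : X)
    {F : P.MA → ℝ≥0∞} (hF : Measurable F) :
    ∫⁻ z, F z.2 ∂jointLaw P.lawA P.lawAC P.alice x = ∫⁻ r, F (P.msgA x r) ∂P.coinLaw := by
  have hx := P.measurable_alice x
  have hs : Measurable fun r : P.Coins => (r.1, P.sharedA r) := by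
    unfold SMPProtocol.sharedA
    fun_prop
  rw [jointLaw, lintegral_map (by fun_prop) (by fun_prop), ← map_coinLaw_alice,
    lintegral_map (by fun_prop) hs]
  rfl

lemma lintegral_jointLaw_bob {X Y Z : Type*} (P : SMPProtocol X Y Z) (y : Y)
    {F : P.MB → ℝ≥0∞} (hF : Measurable F) :
    ∫⁻ z, F z.2 ∂jointLaw P.lawB P.lawBC P.bob y = ∫⁻ r, F (P.msgB y r) ∂P.coinLaw := by
  have hy := P.measurable_bob y
  have hs : Measurable fun r : P.Coins => (r.2.1, P.sharedB r) := by
    unfold SMPProtocol.sharedB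
    fun_prop
  rw [jointLaw, lintegral_map (by fun_prop) (by fun_prop), ← map_coinLaw_bob,
    lintegral_map (by fun_prop) hs]
  rfl

/-- A protocol with finitely many messages for several copies gives a protocol for one copy, with
information cost at most the average cost per copy. -/
theorem infoComplexity_le_of_computesCopies {n : ℕ} (hn : 0 < n)
    (P : SMPProtocol (Fin n → X) (Fin n → Y) (Fin n → Z)) [Fintype P.MA] [Fintype P.MB]
    (hε : 0 ≤ ε) (hP : P.ComputesCopies f ε) {ℓA : P.MA → ℕ} {ℓB : P.MB → ℕ}
    (hℓA : ∑ m, (1 / 2 : ℝ) ^ ℓA m ≤ 1) (hℓB : ∑ m, (1 / 2 : ℝ) ^ ℓB m ≤ 1) {LA LB : ℝ}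
    (hLA : 0 ≤ LA) (hLB : 0 ≤ LB)
    (hA : ∀ x, ∫⁻ r, (ℓA (P.msgA x r) : ℝ≥0∞) ∂P.coinLaw ≤ ENNReal.ofReal LA)
    (hB : ∀ y, ∫⁻ r, (ℓB (P.msgB y r) : ℝ≥0∞) ∂P.coinLaw ≤ ENNReal.ofReal LB) :
    infoComplexity f ε ≤ ENNReal.ofReal ((LA + LB) / n) := by
  have hn' : (0 : ℝ) < n := by exact_mod_cast hn
  have hpA := isChannel_msgProb (lawR := P.lawA) P.measurable_alice
  have hpB := isChannel_msgProb (lawR := P.lawB) P.measurable_bob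
  have key : ∀ η : ℝ, 0 < η →
      infoComplexity f ε ≤ ENNReal.ofReal ((LA + LB) / n + 2 * η / log 2) := by
    intro η hη
    obtain ⟨σ, hσ, c, v, hc, hcs, hv, hsum⟩ := exists_singleLetter P.lawAC hη n _ hpA
    obtain ⟨τ, hτ, d, u, hd, hds, hu, hsum'⟩ := exists_singleLetter P.lawBC hη n _ hpB
    have h1 := hpA.avgInfo_le_length (ν := P.lawAC) hℓA hLA (fun x => by
      rw [← jointLaw_eq_chanLaw P.measurable_alice,
        lintegral_jointLaw_alice P x (F := fun m => (ℓA m : ℝ≥0∞)) (by fun_prop)]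
      exact hA x) hσ
    have h2 := hpB.avgInfo_le_length (ν := P.lawBC) hℓB hLB (fun y => by
      rw [← jointLaw_eq_chanLaw P.measurable_bob,
        lintegral_jointLaw_bob P y (F := fun m => (ℓB m : ℝ≥0∞)) (by fun_prop)]
      exact hB y) hτ
    -- The same position must be good for Alice and Bob together, so the average is taken over the
    -- sums.
    have hi : ∃ i, v i + u i ≤ ((LA + LB) / n + 2 * η / log 2) * log 2 := by
      by_contra! h
      have h3 := Finset.sum_lt_sum_of_nonempty (s := (Finset.univ : Finset (Fin n)))
        ⟨⟨0, hn⟩, Finset.mem_univ _⟩ fun i _ => h i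
      rw [Finset.sum_add_distrib] at h3
      simp only [Finset.sum_const, Finset.card_univ, Fintype.card_fin, nsmul_eq_mul] at h3
      have h4 : (n : ℝ) * (((LA + LB) / n + 2 * η / log 2) * log 2) =
          (LA + LB) * log 2 + 2 * (n * η) := by
        have := log_two_pos.ne'
        field_simp
      rw [h4] at h3
      linarith
    obtain ⟨i, hi⟩ := hi
    have hqA := hpA.mixture (hc i)
    have hqB := hpB.mixture (hd i)
    have hv0 : 0 ≤ v i := by
      classical
      have hs := single_mem_stdSimplex ℝ (Classical.arbitrary X)
      exact (hqA.avgInfo_nonneg P.lawAC hs).trans (hv i _ hs)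
    have hu0 : 0 ≤ u i := by
      classical
      have hs := single_mem_stdSimplex ℝ (Classical.arbitrary Y)
      exact (hqB.avgInfo_nonneg P.lawBC hs).trans (hu i _ hs)
    have hg : Measurable[_, ⊤] fun z => P.referee z i :=
      (show @Measurable _ _ ⊤ ⊤ fun z : Fin n → Z => z i from fun _ _ => trivial).comp
        P.measurable_referee
    have hle := infoComplexity_le_capacity (f := f) P.lawAC P.lawBC P.lawC hqA hqB hg hε ?_
    · refine hle.trans ((add_le_add (capacity_le_ofReal (hv i)) (capacity_le_ofReal (hu i))).trans
        ?_)
      rw [← ENNReal.ofReal_add (div_nonneg hv0 log_two_pos.le) (div_nonneg hu0 log_two_pos.le),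
        ← add_div]
      exact ENNReal.ofReal_le_ofReal ((div_le_iff₀ log_two_pos).2 hi)
    · intro x y
      -- Fillings of positive weight satisfy `w i = x` and `w' i = y`, so copy `i` asks for `f x y`.
      refine errProb_mixture_le (hc i x) (hd i y) hpA hpB (hg trivial) fun w w' hw hw' => ?_
      have h3 := coinLaw_output P w w' {z | z i ≠ f (w i) (w' i)}
      rw [jointLaw_eq_chanLaw P.measurable_alice, jointLaw_eq_chanLaw P.measurable_bob,
        hcs i x w hw, hds i y w' hw'] at h3
      refine h3.symm.trans_le ?_
      rw [ENNReal.le_ofReal_iff_toReal_le (measure_ne_top _ _) hε]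
      have h4 := hP w w' i
      rw [hcs i x w hw, hds i y w' hw'] at h4
      exact h4
  have hlim : Tendsto (fun η : ℝ => ENNReal.ofReal ((LA + LB) / n + 2 * η / log 2)) (𝓝[>] 0)
      (𝓝 (ENNReal.ofReal ((LA + LB) / n + 2 * 0 / log 2))) := by
    refine ((ENNReal.continuous_ofReal.comp ?_).tendsto 0).mono_left nhdsWithin_le_nhds
    fun_prop
  have := ge_of_tendsto hlim (eventually_nhdsWithin_of_forall fun η hη => key η hη)
  simpa using this

end Copies

/-! #### Restriction to finitely many messages -/

/-- Replaces the elements outside the finite set `F` by a fixed one. -/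
def truncate {M : Type*} (F : Finset M) (m₀ : F) (m : M) : F :=
  open Classical in if h : m ∈ F then ⟨m, h⟩ else m₀

lemma truncate_of_mem {M : Type*} {F : Finset M} (m₀ : F) {m : M} (h : m ∈ F) :
    (truncate F m₀ m : M) = m := by
  simp [truncate, h]

/-- The protocol in which messages outside finite sets are replaced by fixed ones. -/
def restrictMessages {X Y Z : Type*} (P : SMPProtocol X Y Z) (FA : Finset P.MA) (a : FA)
    (FB : Finset P.MB) (b : FB) : SMPProtocol X Y Z where
  RA := P.RA
  RB := P.RB
  RC := P.RC
  RAC := P.RAC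
  RBC := P.RBC
  lawA := P.lawA
  lawB := P.lawB
  lawC := P.lawC
  lawAC := P.lawAC
  lawBC := P.lawBC
  MA := FA
  MB := FB
  nonemptyMA := ⟨a⟩
  nonemptyMB := ⟨b⟩
  alice x r := truncate FA a (P.alice x r)
  bob y r := truncate FB b (P.bob y r)
  referee z := P.referee (z.1, z.2.1, z.2.2)
  measurable_alice x :=
    (Measurable.of_discrete (f := truncate FA a)).comp (P.measurable_alice x)
  measurable_bob y := (Measurable.of_discrete (f := truncate FB b)).comp (P.measurable_bob y)
  measurable_referee := P.measurable_referee.comp (by fun_prop)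

instance {X Y Z : Type*} (P : SMPProtocol X Y Z) (FA : Finset P.MA) (a : FA)
    (FB : Finset P.MB) (b : FB) : Fintype (restrictMessages P FA a FB b).MA :=
  inferInstanceAs (Fintype FA)

instance {X Y Z : Type*} (P : SMPProtocol X Y Z) (FA : Finset P.MA) (a : FA)
    (FB : Finset P.MB) (b : FB) : Fintype (restrictMessages P FA a FB b).MB :=
  inferInstanceAs (Fintype FB)

/-- Up to a small probability, a random variable with countably many values has values in a finite
set. -/
lemma eventually_measure_notMem_le {Ω M : Type*} [MeasurableSpace Ω] [Countable M]
    [MeasurableSpace M] [DiscreteMeasurableSpace M] (μ : Measure Ω) [IsFiniteMeasure μ]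
    {V : Ω → M} (hV : Measurable V) {η : ℝ≥0∞} (hη : 0 < η) :
    ∀ᶠ F : Finset M in atTop, μ {ω | V ω ∉ F} ≤ η := by
  have hlim := tendsto_measure_iInter_atTop (μ := μ) (s := fun F : Finset M => {ω | V ω ∉ F})
    (fun F => (hV (.of_discrete (s := {m | m ∉ F}))).nullMeasurableSet)
    (fun F G h ω hω hF => hω (h hF)) ⟨∅, measure_ne_top _ _⟩
  have h0 : ⋂ F : Finset M, {ω | V ω ∉ F} = ∅ := by
    ext ω
    simp only [Set.mem_iInter, Set.mem_ofPred_eq, Set.mem_empty_iff_false, iff_false, not_forall,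
      not_not]
    exact ⟨{V ω}, by simp⟩
  rw [h0, measure_empty] at hlim
  exact (hlim.eventually (gt_mem_nhds hη)).mono fun F hF => hF.le

section Average

variable {X Y Z : Type*} [Fintype X] [Nonempty X] [MeasurableSpace X] [DiscreteMeasurableSpace X]
  [Fintype Y] [Nonempty Y] [MeasurableSpace Y] [DiscreteMeasurableSpace Y] {f : X → Y → Z} {ε : ℝ}

lemma measurable_msgA {X Y Z : Type*} (P : SMPProtocol X Y Z) (x : X) : Measurable (P.msgA x) := by
  have := P.measurable_alice x
  unfold SMPProtocol.msgA SMPProtocol.sharedA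
  fun_prop

lemma measurable_msgB {X Y Z : Type*} (P : SMPProtocol X Y Z) (y : Y) : Measurable (P.msgB y) := by
  have := P.measurable_bob y
  unfold SMPProtocol.msgB SMPProtocol.sharedB
  fun_prop

/-- The length of each message depends on the sender's input alone, so the supremum over pairs
splits. -/
lemma avgCost_eq_add {X Y Z : Type*} [Nonempty X] [Nonempty Y] (P : AvgSMPProtocol X Y Z) :
    P.avgCost = (⨆ x, ∫⁻ r, ((P.encA (P.msgA x r)).length : ℝ≥0∞) ∂P.coinLaw) +
      ⨆ y, ∫⁻ r, ((P.encB (P.msgB y r)).length : ℝ≥0∞) ∂P.coinLaw := by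
  have h : ∀ x y, P.avgCostAt x y =
      ∫⁻ r, ((P.encA (P.msgA x r)).length : ℝ≥0∞) ∂P.coinLaw +
        ∫⁻ r, ((P.encB (P.msgB y r)).length : ℝ≥0∞) ∂P.coinLaw := by
    intro x y
    have hm : Measurable fun r => ((P.encA (P.msgA x r)).length : ℝ≥0∞) :=
      (Measurable.of_discrete (f := fun m => ((P.encA m).length : ℝ≥0∞))).comp
        (measurable_msgA P.toSMPProtocol x)
    rw [AvgSMPProtocol.avgCostAt, ← lintegral_add_left hm]
    simp
  simp only [AvgSMPProtocol.avgCost, h]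
  refine le_antisymm (iSup₂_le fun x y => add_le_add (le_iSup_of_le x le_rfl)
    (le_iSup_of_le y le_rfl)) ?_
  exact ENNReal.iSup_add_iSup_le fun x y => le_iSup₂_of_le x y le_rfl

/-- An average length protocol for several copies gives a protocol for one copy, with slightly
larger error. -/
theorem infoComplexity_le_avgCost_div {n : ℕ} (hn : 0 < n)
    (P : AvgSMPProtocol (Fin n → X) (Fin n → Y) (Fin n → Z)) (hε : 0 ≤ ε)
    (hP : P.ComputesCopies f ε) {η : ℝ} (hη : 0 < η) :
    infoComplexity f (ε + η) ≤ P.avgCost / n := by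
  classical
  by_cases hfin : P.avgCost = ∞
  · rw [hfin, ENNReal.top_div_of_ne_top (ENNReal.natCast_ne_top n)]
    exact le_top
  set CA := ⨆ x, ∫⁻ r, ((P.encA (P.msgA x r)).length : ℝ≥0∞) ∂P.coinLaw with hCA
  set CB := ⨆ y, ∫⁻ r, ((P.encB (P.msgB y r)).length : ℝ≥0∞) ∂P.coinLaw with hCB
  rw [avgCost_eq_add] at hfin ⊢
  obtain ⟨hA, hB⟩ := ENNReal.add_ne_top.1 hfin
  have hη2 : (0 : ℝ≥0∞) < ENNReal.ofReal (η / 2) := ENNReal.ofReal_pos.2 (by linarith)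
  have hAm := Function.argmin_le (fun m => (P.encA m).length)
  have hBm := Function.argmin_le (fun m => (P.encB m).length)
  -- Messages outside the finite set become one with a shortest codeword, so no length increases.
  set a₀ : P.MA := Function.argmin fun m => (P.encA m).length with ha₀
  set b₀ : P.MB := Function.argmin fun m => (P.encB m).length with hb₀
  -- There are finitely many inputs, so one finite set of messages serves them all; each party
  -- accounts for half of the extra error `η`.
  obtain ⟨FA, hFA, hFAa⟩ := ((eventually_all.2 fun x => eventually_measure_notMem_le P.coinLaw
    (measurable_msgA P.toSMPProtocol x) hη2).and (eventually_ge_atTop {a₀})).exists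
  obtain ⟨FB, hFB, hFBb⟩ := ((eventually_all.2 fun y => eventually_measure_notMem_le P.coinLaw
    (measurable_msgB P.toSMPProtocol y) hη2).and (eventually_ge_atTop {b₀})).exists
  have ha : a₀ ∈ FA := hFAa (Finset.mem_singleton_self _)
  have hb : b₀ ∈ FB := hFBb (Finset.mem_singleton_self _)
  let Q := restrictMessages P.toSMPProtocol FA ⟨a₀, ha⟩ FB ⟨b₀, hb⟩
  have hlenA : ∀ m, (P.encA (truncate FA ⟨a₀, ha⟩ m)).length ≤ (P.encA m).length := by
    intro m
    unfold truncate
    split_ifs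
    · exact le_rfl
    · exact hAm m
  have hlenB : ∀ m, (P.encB (truncate FB ⟨b₀, hb⟩ m)).length ≤ (P.encB m).length := by
    intro m
    unfold truncate
    split_ifs
    · exact le_rfl
    · exact hBm m
  have hQ : Q.ComputesCopies f (ε + η) := by
    intro x y i
    refine ENNReal.toReal_le_of_le_ofReal (by linarith) ?_
    have hsub : {r : Q.Coins | Q.output x y r i ≠ f (x i) (y i)} ⊆
        ({r : P.Coins | P.output x y r i ≠ f (x i) (y i)} ∪ {r : P.Coins | P.msgA x r ∉ FA}) ∪
          {r : P.Coins | P.msgB y r ∉ FB} := by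
      intro r hr
      by_contra hc
      have h1 : P.output x y r i = f (x i) (y i) := by
        by_contra h
        exact hc (Or.inl (Or.inl h))
      have h2 : P.msgA x r ∈ FA := by
        by_contra h
        exact hc (Or.inl (Or.inr h))
      have h3 : P.msgB y r ∈ FB := by
        by_contra h
        exact hc (Or.inr h)
      refine hr ?_
      rw [← h1]
      change P.referee (truncate FA ⟨a₀, ha⟩ (P.msgA x r), truncate FB ⟨b₀, hb⟩ (P.msgB y r),
        r.2.2.1, P.sharedA r, P.sharedB r) i = _
      rw [truncate_of_mem _ h2, truncate_of_mem _ h3]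
      rfl
    calc Q.coinLaw {r : Q.Coins | Q.output x y r i ≠ f (x i) (y i)}
        ≤ P.coinLaw (({r : P.Coins | P.output x y r i ≠ f (x i) (y i)} ∪
          {r : P.Coins | P.msgA x r ∉ FA}) ∪ {r : P.Coins | P.msgB y r ∉ FB}) :=
          measure_mono hsub
      _ ≤ (ENNReal.ofReal ε + ENNReal.ofReal (η / 2)) + ENNReal.ofReal (η / 2) := by
          refine (measure_union_le _ _).trans (add_le_add ((measure_union_le _ _).trans
            (add_le_add ?_ (hFA x))) (hFB y))
          rw [ENNReal.le_ofReal_iff_toReal_le (measure_ne_top _ _) hε]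
          exact hP x y i
      _ = ENNReal.ofReal (ε + η) := by
          rw [← ENNReal.ofReal_add hε (by linarith), ← ENNReal.ofReal_add (by linarith)
            (by linarith)]
          congr 1
          ring
  have h := infoComplexity_le_of_computesCopies hn Q (by linarith) hQ
    (ℓA := fun m : FA => (P.encA m).length) (ℓB := fun m : FB => (P.encB m).length)
    (kraft_inequality (enc := fun m : FA => P.encA m) fun m m' hm => Subtype.ext (P.prefixA _ _ hm))
    (kraft_inequality (enc := fun m : FB => P.encB m) fun m m' hm => Subtype.ext (P.prefixB _ _ hm))
    (LA := CA.toReal) (LB := CB.toReal) ENNReal.toReal_nonneg ENNReal.toReal_nonneg ?_ ?_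
  · refine h.trans (le_of_eq ?_)
    rw [ENNReal.ofReal_div_of_pos (by exact_mod_cast hn), ENNReal.ofReal_natCast,
      ENNReal.ofReal_add ENNReal.toReal_nonneg ENNReal.toReal_nonneg, ENNReal.ofReal_toReal hA,
      ENNReal.ofReal_toReal hB]
  · intro x
    rw [ENNReal.ofReal_toReal hA]
    exact le_iSup_of_le x (lintegral_mono fun r =>
      Nat.cast_le.2 (hlenA (P.msgA x r)))
  · intro y
    rw [ENNReal.ofReal_toReal hB]
    exact le_iSup_of_le y (lintegral_mono fun r =>
      Nat.cast_le.2 (hlenB (P.msgB y r)))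

/-- The information complexity is at most the communication cost per copy. -/
theorem infoComplexity_le_avgCommCopies_div (f : X → Y → Z) (hε : 0 < ε) {n : ℕ} (hn : 0 < n) :
    infoComplexity f ε ≤ avgCommCopies f ε n / n := by
  have h1 : ∀ η : ℝ, 0 < η → infoComplexity f (ε + η) ≤ avgCommCopies f ε n / n := by
    intro η hη
    rw [ENNReal.le_div_iff_mul_le (Or.inl (by exact_mod_cast hn.ne'))
      (Or.inl (ENNReal.natCast_ne_top n))]
    refine le_iInf₂ fun P hP => ?_
    rw [← ENNReal.le_div_iff_mul_le (Or.inl (by exact_mod_cast hn.ne'))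
      (Or.inl (ENNReal.natCast_ne_top n))]
    exact infoComplexity_le_avgCost_div hn P hε.le hP hη
  set C : ℝ := log (Fintype.card X) + log (Fintype.card Y) with hC
  have h2 : ∀ δ ∈ Set.Ioo (0 : ℝ) 1, infoComplexity f ε ≤
      avgCommCopies f ε n / n + ENNReal.ofReal (δ * C / log 2) := by
    intro δ hδ
    -- The truncation error `η = ε * δ ^ 2` is absorbed, because `(1 - δ ^ 2) * (1 + δ ^ 2) ≤ 1`.
    -- Then `δ` tends to zero.
    refine (infoComplexity_le_add (ε' := ε + ε * δ ^ 2) hδ.1.le hδ.2.le hε.le ?_).trans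
      (add_le_add (h1 _ (by have := hδ.1; positivity)) le_rfl)
    have : 0 ≤ ε * (δ ^ 2) ^ 2 := by positivity
    nlinarith
  have hlim : Tendsto (fun δ : ℝ => avgCommCopies f ε n / n + ENNReal.ofReal (δ * C / log 2))
      (𝓝[>] 0) (𝓝 (avgCommCopies f ε n / n + ENNReal.ofReal (0 * C / log 2))) := by
    refine tendsto_const_nhds.add (((ENNReal.continuous_ofReal.comp ?_).tendsto 0).mono_left
      nhdsWithin_le_nhds)
    fun_prop
  have := ge_of_tendsto hlim (eventually_of_mem (Ioo_mem_nhdsGT one_pos) h2)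
  simpa using this

end Average

end

end SMP

/-! ### Simulation of channels with shared randomness -/

namespace SMP

open Real (negMulLog log)
open scoped unitInterval

noncomputable section

/-! #### Codes -/

/-- The header `c (g m)` is read first, so the tail `e m` need be prefix-free only among messages
with the same header. -/
lemma isPrefixCode_append {M A : Type*} {c : A → List Bool} (hc : IsPrefixCode c) {g : M → A}
    {e : M → List Bool} (he : ∀ m m', g m = g m' → e m <+: e m' → m = m') :
    IsPrefixCode fun m => c (g m) ++ e m := by
  intro m m' h
  have hg : g m = g m' := by
    rcases List.prefix_or_prefix_of_prefix ((List.prefix_append _ _).trans h)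
      (List.prefix_append (c (g m')) (e m')) with h1 | h1
    · exact hc _ _ h1
    · exact (hc _ _ h1).symm
  refine he m m' hg ?_
  simp only [hg] at h
  exact (List.prefix_append_right_inj _).1 h

/-- The unary code. -/
def unaryCode (q : ℕ) : List Bool := List.replicate q true ++ [false]

lemma isPrefixCode_unaryCode : IsPrefixCode unaryCode := by
  intro q
  induction q with
  | zero =>
    intro q' h
    cases q' with
    | zero => rfl
    | succ q' => simp [unaryCode, List.replicate_succ] at h
  | succ q ih =>
    intro q' h
    cases q' with
    | zero => simp [unaryCode, List.replicate_succ] at h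
    | succ q' =>
      have : unaryCode q <+: unaryCode q' := by
        simpa [unaryCode, List.replicate_succ] using h
      rw [ih _ this]

/-- The `L` lowest binary digits of a number. -/
def bitCode (L N : ℕ) : List Bool := List.ofFn fun i : Fin L => N.testBit i

@[simp] lemma length_bitCode (L N : ℕ) : (bitCode L N).length = L := by simp [bitCode]

lemma eq_of_bitCode_prefix {L N N' : ℕ} (hN : N < 2 ^ L) (hN' : N' < 2 ^ L)
    (h : bitCode L N <+: bitCode L N') : N = N' := by
  have h1 : bitCode L N = bitCode L N' := h.eq_of_length (by simp)
  have h2 := List.ofFn_injective h1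
  refine Nat.eq_of_testBit_eq fun i => ?_
  by_cases hi : i < L
  · exact congrFun h2 ⟨i, hi⟩
  · have hpow : 2 ^ L ≤ 2 ^ i := Nat.pow_le_pow_right two_pos (not_lt.1 hi)
    rw [Nat.testBit_eq_false_of_lt (hN.trans_le hpow),
      Nat.testBit_eq_false_of_lt (hN'.trans_le hpow)]

/-- A code for the natural numbers: the number of blocks of `b` digits, in unary, followed by the
digits. -/
def blockCode (b N : ℕ) : List Bool :=
  unaryCode (N.size / b + 1) ++ bitCode ((N.size / b + 1) * b) N

lemma isPrefixCode_blockCode {b : ℕ} (hb : 0 < b) : IsPrefixCode (blockCode b) := by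
  refine isPrefixCode_append isPrefixCode_unaryCode (g := fun N : ℕ => N.size / b + 1)
    fun N N' hg he => ?_
  have hlt : ∀ N : ℕ, N < 2 ^ ((N.size / b + 1) * b) := fun N =>
    (Nat.lt_size_self N).trans_le (Nat.pow_le_pow_right two_pos (by
      rw [add_mul, one_mul, mul_comm]
      exact (Nat.lt_mul_div_succ N.size hb).le.trans_eq (by ring)))
  refine eq_of_bitCode_prefix (hlt N) (hg ▸ hlt N') ?_
  rw [← hg] at he
  exact he

lemma size_le_log (N : ℕ) : (N.size : ℝ) ≤ log N / log 2 + 1 := by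
  have hlog := log_two_pos
  rcases N.eq_zero_or_pos with rfl | h
  · simp
  have hs : 0 < N.size := Nat.size_pos.2 h
  have h3 : 2 ^ (N.size - 1) ≤ N := Nat.lt_size.1 (by omega)
  have h4 : (2 : ℝ) ^ (N.size - 1) ≤ N := by exact_mod_cast h3
  have h5 := Real.log_le_log (by positivity) h4
  rw [Real.log_pow, Nat.cast_sub hs] at h5
  rw [← sub_le_iff_le_add, le_div_iff₀ hlog]
  simpa using h5

/-- The unary header costs one bit per block of `b` digits, whence the factor `1 + 1 / b` on the
binary logarithm; the rest is constant. -/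
lemma length_blockCode_le {b : ℕ} (hb : 0 < b) (N : ℕ) :
    ((blockCode b N).length : ℝ) ≤ (b + 4) + (1 + 1 / b) / log 2 * log (N + 1) := by
  have hb' : (1 : ℝ) ≤ b := by exact_mod_cast hb
  have hlog : 0 < log 2 := Real.log_pos one_lt_two
  have h1 : ((N.size / b : ℕ) : ℝ) ≤ N.size / b := Nat.cast_div_le
  have h2 : (N.size : ℝ) ≤ log (N + 1) / log 2 + 1 := by
    refine (size_le_log N).trans (add_le_add_left (div_le_div_of_nonneg_right ?_ hlog.le) 1)
    rcases N.eq_zero_or_pos with rfl | h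
    · simp
    · exact Real.log_le_log (by exact_mod_cast h) (by linarith)
  have h6 : ((blockCode b N).length : ℝ) =
      ((N.size / b : ℕ) + 1) + 1 + ((N.size / b : ℕ) + 1) * b := by
    simp [blockCode, unaryCode]
    ring
  rw [h6]
  have h7 : ((N.size / b : ℕ) : ℝ) * (1 + b) ≤ N.size / b * (1 + b) :=
    mul_le_mul_of_nonneg_right h1 (by linarith)
  have h8 : (N.size : ℝ) / b * (1 + b) = (1 + 1 / b) * N.size := by
    field_simp
    ring
  have h9 : (1 + 1 / (b : ℝ)) * N.size ≤ (1 + 1 / b) * (log (N + 1) / log 2 + 1) :=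
    mul_le_mul_of_nonneg_left h2 (by positivity)
  have h10 : (1 : ℝ) / b ≤ 1 := by
    rw [div_le_one (by linarith)]
    exact hb'
  have h11 : (1 + 1 / (b : ℝ)) * (log (N + 1) / log 2 + 1) =
      (1 + 1 / b) / log 2 * log (N + 1) + 1 + 1 / b := by ring
  linarith

/-! #### The first element of a random sequence in a given set -/

/-- The index of the first element of a sequence that is in `A`. -/
def firstHit {E : Type*} (A : Set E) (e : ℕ → E) : ℕ := sInf {j | e j ∈ A}

lemma measurable_sInf_nat {Ω : Type*} [MeasurableSpace Ω] {p : ℕ → Ω → Prop}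
    (hp : ∀ j, MeasurableSet {ω | p j ω}) : Measurable fun ω => sInf {j | p j ω} := by
  classical
  refine measurable_to_countable' fun n => ?_
  -- The infimum of the empty set is `0`, so the fibre over `0` has an extra piece.
  have h : (fun ω => sInf {j | p j ω}) ⁻¹' {n} =
      ({ω | p n ω} ∩ ⋂ i : Fin n, {ω | p i ω}ᶜ) ∪
        (if n = 0 then ⋂ i : ℕ, {ω | p i ω}ᶜ else ∅) := by
    ext ω
    simp only [Set.mem_preimage, Set.mem_singleton_iff, Set.mem_union, Set.mem_inter_iff,
      Set.mem_iInter, Set.mem_compl_iff]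
    constructor
    · intro hn
      by_cases hne : {j | p j ω}.Nonempty
      · refine Or.inl ⟨?_, fun i hi => ?_⟩
        · have := Nat.sInf_mem hne
          rwa [hn] at this
        · exact Nat.notMem_of_lt_sInf (i.2.trans_eq hn.symm) hi
      · right
        rw [Set.not_nonempty_iff_eq_empty.1 hne, Nat.sInf_empty] at hn
        rw [if_pos hn.symm]
        simp only [Set.mem_iInter, Set.mem_compl_iff]
        exact fun i hi => hne ⟨i, hi⟩
    · rintro (⟨h1, h2⟩ | h1)
      · refine le_antisymm (Nat.sInf_le h1) ?_
        by_contra hlt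
        exact h2 ⟨_, not_le.1 hlt⟩ (Nat.sInf_mem (s := {j | p j ω}) ⟨n, h1⟩)
      · split_ifs at h1 with hn
        · simp only [Set.mem_iInter, Set.mem_compl_iff] at h1
          have : {j | p j ω} = ∅ := Set.eq_empty_of_forall_notMem h1
          rw [this, Nat.sInf_empty, hn]
        · exact absurd h1 (Set.notMem_empty _)
  rw [h]
  refine ((hp n).inter (MeasurableSet.iInter fun i : Fin n => (hp i).compl)).union ?_
  split_ifs
  · exact MeasurableSet.iInter fun i => (hp i).compl
  · exact MeasurableSet.empty

section FirstHit

variable {E : Type*} [MeasurableSpace E] (ρ : Measure E) [IsProbabilityMeasure ρ] {A C : Set E}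

lemma infinitePi_first (hA : MeasurableSet A) (hC : MeasurableSet C) (j : ℕ) :
    Measure.infinitePi (fun _ : ℕ => ρ) {e | (∀ i < j, e i ∉ A) ∧ e j ∈ C} =
      (1 - ρ A) ^ j * ρ C := by
  have h : {e : ℕ → E | (∀ i < j, e i ∉ A) ∧ e j ∈ C} =
      Set.pi (Finset.range (j + 1)) fun i => if i < j then Aᶜ else C := by
    ext e
    simp only [Set.mem_ofPred_eq, Set.mem_pi, Finset.coe_range, Set.mem_Iio]
    constructor
    · rintro ⟨h1, h2⟩ i hi
      split_ifs with hij
      · exact h1 i hij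
      · have : i = j := by omega
        exact this ▸ h2
    · intro h
      refine ⟨fun i hi => ?_, ?_⟩
      · simpa [hi] using h i (by omega)
      · simpa using h j (by omega)
  rw [h, Measure.infinitePi_pi _ fun i _ => ?_, Finset.prod_range_succ]
  · congr 1
    · rw [Finset.prod_congr rfl (g := fun _ => 1 - ρ A)]
      · simp
      · intro i hi
        rw [if_pos (Finset.mem_range.1 hi), prob_compl_eq_one_sub hA]
    · simp
  · split_ifs
    · exact hA.compl
    · exact hC

lemma tsum_one_sub_pow (A : Set E) : ∑' j : ℕ, (1 - ρ A) ^ j = (ρ A)⁻¹ := by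
  rw [ENNReal.tsum_geometric, ENNReal.sub_sub_cancel ENNReal.one_ne_top prob_le_one]

/-- The first element in `A` is in `C ⊆ A` with at least the conditional probability. -/
lemma div_le_infinitePi_firstHit (hA : MeasurableSet A) (hC : MeasurableSet C) (hCA : C ⊆ A) :
    ρ C / ρ A ≤ Measure.infinitePi (fun _ : ℕ => ρ) {e | e (firstHit A e) ∈ C} := by
  have hsub : (⋃ j : ℕ, {e : ℕ → E | (∀ i < j, e i ∉ A) ∧ e j ∈ C}) ⊆
      {e | e (firstHit A e) ∈ C} := by
    refine Set.iUnion_subset fun j e he => ?_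
    have : firstHit A e = j := by
      refine le_antisymm (Nat.sInf_le (hCA he.2)) ?_
      by_contra hlt
      exact he.1 _ (not_le.1 hlt) (Nat.sInf_mem (s := {j | e j ∈ A}) ⟨j, hCA he.2⟩)
    rw [Set.mem_ofPred_eq, this]
    exact he.2
  refine le_trans ?_ (measure_mono hsub)
  rw [measure_iUnion]
  · simp_rw [infinitePi_first ρ hA hC]
    rw [ENNReal.tsum_mul_right, tsum_one_sub_pow ρ A, mul_comm, ENNReal.div_eq_inv_mul,
      mul_comm]
  · intro j j' hjj
    rw [Function.onFun, Set.disjoint_left]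
    rintro e ⟨h1, h2⟩ ⟨h3, h4⟩
    rcases lt_or_gt_of_ne hjj with h | h
    · exact h3 j h (hCA h2)
    · exact h1 j' h (hCA h4)
  · intro j
    have hi : ∀ i : ℕ, MeasurableSet {e : ℕ → E | e i ∉ A} := fun i =>
      (measurable_pi_apply i : Measurable fun e : ℕ → E => e i) hA.compl
    have h1 : MeasurableSet (⋂ i : Fin j, {e : ℕ → E | e i ∉ A}) :=
      MeasurableSet.iInter fun i => hi i
    have h2 : MeasurableSet {e : ℕ → E | e j ∈ C} := measurable_pi_apply j hC
    convert h1.inter h2 using 1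
    ext e
    simp only [Set.mem_ofPred_eq, Set.mem_inter_iff, Set.mem_iInter]
    exact ⟨fun h => ⟨fun i => h.1 i i.2, h.2⟩, fun h => ⟨fun i hi => h.1 ⟨i, hi⟩, h.2⟩⟩

/-- The mean of a geometric variable as a sum of tail probabilities. On sequences that never hit `A`
the index is `0` by default, which is harmless for an upper bound. -/
lemma lintegral_firstHit_le (hA : MeasurableSet A) :
    ∫⁻ e, ((firstHit A e : ℝ≥0∞) + 1) ∂Measure.infinitePi (fun _ : ℕ => ρ) ≤ (ρ A)⁻¹ := by
  set s : ℕ → Set (ℕ → E) := fun j => {e | (∀ i < j, e i ∉ A) ∧ e j ∈ Set.univ} with hs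
  have hsm : ∀ j, MeasurableSet (s j) := by
    intro j
    have hi : ∀ i : ℕ, MeasurableSet {e : ℕ → E | e i ∉ A} := fun i =>
      (measurable_pi_apply i : Measurable fun e : ℕ → E => e i) hA.compl
    have h1 : MeasurableSet (⋂ i : Fin j, {e : ℕ → E | e i ∉ A}) :=
      MeasurableSet.iInter fun i => hi i
    convert h1 using 1
    ext e
    simp only [hs, Set.mem_ofPred_eq, Set.mem_univ, and_true, Set.mem_iInter]
    exact ⟨fun h i => h i i.2, fun h i hi => h ⟨i, hi⟩⟩
  calc _ ≤ ∫⁻ e, ∑' j, (s j).indicator 1 e ∂Measure.infinitePi (fun _ : ℕ => ρ) := by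
        refine lintegral_mono fun e => ?_
        refine le_trans (le_of_eq ?_) (ENNReal.sum_le_tsum (Finset.range (firstHit A e + 1)))
        rw [Finset.sum_congr rfl (g := fun _ => 1)]
        · simp
        · intro j hj
          have : e ∈ s j := ⟨fun i hi => Nat.notMem_of_lt_sInf
            (hi.trans_le (Nat.lt_succ_iff.1 (Finset.mem_range.1 hj))), trivial⟩
          simp [this]
    _ = ∑' j, (1 - ρ A) ^ j := by
        rw [lintegral_tsum fun j => (measurable_one.indicator (hsm j)).aemeasurable]
        refine tsum_congr fun j => ?_
        rw [lintegral_indicator_one (hsm j), hs, infinitePi_first ρ hA MeasurableSet.univ,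
          measure_univ, mul_one]
    _ = _ := tsum_one_sub_pow ρ A

/-- The average length of an encoding of the index of the first element in `A`. -/
lemma lintegral_length_firstHit_le (hA : MeasurableSet A) {ℓ : ℕ → ℕ} {c₀ c₁ a : ℝ}
    (h0 : 0 ≤ c₀) (h1 : 0 ≤ c₁) (hℓ : ∀ j : ℕ, (ℓ j : ℝ) ≤ c₀ + c₁ * log (j + 1)) (ha : 0 < a)
    (ha1 : a ≤ 1) (hρ : ρ A = ENNReal.ofReal a) :
    ∫⁻ e, (ℓ (firstHit A e) : ℝ≥0∞) ∂Measure.infinitePi (fun _ : ℕ => ρ) ≤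
      ENNReal.ofReal (c₀ + c₁ + c₁ * (-log a)) := by
  have hla : 0 ≤ c₁ * (-log a) := mul_nonneg h1 (by linarith [Real.log_nonpos ha.le ha1])
  have key : ∀ j : ℕ, (ℓ j : ℝ≥0∞) ≤
      ENNReal.ofReal (c₀ + c₁ * (-log a)) + ENNReal.ofReal (c₁ * a) * ((j : ℝ≥0∞) + 1) := by
    intro j
    have hj : (0 : ℝ) < j + 1 := by positivity
    -- The tangent to `log` at `1 / a`, with its constant `-1` dropped. As `j + 1` has mean at most
    -- `1 / a`, the linear term contributes at most `c₁`.
    have h2 : log ((j : ℝ) + 1) ≤ -log a + a * (j + 1) := by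
      have := Real.log_le_sub_one_of_pos (mul_pos ha hj)
      rw [Real.log_mul ha.ne' hj.ne'] at this
      linarith
    have h3 : (ℓ j : ℝ) ≤ (c₀ + c₁ * (-log a)) + c₁ * a * (j + 1) := by
      have := mul_le_mul_of_nonneg_left h2 h1
      linarith [hℓ j]
    have h4 : ((j : ℝ≥0∞) + 1) = ENNReal.ofReal (j + 1) := by
      rw [ENNReal.ofReal_add (by positivity) zero_le_one]
      simp
    rw [h4, ← ENNReal.ofReal_mul (by positivity), ← ENNReal.ofReal_add (by positivity)
      (by positivity), ← ENNReal.ofReal_natCast]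
    exact ENNReal.ofReal_le_ofReal h3
  calc _ ≤ ∫⁻ e, (ENNReal.ofReal (c₀ + c₁ * (-log a)) + ENNReal.ofReal (c₁ * a) *
        ((firstHit A e : ℝ≥0∞) + 1)) ∂Measure.infinitePi (fun _ : ℕ => ρ) :=
        lintegral_mono fun e => key _
    _ = ENNReal.ofReal (c₀ + c₁ * (-log a)) + ENNReal.ofReal (c₁ * a) *
        ∫⁻ e, ((firstHit A e : ℝ≥0∞) + 1) ∂Measure.infinitePi (fun _ : ℕ => ρ) := by
        rw [lintegral_add_left measurable_const, lintegral_const_mul' _ _ ENNReal.ofReal_ne_top]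
        simp
    _ ≤ ENNReal.ofReal (c₀ + c₁ * (-log a)) + ENNReal.ofReal (c₁ * a) * (ρ A)⁻¹ := by
        gcongr
        exact lintegral_firstHit_le ρ hA
    _ = _ := by
        rw [hρ, ← ENNReal.ofReal_inv_of_pos ha, ← ENNReal.ofReal_mul (by positivity),
          mul_assoc, mul_inv_cancel₀ ha.ne', mul_one, ← ENNReal.ofReal_add (by positivity) h1]
        congr 1
        ring

end FirstHit

/-! #### Rejection sampling by levels of the likelihood ratio -/

section Levels

variable {W : Type*} {p q : W → ℝ}

/-- The binary logarithm of the likelihood ratio, rounded up to a natural number. -/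
def level (p q : W → ℝ) (w : W) : ℕ := ⌈Real.logb 2 (p w / q w)⌉₊

/-- This is what makes `p w / (2 ^ k * q w)` an acceptance probability at level `k`. -/
lemma le_two_pow_level_mul (hp : ∀ w, 0 ≤ p w) (hq : ∀ w, 0 ≤ q w) (hpq : ∀ w, q w = 0 → p w = 0)
    (w : W) : p w ≤ 2 ^ level p q w * q w := by
  rcases (hq w).eq_or_lt with h | h
  · simp [← h, hpq w h.symm]
  rcases (hp w).eq_or_lt with h' | h'
  · rw [← h']
    positivity
  rw [← div_le_iff₀ h, ← Real.rpow_natCast, ← Real.logb_le_iff_le_rpow one_lt_two (div_pos h' h)]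
  exact Nat.le_ceil _

/-- Summed over `w`, the mean level in nats is at most the divergence plus `1 + log 2`. The term `p
w * log 2` pays for rounding up, and `q w` for the negative log-ratios, which the level replaces by
zero. -/
lemma mul_level_le (hp : ∀ w, 0 ≤ p w) (hq : ∀ w, 0 ≤ q w) (hpq : ∀ w, q w = 0 → p w = 0)
    (w : W) : p w * (level p q w * log 2) ≤ p w * (log (p w) - log (q w)) + q w + p w * log 2 := by
  have hlog : 0 < log 2 := Real.log_pos one_lt_two
  rcases (hp w).eq_or_lt with h' | h'
  · rw [← h']
    simpa using hq w
  have h : 0 < q w := (hq w).lt_of_ne fun h => h'.ne' (hpq w h.symm)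
  have hlb : Real.logb 2 (p w / q w) * log 2 = log (p w) - log (q w) := by
    rw [Real.logb, div_mul_cancel₀ _ hlog.ne', Real.log_div h'.ne' h.ne']
  rcases le_total 0 (Real.logb 2 (p w / q w)) with h0 | h0
  · have h1 : (level p q w : ℝ) ≤ Real.logb 2 (p w / q w) + 1 := (Nat.ceil_lt_add_one h0).le
    have h2 := mul_le_mul_of_nonneg_left (mul_le_mul_of_nonneg_right h1 hlog.le) h'.le
    rw [add_mul, hlb] at h2
    linarith
  · have h1 : level p q w = 0 := by
      rw [level, Nat.ceil_eq_zero]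
      exact h0
    have h2 := Real.log_le_sub_one_of_pos (div_pos h h')
    rw [Real.log_div h.ne' h'.ne'] at h2
    have h3 := mul_le_mul_of_nonneg_left h2 h'.le
    have h4 : p w * (q w / p w - 1) = q w - p w := by field_simp
    rw [h4] at h3
    rw [h1]
    simp only [Nat.cast_zero, zero_mul, mul_zero]
    have := mul_pos h' hlog
    nlinarith

variable [Fintype W]

/-- The probability of a level. -/
def levelProb (p q : W → ℝ) (k : ℕ) : ℝ := ∑ w with level p q w = k, p w

lemma le_levelProb (hp : p ∈ stdSimplex ℝ W) (w : W) : p w ≤ levelProb p q (level p q w) :=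
  Finset.single_le_sum (f := p) (fun w _ => hp.1 w) (by simp)

lemma levelProb_nonneg (hp : p ∈ stdSimplex ℝ W) (k : ℕ) : 0 ≤ levelProb p q k :=
  Finset.sum_nonneg fun w _ => hp.1 w

lemma levelProb_le_one (hp : p ∈ stdSimplex ℝ W) (k : ℕ) : levelProb p q k ≤ 1 := by
  rw [← hp.2]
  exact Finset.sum_le_sum_of_subset_of_nonneg (Finset.filter_subset _ _) fun w _ _ => hp.1 w

lemma sum_div_levelProb_le {g : ℕ → ℝ} (hg : ∀ k, 0 ≤ g k)
    (hgs : ∀ s : Finset ℕ, ∑ k ∈ s, g k ≤ 1) :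
    ∑ w, p w * (g (level p q w) / levelProb p q (level p q w)) ≤ 1 := by
  classical
  rw [← Finset.sum_fiberwise_of_maps_to (t := Finset.univ.image (level p q))
    (g := level p q) fun w _ => Finset.mem_image_of_mem _ (Finset.mem_univ w)]
  refine le_trans (Finset.sum_le_sum fun k _ => ?_) (hgs (Finset.univ.image (level p q)))
  have h1 : ∑ w with level p q w = k, p w * (g (level p q w) / levelProb p q (level p q w)) =
      levelProb p q k * (g k / levelProb p q k) := by
    rw [levelProb, Finset.sum_mul]
    refine Finset.sum_congr rfl fun w hw => ?_
    rw [(Finset.mem_filter.1 hw).2]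
    rfl
  rw [h1]
  by_cases h : levelProb p q k = 0
  · simp [h, hg k]
  · rw [mul_div_cancel₀ _ h]

/-- A bound for the entropy of the level. -/
lemma sum_neg_log_levelProb_le (hp : p ∈ stdSimplex ℝ W) {t : ℝ} (ht : 0 < t) :
    ∑ w, p w * (-log (levelProb p q (level p q w))) ≤
      t * ∑ w, p w * level p q w + -log (1 - Real.exp (-t)) := by
  set θ := Real.exp (-t) with hθ
  have hθ0 : 0 < θ := Real.exp_pos _
  have hθ1 : θ < 1 := by
    rw [hθ, Real.exp_lt_one_iff]
    linarith
  -- The entropy of the level is compared with a geometric distribution, whose negative logarithm `t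
  -- * k - log (1 - θ)` is linear in the level with an arbitrarily small slope.
  have hg : ∀ k : ℕ, 0 < (1 - θ) * θ ^ k := fun k => mul_pos (by linarith) (by positivity)
  have hgs : ∀ s : Finset ℕ, ∑ k ∈ s, (1 - θ) * θ ^ k ≤ 1 := by
    intro s
    rw [← Finset.mul_sum]
    have h1 := (summable_geometric_of_lt_one hθ0.le hθ1).sum_le_tsum s fun k _ => by positivity
    rw [tsum_geometric_of_lt_one hθ0.le hθ1] at h1
    refine (mul_le_mul_of_nonneg_left h1 (by linarith)).trans_eq (mul_inv_cancel₀ (by linarith))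
  have h1 := sum_div_levelProb_le (p := p) (q := q) (fun k => (hg k).le) hgs
  have key : ∀ w, p w * (-log (levelProb p q (level p q w))) ≤
      p w * ((1 - θ) * θ ^ level p q w / levelProb p q (level p q w)) - p w +
        (t * (p w * level p q w) + p w * (-log (1 - θ))) := by
    intro w
    rcases (hp.1 w).eq_or_lt with h | h
    · simp [← h]
    have hl : 0 < levelProb p q (level p q w) := h.trans_le (le_levelProb hp w)
    have h2 := Real.log_le_sub_one_of_pos (div_pos (hg (level p q w)) hl)
    rw [Real.log_div (hg _).ne' hl.ne', Real.log_mul (by linarith) (by positivity), Real.log_pow,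
      hθ, Real.log_exp, ← hθ] at h2
    have h3 := mul_le_mul_of_nonneg_left h2 h.le
    linarith
  have h4 := Finset.sum_le_sum fun w (_ : w ∈ Finset.univ) => key w
  simp only [Finset.sum_add_distrib, Finset.sum_sub_distrib, ← Finset.sum_mul, ← Finset.mul_sum,
    hp.2, one_mul] at h4
  linarith

end Levels

end

end SMP

namespace SMP

open Real (negMulLog log)
open scoped unitInterval

noncomputable section

/-! ### Darts: the law and the length of the simulated sample -/

section Accept

variable {W : Type*} {p q : W → ℝ} {φ ψ : I → W}

/-- The darts `(u, v)` that are accepted in a search for an element of level `k`. -/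
def acceptSet (p q : W → ℝ) (φ : I → W) (k : ℕ) : Set (I × I) :=
  {e | level p q (φ e.1) = k ∧ (e.2 : ℝ) * (2 ^ k * q (φ e.1)) ≤ p (φ e.1)}

/-- The accepted darts that give the element `w`. -/
def acceptCell (p q : W → ℝ) (φ : I → W) (w : W) : Set (I × I) :=
  {e | φ e.1 = w ∧ (e.2 : ℝ) * (2 ^ level p q w * q w) ≤ p w}

/-- The index of the first accepted dart, where the level is that of a random element. -/
def simIndex (p q : W → ℝ) (φ ψ : I → W) (z : I × (ℕ → I × I)) : ℕ :=
  firstHit (acceptSet p q φ (level p q (ψ z.1))) z.2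

/-- The law of the shared randomness that is used to simulate a channel: a random level and a
sequence of darts. -/
def dartLaw : Measure (I × (ℕ → I × I)) :=
  (volume : Measure I).prod (Measure.infinitePi fun _ : ℕ => (volume : Measure (I × I)))

instance : IsProbabilityMeasure dartLaw := by
  unfold dartLaw
  infer_instance

lemma acceptCell_subset (w : W) : acceptCell p q φ w ⊆ acceptSet p q φ (level p q w) := by
  rintro e ⟨rfl, h⟩
  exact ⟨rfl, h⟩

lemma acceptSet_eq_iUnion [Fintype W] (k : ℕ) :
    acceptSet p q φ k = ⋃ w ∈ Finset.univ.filter fun w => level p q w = k, acceptCell p q φ w := by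
  ext e
  simp only [acceptSet, acceptCell, Set.mem_ofPred_eq, Set.mem_iUnion, Finset.mem_filter,
    Finset.mem_univ, true_and, exists_prop]
  constructor
  · rintro ⟨h, h'⟩
    exact ⟨φ e.1, h, rfl, h.symm ▸ h'⟩
  · rintro ⟨w, rfl, rfl, h⟩
    exact ⟨rfl, h⟩

/-- The first coordinate gives `w` with probability `q w`, and the height passes with probability `p
w / (2 ^ k * q w)`. So, within a level, accepted darts have law proportional to `p`. -/
lemma volume_acceptCell (hp : ∀ w, 0 ≤ p w) (hq : ∀ w, 0 ≤ q w) (hpq : ∀ w, q w = 0 → p w = 0)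
    (hφ' : ∀ w, volume (φ ⁻¹' {w}) = ENNReal.ofReal (q w)) (w : W) :
    volume (acceptCell p q φ w) = ENNReal.ofReal (p w / 2 ^ level p q w) := by
  have h : acceptCell p q φ w =
      (φ ⁻¹' {w}) ×ˢ {v : I | (v : ℝ) * (2 ^ level p q w * q w) ≤ p w} := rfl
  rw [h, Measure.volume_eq_prod, Measure.prod_prod, hφ']
  rcases (hq w).eq_or_lt with h0 | h0
  · simp [← h0, hpq w h0.symm]
  have hc : 0 < 2 ^ level p q w * q w := by positivity
  have hle := le_two_pow_level_mul hp hq hpq w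
  have h1 : {v : I | (v : ℝ) * (2 ^ level p q w * q w) ≤ p w} =
      Set.Iic ⟨p w / (2 ^ level p q w * q w), div_nonneg (hp w) hc.le, (div_le_one hc).2 hle⟩ := by
    ext v
    rw [Set.mem_ofPred_eq, ← le_div_iff₀ hc]
    rfl
  rw [h1, unitInterval.volume_Iic, ← ENNReal.ofReal_mul h0.le]
  congr 1
  field_simp

variable [MeasurableSpace W] [DiscreteMeasurableSpace W]

lemma measurableSet_acceptCell (hφ : Measurable φ) (w : W) :
    MeasurableSet (acceptCell p q φ w) := by
  refine MeasurableSet.inter ?_ ?_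
  · exact (hφ.comp measurable_fst) (.of_discrete (s := {w}))
  · exact measurableSet_le ((measurable_subtype_coe.comp measurable_snd).mul_const _)
      measurable_const

variable [Fintype W]

lemma measurableSet_acceptSet (hφ : Measurable φ) (k : ℕ) :
    MeasurableSet (acceptSet p q φ k) := by
  rw [acceptSet_eq_iUnion]
  exact Finset.measurableSet_biUnion _ fun w _ => measurableSet_acceptCell hφ w

lemma volume_acceptSet (hp : ∀ w, 0 ≤ p w) (hq : ∀ w, 0 ≤ q w) (hpq : ∀ w, q w = 0 → p w = 0)
    (hφ : Measurable φ) (hφ' : ∀ w, volume (φ ⁻¹' {w}) = ENNReal.ofReal (q w)) (k : ℕ) :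
    volume (acceptSet p q φ k) = ENNReal.ofReal (levelProb p q k / 2 ^ k) := by
  rw [acceptSet_eq_iUnion, measure_biUnion_finset]
  · rw [levelProb, Finset.sum_div, ENNReal.ofReal_sum_of_nonneg fun w _ => by
      have := hp w
      positivity]
    refine Finset.sum_congr rfl fun w hw => ?_
    rw [volume_acceptCell hp hq hpq hφ', (Finset.mem_filter.1 hw).2]
  · intro w _ w' _ hww
    rw [Function.onFun, Set.disjoint_left]
    rintro e ⟨h1, _⟩ ⟨h2, _⟩
    exact hww (h1.symm.trans h2)
  · exact fun w _ => measurableSet_acceptCell hφ w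

/-- The level of `w` is drawn with its probability under `p`, and then `w` has its conditional
probability within the level; the product is `p w`. -/
lemma le_dartLaw_simIndex (hp : p ∈ stdSimplex ℝ W) (hq : ∀ w, 0 ≤ q w)
    (hpq : ∀ w, q w = 0 → p w = 0) (hφ : Measurable φ)
    (hφ' : ∀ w, volume (φ ⁻¹' {w}) = ENNReal.ofReal (q w)) (hψ : Measurable ψ)
    (hψ' : ∀ w, volume (ψ ⁻¹' {w}) = ENNReal.ofReal (p w)) (w : W) :
    ENNReal.ofReal (p w) ≤ dartLaw {z | φ (z.2 (simIndex p q φ ψ z)).1 = w} := by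
  classical
  set k := level p q w with hk
  have hsub : ((fun u => level p q (ψ u)) ⁻¹' {k}) ×ˢ
      {e : ℕ → I × I | e (firstHit (acceptSet p q φ k) e) ∈ acceptCell p q φ w} ⊆
      {z | φ (z.2 (simIndex p q φ ψ z)).1 = w} := by
    rintro ⟨u, e⟩ ⟨h1, h2⟩
    have h1' : level p q (ψ u) = k := h1
    change φ (e (firstHit (acceptSet p q φ (level p q (ψ u))) e)).1 = w
    rw [h1']
    exact h2.1
  refine le_trans ?_ (measure_mono hsub)
  rw [dartLaw, Measure.prod_prod]
  have h1 : volume ((fun u => level p q (ψ u)) ⁻¹' {k}) =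
      ENNReal.ofReal (levelProb p q k) := by
    have : (fun u => level p q (ψ u)) ⁻¹' {k} =
        ⋃ w ∈ Finset.univ.filter fun w => level p q w = k, ψ ⁻¹' {w} := by
      ext u
      simp
    rw [this, measure_biUnion_finset, levelProb, ENNReal.ofReal_sum_of_nonneg fun w _ => hp.1 w]
    · exact Finset.sum_congr rfl fun w _ => hψ' w
    · intro w _ w' _ hww
      rw [Function.onFun, Set.disjoint_left]
      rintro e h1 h2
      exact hww (Eq.trans (Eq.symm h1) h2)
    · exact fun w _ => hψ .of_discrete
  rw [h1]
  refine le_trans ?_ (mul_le_mul_right (div_le_infinitePi_firstHit volume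
    (measurableSet_acceptSet hφ k) (measurableSet_acceptCell hφ w) (acceptCell_subset w)) _)
  rcases (levelProb_nonneg (q := q) hp k).eq_or_lt with h0 | h0
  · have : p w ≤ 0 := (le_levelProb hp w).trans_eq h0.symm
    simp [ENNReal.ofReal_of_nonpos this]
  · rw [volume_acceptSet hp.1 hq hpq hφ hφ', volume_acceptCell hp.1 hq hpq hφ',
      ← ENNReal.ofReal_div_of_pos (by positivity), ← ENNReal.ofReal_mul h0.le]
    refine le_of_eq ?_
    congr 1
    rw [← hk]
    field_simp

/-- At level `k` a dart is accepted with probability `levelProb p q k / 2 ^ k`, so the log-index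
costs about `k * log 2 - log (levelProb p q k)`. On average this is the mean level, near the
divergence, plus the entropy of the level, which costs a fraction `t` of the mean level and a
constant. -/
lemma lintegral_simIndex_le (hp : p ∈ stdSimplex ℝ W) (hq : q ∈ stdSimplex ℝ W)
    (hpq : ∀ w, q w = 0 → p w = 0) (hφ : Measurable φ)
    (hφ' : ∀ w, volume (φ ⁻¹' {w}) = ENNReal.ofReal (q w)) (hψ : Measurable ψ)
    (hψ' : ∀ w, volume (ψ ⁻¹' {w}) = ENNReal.ofReal (p w)) {ℓ : ℕ → ℕ} {c₀ c₁ t : ℝ}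
    (h0 : 0 ≤ c₀) (h1 : 0 ≤ c₁) (hℓ : ∀ j : ℕ, (ℓ j : ℝ) ≤ c₀ + c₁ * log (j + 1)) (ht : 0 < t) :
    ∫⁻ z, (ℓ (simIndex p q φ ψ z) : ℝ≥0∞) ∂dartLaw ≤
      ENNReal.ofReal (c₀ + c₁ + c₁ * ((1 + t) * (∑ w, p w * (log (p w) - log (q w)) + 1 + log 2) +
        -log (1 - Real.exp (-(t * log 2))))) := by
  have hlog : 0 < log 2 := Real.log_pos one_lt_two
  set F : W → ℝ := fun w => c₀ + c₁ + c₁ *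
    (level p q w * log 2 - log (levelProb p q (level p q w))) with hF
  have hF0 : ∀ w, 0 ≤ F w := by
    intro w
    have h2 : 0 ≤ -log (levelProb p q (level p q w)) := neg_nonneg.2
      (Real.log_nonpos (levelProb_nonneg hp _) (levelProb_le_one hp _))
    have h3 : 0 ≤ level p q w * log 2 := by positivity
    have := mul_nonneg h1 (add_nonneg h3 h2)
    simp only [hF]
    linarith
  calc _ ≤ ∫⁻ u, ∫⁻ e, (ℓ (firstHit (acceptSet p q φ (level p q (ψ u))) e) : ℝ≥0∞)
        ∂Measure.infinitePi (fun _ : ℕ => (volume : Measure (I × I))) ∂(volume : Measure I) :=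
        lintegral_prod_le _
    _ = ∑ w, (∫⁻ e, (ℓ (firstHit (acceptSet p q φ (level p q w)) e) : ℝ≥0∞)
        ∂Measure.infinitePi (fun _ : ℕ => (volume : Measure (I × I)))) * ENNReal.ofReal (p w) := by
        rw [← lintegral_map (f := fun w => ∫⁻ e,
          (ℓ (firstHit (acceptSet p q φ (level p q w)) e) : ℝ≥0∞)
          ∂Measure.infinitePi (fun _ : ℕ => (volume : Measure (I × I)))) .of_discrete hψ,
          lintegral_fintype]
        refine Finset.sum_congr rfl fun w _ => ?_
        rw [Measure.map_apply hψ .of_discrete, hψ']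
    _ ≤ ∑ w, ENNReal.ofReal (F w) * ENNReal.ofReal (p w) := by
        refine Finset.sum_le_sum fun w _ => ?_
        rcases (hp.1 w).eq_or_lt with h | h
        · simp [← h]
        refine mul_le_mul_left ?_ _
        have hl : 0 < levelProb p q (level p q w) := h.trans_le (le_levelProb hp w)
        refine (lintegral_length_firstHit_le volume (measurableSet_acceptSet hφ _) h0 h1 hℓ
          (a := levelProb p q (level p q w) / 2 ^ level p q w) (by positivity) ?_
          (volume_acceptSet hp.1 hq.1 hpq hφ hφ' _)).trans_eq ?_
        · rw [div_le_one (by positivity)]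
          exact (levelProb_le_one hp _).trans (one_le_pow₀ one_le_two)
        · rw [Real.log_div hl.ne' (by positivity), Real.log_pow]
          simp only [hF]
          congr 1
          ring
    _ = ENNReal.ofReal (∑ w, p w * F w) := by
        rw [ENNReal.ofReal_sum_of_nonneg fun w _ => mul_nonneg (hp.1 w) (hF0 w)]
        refine Finset.sum_congr rfl fun w _ => ?_
        rw [mul_comm, ENNReal.ofReal_mul (hp.1 w)]
    _ ≤ _ := by
        refine ENNReal.ofReal_le_ofReal ?_
        have h2 := sum_neg_log_levelProb_le (q := q) hp (mul_pos ht hlog)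
        have h3 := Finset.sum_le_sum fun w (_ : w ∈ Finset.univ) => mul_level_le hp.1 hq.1 hpq w
        simp only [Finset.sum_add_distrib, ← Finset.sum_mul, hq.2, hp.2, one_mul] at h3
        have h4 : ∑ w, p w * F w = (c₀ + c₁) + c₁ * (∑ w, p w * (level p q w * log 2) +
            ∑ w, p w * (-log (levelProb p q (level p q w)))) := by
          simp only [hF, mul_add, mul_sub, mul_neg, Finset.sum_add_distrib, Finset.sum_sub_distrib,
            Finset.sum_neg_distrib, ← Finset.sum_mul, hp.2, one_mul, Finset.mul_sum]
          rw [sub_eq_add_neg]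
          congr 2
          · exact Finset.sum_congr rfl fun w _ => by ring
          · rw [← Finset.sum_neg_distrib, ← Finset.sum_neg_distrib]
            exact Finset.sum_congr rfl fun w _ => by ring
        rw [h4]
        have h5 : t * log 2 * ∑ w, p w * level p q w = t * ∑ w, p w * (level p q w * log 2) := by
          rw [Finset.mul_sum, Finset.mul_sum]
          exact Finset.sum_congr rfl fun w _ => by ring
        rw [h5] at h2
        have h6 := mul_le_mul_of_nonneg_left h3 ht.le
        have h7 := mul_le_mul_of_nonneg_left (add_le_add h3 h2) h1
        have h8 := mul_le_mul_of_nonneg_left h6 h1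
        linarith

end Accept

/-! #### Product distributions and types -/

section Words

variable {M : Type*} [Fintype M] {n : ℕ}

/-- The distribution of independent letters. -/
def wordDist (a : Fin n → M → ℝ) (w : Fin n → M) : ℝ := ∏ i, a i (w i)

lemma sum_wordDist_mul {a : Fin n → M → ℝ} (ha : ∀ i, a i ∈ stdSimplex ℝ M) (j : Fin n)
    (g : M → ℝ) : ∑ w, wordDist a w * g (w j) = ∑ m, a j m * g m := by
  classical
  have h1 : ∀ w, wordDist a w * g (w j) = ∏ i, (a i (w i) * if i = j then g (w i) else 1) := by
    intro w
    rw [Finset.prod_mul_distrib, wordDist]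
    simp
  have h2 := Finset.prod_univ_sum (fun _ : Fin n => (Finset.univ : Finset M))
    fun i m => a i m * if i = j then g m else 1
  rw [Fintype.piFinset_univ] at h2
  rw [Finset.sum_congr rfl fun w _ => h1 w, ← h2, Finset.prod_eq_single j]
  · simp
  · intro i _ hij
    simp [hij, (ha i).2]
  · simp

lemma wordDist_mem_stdSimplex {a : Fin n → M → ℝ} (ha : ∀ i, a i ∈ stdSimplex ℝ M) :
    wordDist a ∈ stdSimplex ℝ (Fin n → M) := by
  classical
  refine ⟨fun w => Finset.prod_nonneg fun i _ => (ha i).1 _, ?_⟩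
  unfold wordDist
  rw [← Fintype.piFinset_univ, ← Finset.prod_univ_sum]
  simp [(ha _).2]

/-- Divergence is additive over independent letters. The logarithm of a product is split only on
words of positive probability, where `hac` keeps the factors of `c` non-zero. -/
lemma sum_wordDist_log {a c : Fin n → M → ℝ} (ha : ∀ i, a i ∈ stdSimplex ℝ M)
    (hac : ∀ i m, c i m = 0 → a i m = 0) :
    ∑ w, wordDist a w * (log (wordDist a w) - log (wordDist c w)) =
      ∑ i, ∑ m, a i m * (log (a i m) - log (c i m)) := by
  have h1 : ∀ w, wordDist a w * (log (wordDist a w) - log (wordDist c w)) =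
      ∑ i, wordDist a w * (log (a i (w i)) - log (c i (w i))) := by
    intro w
    rw [← Finset.mul_sum]
    by_cases h : wordDist a w = 0
    · simp [h]
    have ha' : ∀ i ∈ Finset.univ, a i (w i) ≠ 0 := Finset.prod_ne_zero_iff.1 h
    rw [wordDist, wordDist, Real.log_prod ha',
      Real.log_prod fun i hi hc => ha' i hi (hac i _ hc), Finset.sum_sub_distrib]
  simp_rw [h1]
  rw [Finset.sum_comm]
  exact Finset.sum_congr rfl fun i _ =>
    sum_wordDist_mul ha i fun m => log (a i m) - log (c i m)

variable {X : Type*} [DecidableEq X]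

/-- The number of occurrences of a letter in a word. -/
def letterCount (x : Fin n → X) (a : X) : ℕ := (Finset.univ.filter fun i => x i = a).card

/-- The empirical distribution of the letters of a word. -/
def empDist (x : Fin n → X) (a : X) : ℝ := letterCount x a / n

lemma empDist_pos (x : Fin n → X) (i : Fin n) : 0 < empDist x (x i) := by
  have hn : 0 < n := i.pos
  have : 0 < letterCount x (x i) := Finset.card_pos.2 ⟨i, by simp⟩
  unfold empDist
  positivity

variable [Fintype X]

lemma sum_letters (x : Fin n → X) (hn : 0 < n) (F : X → ℝ) :
    ∑ i, F (x i) = n * ∑ a, empDist x a * F a := by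
  have hn' : (n : ℝ) ≠ 0 := by exact_mod_cast hn.ne'
  rw [← Finset.sum_fiberwise Finset.univ x, Finset.mul_sum]
  refine Finset.sum_congr rfl fun a _ => ?_
  rw [Finset.sum_congr rfl (g := fun _ => F a) fun i hi => by rw [(Finset.mem_filter.1 hi).2],
    Finset.sum_const, nsmul_eq_mul, empDist, letterCount]
  field_simp

lemma empDist_mem_stdSimplex (x : Fin n → X) (hn : 0 < n) : empDist x ∈ stdSimplex ℝ X := by
  refine ⟨fun a => by unfold empDist; positivity, ?_⟩
  have hn' : (n : ℝ) ≠ 0 := by exact_mod_cast hn.ne'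
  have h := sum_letters x hn fun _ => 1
  simp only [Finset.sum_const, Finset.card_univ, Fintype.card_fin, nsmul_eq_mul, mul_one] at h
  exact (mul_left_cancel₀ hn' (h.symm.trans (mul_one _).symm))

lemma eq_zero_of_mixture_empDist {p : X → M → ℝ} (hp : ∀ a, p a ∈ stdSimplex ℝ M)
    (x : Fin n → X) (i : Fin n) {m : M} (h : mixture (empDist x) p m = 0) : p (x i) m = 0 := by
  have h1 := (Finset.sum_eq_zero_iff_of_nonneg fun a _ => mul_nonneg
    ((empDist_mem_stdSimplex x i.pos).1 a) ((hp a).1 m)).1 h (x i) (Finset.mem_univ _)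
  have h2 := (empDist_pos x i).ne'
  exact (mul_eq_zero.1 h1).resolve_left h2

/-- The divergence of independent outputs from independent samples of the output distribution for
the empirical input distribution. -/
lemma sum_wordDist_log_empDist {p : X → M → ℝ} (hp : ∀ a, p a ∈ stdSimplex ℝ M) (hn : 0 < n)
    (x : Fin n → X) : ∑ w, wordDist (fun i => p (x i)) w * (log (wordDist (fun i => p (x i)) w) -
      log (wordDist (fun _ : Fin n => mixture (empDist x) p) w)) =
      n * mutualInfo (empDist x) p := by
  rw [sum_wordDist_log (fun i => hp (x i)) fun i m h => eq_zero_of_mixture_empDist hp x i h,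
    sum_letters x hn fun a => ∑ m, p a m * (log (p a m) - log (mixture (empDist x) p m))]
  congr 1
  have h1 : entropy (mixture (empDist x) p) =
      ∑ a, empDist x a * ∑ m, p a m * (-log (mixture (empDist x) p m)) := by
    simp only [Finset.mul_sum, entropy, negMulLog]
    rw [Finset.sum_comm]
    refine Finset.sum_congr rfl fun m _ => ?_
    conv_lhs => rw [neg_mul, ← mul_neg, mixture, Finset.sum_mul]
    exact Finset.sum_congr rfl fun a _ => by rw [mul_assoc]; rfl
  rw [mutualInfo, h1, ← Finset.sum_sub_distrib]
  refine Finset.sum_congr rfl fun a _ => ?_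
  rw [← mul_sub, entropy, ← Finset.sum_sub_distrib]
  congr 1
  refine Finset.sum_congr rfl fun m _ => ?_
  rw [negMulLog]
  ring

end Words

/-- The words have polynomially many empirical distributions. -/
lemma exists_empDist_index {X : Type*} [Fintype X] [DecidableEq X] {n N : ℕ}
    (hN : (n + 1) ^ Fintype.card X ≤ N) :
    ∃ t : (Fin n → X) → Fin N, ∀ x x', t x = t x' → empDist x = empDist x' := by
  let c : (Fin n → X) → X → Fin (n + 1) := fun x a =>
    ⟨letterCount x a, Nat.lt_succ_of_le ((Finset.card_filter_le _ _).trans_eq (by simp))⟩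
  obtain ⟨e⟩ := Function.Embedding.nonempty_of_card_le (α := X → Fin (n + 1)) (β := Fin N)
    (by simpa using hN)
  refine ⟨fun x => e (c x), fun x x' h => ?_⟩
  ext a
  have h2 := congrArg Fin.val (congrFun (e.injective h) a)
  simp only [c] at h2
  simp only [empDist, h2]

end

end SMP

namespace SMP

open Real (negMulLog log)
open scoped unitInterval

noncomputable section

/-! ### Exact simulation of a channel with state -/

section Simulation

variable {W : Type*} [MeasurableSpace W] [DiscreteMeasurableSpace W] [Fintype W]

/-- The lower bounds `p w` and the actual probabilities both have sum one, so they agree. Sequences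
without an accepted dart thus need no analysis. -/
lemma dartLaw_simIndex {p q : W → ℝ} {φ ψ : I → W} (hp : p ∈ stdSimplex ℝ W) (hq : ∀ w, 0 ≤ q w)
    (hpq : ∀ w, q w = 0 → p w = 0) (hφ : Measurable φ)
    (hφ' : ∀ w, volume (φ ⁻¹' {w}) = ENNReal.ofReal (q w)) (hψ : Measurable ψ)
    (hψ' : ∀ w, volume (ψ ⁻¹' {w}) = ENNReal.ofReal (p w))
    (hm : Measurable fun z : I × (ℕ → I × I) => φ (z.2 (simIndex p q φ ψ z)).1) (w : W) :
    dartLaw {z | φ (z.2 (simIndex p q φ ψ z)).1 = w} = ENNReal.ofReal (p w) := by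
  have h1 : ∀ w ∈ Finset.univ, p w ≤ dartLaw.real {z | φ (z.2 (simIndex p q φ ψ z)).1 = w} :=
    fun w _ => (ENNReal.ofReal_le_iff_le_toReal (measure_ne_top _ _)).1
      (le_dartLaw_simIndex hp hq hpq hφ hφ' hψ hψ' w)
  have h2 : ∑ w, dartLaw.real {z | φ (z.2 (simIndex p q φ ψ z)).1 = w} = 1 := by
    have h := sum_measureReal_preimage_singleton (μ := dartLaw) (Finset.univ : Finset W)
      (f := fun z => φ (z.2 (simIndex p q φ ψ z)).1) (fun w _ => hm .of_discrete)
    simpa [Set.preimage] using h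
  have h3 := (Finset.sum_eq_sum_iff_of_le h1).1 (hp.2.trans h2.symm) w (Finset.mem_univ _)
  rw [h3, ofReal_measureReal]

lemma measurable_level {A T S : Type*} [MeasurableSpace S] {P : A → S → W → ℝ} {Q : T → S → W → ℝ}
    (hP : IsChannel P) (hQ : IsChannel Q) (x : A) (y : T) :
    Measurable fun z : W × S => level (P x z.2) (Q y z.2) z.1 :=
  measurable_from_prod_countable_right fun w => by
    have h1 := hP.meas x w
    have h2 := hQ.meas y w
    unfold level Real.logb
    exact Nat.measurable_ceil.comp ((Real.measurable_log.comp (h1.div h2)).div_const _)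

/-- A random output of a channel is sent by a short message with the help of shared randomness, to a
referee who knows another channel with an approximate output distribution. -/
theorem exists_simulation {A T S : Type*} [MeasurableSpace S] [Nonempty W] (ν : Measure S)
    [IsProbabilityMeasure ν] {P : A → S → W → ℝ} {Q : T → S → W → ℝ} (hP : IsChannel P)
    (hQ : IsChannel Q) (t : A → T) (hPQ : ∀ a s w, Q (t a) s w = 0 → P a s w = 0) :
    ∃ (idx : A → S × I × (ℕ → I × I) → ℕ) (dec : T → ℕ → S × I × (ℕ → I × I) → W),
      (∀ a, Measurable (idx a)) ∧ (∀ τ N, Measurable (dec τ N)) ∧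
      (∀ a, (ν.prod dartLaw).map (fun r => (r.1, dec (t a) (idx a r) r)) = chanLaw ν (P a)) ∧
      ∀ a (ℓ : ℕ → ℕ) (c₀ c₁ θ C : ℝ), 0 ≤ c₀ → 0 ≤ c₁ →
        (∀ j : ℕ, (ℓ j : ℝ) ≤ c₀ + c₁ * log (j + 1)) → 0 < θ →
        Integrable (fun s => ∑ w, P a s w * (log (P a s w) - log (Q (t a) s w))) ν →
        (∀ s, 0 ≤ ∑ w, P a s w * (log (P a s w) - log (Q (t a) s w))) →
        ∫ s, ∑ w, P a s w * (log (P a s w) - log (Q (t a) s w)) ∂ν ≤ C →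
        ∫⁻ r, (ℓ (idx a r) : ℝ≥0∞) ∂ν.prod dartLaw ≤ ENNReal.ofReal (c₀ + c₁ +
          c₁ * ((1 + θ) * (C + 1 + log 2) + -log (1 - Real.exp (-(θ * log 2))))) := by
  obtain ⟨ψ, hψ, hψP⟩ := exists_enc_of_channel hP
  obtain ⟨φ, hφ, hφQ⟩ := exists_enc_of_channel hQ
  have hψs : ∀ a s, Measurable fun u => ψ a (u, s) := fun a s =>
    (hψ a).comp measurable_prodMk_right
  have hφs : ∀ τ s, Measurable fun u => φ τ (u, s) := fun τ s =>
    (hφ τ).comp measurable_prodMk_right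
  have hψ' : ∀ a s w, volume ((fun u => ψ a (u, s)) ⁻¹' {w}) = ENNReal.ofReal (P a s w) := by
    intro a s w
    rw [← hψP, msgProb, ofReal_measureReal]
    rfl
  have hφ' : ∀ τ s w, volume ((fun u => φ τ (u, s)) ⁻¹' {w}) = ENNReal.ofReal (Q τ s w) := by
    intro τ s w
    rw [← hφQ, msgProb, ofReal_measureReal]
    rfl
  set idx : A → S × I × (ℕ → I × I) → ℕ := fun a r =>
    simIndex (P a r.1) (Q (t a) r.1) (fun u => φ (t a) (u, r.1)) (fun u => ψ a (u, r.1)) r.2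
    with hidx
  -- The decoder only looks up the dart with the index received. It needs neither the level nor the
  -- law `P a`, which depend on the sender's input.
  set dec : T → ℕ → S × I × (ℕ → I × I) → W := fun τ N r => φ τ ((r.2.2 N).1, r.1) with hdec
  have hidxm : ∀ a, Measurable (idx a) := by
    intro a
    have hPa : Measurable fun z : W × S => P a z.2 z.1 :=
      measurable_from_prod_countable_right fun w => hP.meas a w
    have hQa : Measurable fun z : W × S => Q (t a) z.2 z.1 :=
      measurable_from_prod_countable_right fun w => hQ.meas (t a) w
    have hl := measurable_level hP hQ a (t a)
    refine measurable_sInf_nat fun j => ?_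
    have hd : Measurable fun r : S × I × (ℕ → I × I) => (φ (t a) ((r.2.2 j).1, r.1), r.1) :=
      ((hφ (t a)).comp (by fun_prop)).prodMk measurable_fst
    have hu : Measurable fun r : S × I × (ℕ → I × I) => (ψ a (r.2.1, r.1), r.1) :=
      ((hψ a).comp (by fun_prop)).prodMk measurable_fst
    have hv : Measurable fun r : S × I × (ℕ → I × I) => ((r.2.2 j).2 : ℝ) :=
      measurable_subtype_coe.comp (by fun_prop)
    have hpow : Measurable fun k : ℕ => (2 : ℝ) ^ k := .of_discrete
    exact (measurableSet_eq_fun (hl.comp hd) (hl.comp hu)).inter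
      (measurableSet_le (hv.mul ((hpow.comp (hl.comp hu)).mul (hQa.comp hd))) (hPa.comp hd))
  have hdecm : ∀ τ N, Measurable (dec τ N) := fun τ N => (hφ τ).comp (by fun_prop)
  have hvalm : ∀ a, Measurable fun r => dec (t a) (idx a r) r := fun a =>
    (measurable_from_prod_countable_right (f := fun z : ℕ × S × I × (ℕ → I × I) =>
      dec (t a) z.1 z.2) fun N => hdecm (t a) N).comp ((hidxm a).prodMk measurable_id)
  refine ⟨idx, dec, hidxm, hdecm, fun a => ?_, ?_⟩
  · refine ext_of_prod_singleton fun B hB w => ?_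
    have hBw : MeasurableSet (B ×ˢ ({w} : Set W)) := hB.prod .of_discrete
    have hg : Measurable fun r => (r.1, dec (t a) (idx a r) r) := measurable_fst.prodMk (hvalm a)
    rw [Measure.map_apply hg hBw, Measure.prod_apply (hg hBw),
      chanLaw_prod_singleton (hP.meas a) hB, ← lintegral_indicator hB]
    refine lintegral_congr fun s => ?_
    by_cases hs : s ∈ B
    · rw [Set.indicator_of_mem hs, ← dartLaw_simIndex (hP.mem a s) (hQ.mem (t a) s).1
        (hPQ a s) (hφs (t a) s) (hφ' (t a) s) (hψs a s) (hψ' a s)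
        ((hvalm a).comp measurable_prodMk_left)]
      congr 1
      ext z
      simp [hs, hidx, hdec]
    · have : Prod.mk s ⁻¹' ((fun r => (r.1, dec (t a) (idx a r) r)) ⁻¹' B ×ˢ {w}) = ∅ := by
        ext z
        simp [hs]
      rw [this, measure_empty, Set.indicator_of_notMem hs]
  · intro a ℓ c₀ c₁ θ C h0 h1 hℓ hθ hint hnn hC
    set D : S → ℝ := fun s => ∑ w, P a s w * (log (P a s w) - log (Q (t a) s w)) with hD
    have hE0 : 0 ≤ -log (1 - Real.exp (-(θ * log 2))) := by
      have h2 : Real.exp (-(θ * log 2)) ≤ 1 := Real.exp_le_one_iff.2 (by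
        have := mul_pos hθ log_two_pos
        linarith)
      have h3 := Real.exp_pos (-(θ * log 2))
      exact neg_nonneg.2 (Real.log_nonpos (by linarith) (by linarith))
    set E := -log (1 - Real.exp (-(θ * log 2)))
    have hlog := log_two_pos
    have hnn' : ∀ s, 0 ≤ c₀ + c₁ + c₁ * ((1 + θ) * (D s + 1 + log 2) + E) := by
      intro s
      have := hnn s
      have h4 : 0 ≤ D s + 1 + log 2 := by linarith
      positivity
    have hi : Integrable (fun s => c₀ + c₁ + c₁ * ((1 + θ) * (D s + 1 + log 2) + E)) ν :=
      (integrable_const _).add (((((hint.add (integrable_const _)).add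
        (integrable_const _)).const_mul _).add (integrable_const _)).const_mul _)
    calc _ ≤ ∫⁻ s, ∫⁻ z, (ℓ (idx a (s, z)) : ℝ≥0∞) ∂dartLaw ∂ν := lintegral_prod_le _
      _ ≤ ∫⁻ s, ENNReal.ofReal (c₀ + c₁ + c₁ * ((1 + θ) * (D s + 1 + log 2) + E)) ∂ν :=
          lintegral_mono fun s => lintegral_simIndex_le (hP.mem a s) (hQ.mem (t a) s) (hPQ a s)
            (hφs (t a) s) (hφ' (t a) s) (hψs a s) (hψ' a s) h0 h1 hℓ hθ
      _ = ENNReal.ofReal (∫ s, (c₀ + c₁ + c₁ * ((1 + θ) * (D s + 1 + log 2) + E)) ∂ν) :=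
          (ofReal_integral_eq_lintegral_ofReal hi (ae_of_all _ hnn')).symm
      _ ≤ _ := by
          refine ENNReal.ofReal_le_ofReal ?_
          have h5 : ∀ s, c₀ + c₁ + c₁ * ((1 + θ) * (D s + 1 + log 2) + E) =
              (c₀ + c₁ + c₁ * ((1 + θ) * (1 + log 2) + E)) + c₁ * (1 + θ) * D s := fun s => by ring
          simp_rw [h5]
          rw [integral_add (integrable_const _) (hint.const_mul _), integral_const,
            integral_const_mul, probReal_univ, one_smul]
          have h6 := mul_le_mul_of_nonneg_left hC (mul_nonneg h1 (by linarith : 0 ≤ 1 + θ))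
          linarith

end Simulation

section Words

variable {S M : Type*} [MeasurableSpace S] [Fintype M] {n : ℕ}

lemma isChannel_wordDist {A : Type*} {a : A → Fin n → S → M → ℝ} (ha : ∀ x, IsChannel (a x)) :
    IsChannel fun x s => wordDist fun i => a x i s where
  mem x s := wordDist_mem_stdSimplex fun i => (ha x).mem i s
  meas x w := Finset.measurable_prod _ fun i _ => (ha x).meas i (w i)

lemma map_chanLaw_wordDist [MeasurableSpace M] [DiscreteMeasurableSpace M] (ν : Measure S)
    {a : Fin n → S → M → ℝ} (ha : IsChannel a) (i : Fin n) :
    (chanLaw ν fun s => wordDist fun i => a i s).map (fun z => (z.1, z.2 i)) = chanLaw ν (a i) := by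
  classical
  have hw : IsChannel fun (_ : Unit) s => wordDist fun i => a i s := isChannel_wordDist fun _ => ha
  refine ext_of_prod_singleton fun B hB m => ?_
  have hBm : MeasurableSet (B ×ˢ ({m} : Set M)) := hB.prod .of_discrete
  have hg : Measurable fun z : S × (Fin n → M) => (z.1, z.2 i) := by fun_prop
  rw [Measure.map_apply hg hBm, chanLaw_prod_singleton (ha.meas i) hB,
    ← lintegral_indicator_one (hg hBm), lintegral_chanLaw (hw.meas ())
      (measurable_one.indicator (hg hBm)), ← lintegral_indicator hB, ← lintegral_finsetSum]
  · refine lintegral_congr fun s => ?_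
    by_cases hs : s ∈ B
    · have h1 := sum_wordDist_mul (fun i => ha.mem i s) i fun m' => if m' = m then 1 else 0
      simp only [mul_ite, mul_one, mul_zero, Finset.sum_ite_eq', Finset.mem_univ, if_true] at h1
      rw [Set.indicator_of_mem hs, ← h1, ENNReal.ofReal_sum_of_nonneg fun w _ => by
        split_ifs
        · exact (hw.mem () s).1 w
        · exact le_rfl]
      refine Finset.sum_congr rfl fun w _ => ?_
      by_cases h : w i = m <;> simp [h, hs, Set.indicator]
    · rw [Set.indicator_of_notMem hs]
      refine Finset.sum_eq_zero fun w _ => ?_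
      simp [hs, Set.indicator]
  · exact fun w _ => ((hw.meas () w).ennreal_ofReal).mul
      ((measurable_one.indicator (hg hBm)).comp measurable_prodMk_right)

end Words

end

end SMP

namespace SMP

open Real (negMulLog log)
open scoped unitInterval

noncomputable section

/-- The constant part of the length of the message by which one output of a channel is sent, where
indices are encoded with blocks of `b` digits. -/
def codeOverhead (b : ℕ) : ℝ :=
  (b + 4) + (1 + 1 / b) / log 2 + (1 + 1 / b) / log 2 * ((1 + 1 / b) * (1 + log 2) +
    -log (1 - Real.exp (-(1 / b * log 2))))

/-- The outputs of a channel on the letters of a word are sent with the help of shared randomness,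
to a referee. -/
theorem exists_word_simulation {X : Type*} [Fintype X] [Nonempty X] {S M : Type*}
    [MeasurableSpace S] [Fintype M] [Nonempty M] [MeasurableSpace M] [DiscreteMeasurableSpace M]
    (ν : Measure S) [IsProbabilityMeasure ν] {p : X → S → M → ℝ} (hp : IsChannel p) {C : ℝ}
    (hC : ∀ μ ∈ stdSimplex ℝ X, avgInfo ν μ p ≤ C) {b n L : ℕ} (hb : 0 < b) (hn : 0 < n)
    (hL : (n + 1) ^ Fintype.card X ≤ 2 ^ L) :
    ∃ (msg : (Fin n → X) → S × I × (ℕ → I × I) → Fin (2 ^ L) × ℕ)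
      (dec : (Fin (2 ^ L) × ℕ) × S × I × (ℕ → I × I) → Fin n → M)
      (enc : Fin (2 ^ L) × ℕ → List Bool),
      (∀ x, Measurable (msg x)) ∧ Measurable dec ∧ IsPrefixCode enc ∧
      (∀ x i, (ν.prod dartLaw).map (fun r => (r.1, dec (msg x r, r) i)) = chanLaw ν (p (x i))) ∧
      ∀ x, ∫⁻ r, ((enc (msg x r)).length : ℝ≥0∞) ∂ν.prod dartLaw ≤
        ENNReal.ofReal (L + codeOverhead b + (1 + 1 / b) ^ 2 / log 2 * (n * C)) := by
  classical
  obtain ⟨t, ht⟩ := exists_empDist_index hL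
  -- The referee knows only the index of the empirical distribution; any word with that index stands
  -- for it.
  have hrep : ∀ x, empDist (Function.invFun t (t x)) = empDist x := fun x =>
    ht _ _ (Function.invFun_eq ⟨x, rfl⟩)
  set P : (Fin n → X) → S → (Fin n → M) → ℝ := fun x s => wordDist fun i => p (x i) s
  have hP : IsChannel P := isChannel_wordDist fun x =>
    ⟨fun i s => hp.mem (x i) s, fun i m => hp.meas (x i) m⟩
  set Q : Fin (2 ^ L) → S → (Fin n → M) → ℝ := fun τ s =>
    wordDist fun _ => mixture (empDist (Function.invFun t τ)) fun a => p a s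
  have hQ : IsChannel Q := isChannel_wordDist fun τ =>
    hp.mixture fun _ => empDist_mem_stdSimplex (Function.invFun t τ) hn
  have hPQ : ∀ x s w, Q (t x) s w = 0 → P x s w = 0 := by
    intro x s w h
    obtain ⟨i, -, hi⟩ := Finset.prod_eq_zero_iff.1 h
    rw [hrep] at hi
    exact Finset.prod_eq_zero (Finset.mem_univ i)
      (eq_zero_of_mixture_empDist (fun a => hp.mem a s) x i hi)
  obtain ⟨idx, dec, hidx, hdec, hlaw, hlen⟩ := exists_simulation ν hP hQ t hPQ
  have hKL : ∀ x s, ∑ w, P x s w * (log (P x s w) - log (Q (t x) s w)) =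
      n * mutualInfo (empDist x) (fun a => p a s) := by
    intro x s
    simp only [P, Q, hrep]
    exact sum_wordDist_log_empDist (fun a => hp.mem a s) hn x
  refine ⟨fun x r => (t x, idx x r), fun z => dec z.1.1 z.1.2 z.2,
    fun m => bitCode L m.1 ++ blockCode b m.2, fun x => measurable_const.prodMk (hidx x),
    measurable_from_prod_countable_right fun m => hdec m.1 m.2, ?_, fun x i => ?_, fun x => ?_⟩
  · refine isPrefixCode_append (g := Prod.fst) (c := fun i : Fin (2 ^ L) => bitCode L i)
      (fun i j h => Fin.ext (eq_of_bitCode_prefix i.2 j.2 h)) fun m m' h1 h2 => ?_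
    exact Prod.ext h1 (isPrefixCode_blockCode hb _ _ h2)
  · have hg : Measurable fun z : S × (Fin n → M) => (z.1, z.2 i) := by fun_prop
    have hv : Measurable fun r => dec (t x) (idx x r) r :=
      (measurable_from_prod_countable_right (f := fun z : ℕ × S × I × (ℕ → I × I) =>
        dec (t x) z.1 z.2) fun N => hdec (t x) N).comp ((hidx x).prodMk measurable_id)
    rw [← map_chanLaw_wordDist ν (a := fun i => p (x i))
      ⟨fun i s => hp.mem (x i) s, fun i m => hp.meas (x i) m⟩ i, ← hlaw x,
      Measure.map_map hg (measurable_fst.prodMk hv)]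
    rfl
  · have hlog := log_two_pos
    have hb' : (0 : ℝ) < b := by exact_mod_cast hb
    have he := empDist_mem_stdSimplex x hn
    -- With slope `1 / b` for the entropy of the level, the factor `1 + 1 / b` occurs a second time,
    -- besides the one from the block code.
    have h1 := hlen x (fun N => (blockCode b N).length) (b + 4) ((1 + 1 / b) / log 2) (1 / b)
      (n * C) (by positivity) (by positivity) (length_blockCode_le hb) (by positivity)
      (by simp_rw [hKL]; exact (hp.integrable_mutualInfo ν he).const_mul _)
      (fun s => by
        rw [hKL]
        exact mul_nonneg n.cast_nonneg (mutualInfo_nonneg he fun a => hp.mem a s))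
      (by
        simp_rw [hKL]
        rw [integral_const_mul]
        exact mul_le_mul_of_nonneg_left (hC _ he) n.cast_nonneg)
    have hC0 : 0 ≤ C := (hp.avgInfo_nonneg ν he).trans (hC _ he)
    have h2 : 0 ≤ -log (1 - Real.exp (-(1 / b * log 2))) := by
      have h2 : Real.exp (-(1 / b * log 2)) ≤ 1 := Real.exp_le_one_iff.2 (by
        have : 0 < 1 / b * log 2 := by positivity
        linarith)
      have h3 := Real.exp_pos (-(1 / b * log 2))
      exact neg_nonneg.2 (Real.log_nonpos (by linarith) (by linarith))
    calc _ = ∫⁻ r, ((L : ℝ≥0∞) + ((blockCode b (idx x r)).length : ℝ≥0∞)) ∂ν.prod dartLaw := by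
          simp
      _ = (L : ℝ≥0∞) + ∫⁻ r, ((blockCode b (idx x r)).length : ℝ≥0∞) ∂ν.prod dartLaw := by
          rw [lintegral_add_left measurable_const]
          simp
      _ ≤ _ := by
          rw [codeOverhead]
          generalize -log (1 - Real.exp (-(1 / b * log 2))) = E at h1 h2 ⊢
          refine (add_le_add_right h1 _).trans_eq ?_
          rw [← ENNReal.ofReal_natCast, ← ENNReal.ofReal_add (by positivity) (by positivity)]
          congr 1
          ring

end

end SMP

/-! ### Amortized communication -/

namespace SMP

open Real (negMulLog log)
open scoped unitInterval

noncomputable section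

/-- Coordinatewise measurability need not give measurability for `⊤` on words over an infinite `Z`;
a finite range does. This is why `blockProtocol` confines its outputs to `F`. -/
lemma measurable_top_of_forall_mem {Ω Z : Type*} [MeasurableSpace Ω] {n : ℕ} {F : Finset Z}
    {g : Ω → Fin n → Z} (hF : ∀ ω i, g ω i ∈ F)
    (hg : ∀ i, Measurable[_, ⊤] fun ω => g ω i) : Measurable[_, ⊤] g := by
  intro B _
  have hfin : {h : Fin n → Z | ∀ i, h i ∈ (F : Set Z)}.Finite :=
    Set.Finite.pi' fun _ => F.finite_toSet
  have h : g ⁻¹' B = ⋃ h ∈ {h : Fin n → Z | ∀ i, h i ∈ (F : Set Z)} ∩ B,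
      ⋂ i, (fun ω => g ω i) ⁻¹' {h i} := by
    ext ω
    simp only [Set.mem_preimage, Set.mem_iUnion, Set.mem_iInter, Set.mem_singleton_iff,
      exists_prop]
    constructor
    · exact fun hω => ⟨g ω, ⟨fun i => hF ω i, hω⟩, fun _ => rfl⟩
    · rintro ⟨h, ⟨-, hB⟩, hh⟩
      rwa [funext hh]
  rw [h]
  exact (hfin.inter_of_left B).measurableSet_biUnion fun h _ =>
    MeasurableSet.iInter fun i => hg i trivial

lemma jointLaw_dirac {X R S K : Type*} [MeasurableSpace R] [MeasurableSpace S] [MeasurableSpace K]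
    (ρ : R) (ν : Measure S) [SFinite ν] {msg : X → S → K} (hmsg : ∀ x, Measurable (msg x)) (x : X) :
    jointLaw (Measure.dirac ρ) ν (fun x r => msg x r.2) x = ν.map fun s => (s, msg x s) := by
  have hm := hmsg x
  rw [jointLaw, Measure.dirac_prod, Measure.map_map (by fun_prop) (by fun_prop)]
  rfl

/-! ### The protocol for `n` copies -/

section Block

variable {X Y Z : Type*} (P : SMPProtocol X Y Z) (F : Finset Z) (z₀ : F) {n : ℕ} {KA KB : Type}
  [Countable KA] [Nonempty KA] [MeasurableSpace KA] [DiscreteMeasurableSpace KA]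
  [Countable KB] [Nonempty KB] [MeasurableSpace KB] [DiscreteMeasurableSpace KB]
  {msgA : (Fin n → X) → P.RAC × I × (ℕ → I × I) → KA} (hmsgA : ∀ x, Measurable (msgA x))
  {msgB : (Fin n → Y) → P.RBC × I × (ℕ → I × I) → KB} (hmsgB : ∀ y, Measurable (msgB y))
  {decA : KA × P.RAC × I × (ℕ → I × I) → Fin n → P.MA} (hdecA : Measurable decA)
  {decB : KB × P.RBC × I × (ℕ → I × I) → Fin n → P.MB} (hdecB : Measurable decB)
  {encA : KA → List Bool} (hencA : IsPrefixCode encA)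
  {encB : KB → List Bool} (hencB : IsPrefixCode encB)

/-- The protocol for many copies in which the referee recovers messages of the protocol `P` for each
copy, and applies the decision rule of `P`. Outputs outside `F` are replaced by `z₀`. -/
def blockProtocol : AvgSMPProtocol (Fin n → X) (Fin n → Y) (Fin n → Z) where
  RA := Unit
  RB := Unit
  RC := P.RC
  RAC := P.RAC × I × (ℕ → I × I)
  RBC := P.RBC × I × (ℕ → I × I)
  lawA := Measure.dirac ()
  lawB := Measure.dirac ()
  lawC := P.lawC
  lawAC := P.lawAC.prod dartLaw
  lawBC := P.lawBC.prod dartLaw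
  MA := KA
  MB := KB
  alice x r := msgA x r.2
  bob y r := msgB y r.2
  referee m i := (truncate F z₀ (P.referee (decA (m.1, m.2.2.2.1) i, decB (m.2.1, m.2.2.2.2) i,
    m.2.2.1, m.2.2.2.1.1, m.2.2.2.2.1)) : Z)
  measurable_alice x := (hmsgA x).comp measurable_snd
  measurable_bob y := (hmsgB y).comp measurable_snd
  measurable_referee := by
    refine measurable_top_of_forall_mem (F := F) (fun _ _ => Subtype.coe_prop _) fun i => ?_
    intro B _
    have hm : Measurable fun m : KA × KB × P.RC × (P.RAC × I × (ℕ → I × I)) ×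
        (P.RBC × I × (ℕ → I × I)) => (decA (m.1, m.2.2.2.1) i, decB (m.2.1, m.2.2.2.2) i,
          m.2.2.1, m.2.2.2.1.1, m.2.2.2.2.1) := by fun_prop
    exact hm (P.measurable_referee (t := {z | (truncate F z₀ z : Z) ∈ B}) trivial)
  encA := encA
  encB := encB
  prefixA := hencA
  prefixB := hencB

/-- For each copy, the old shared strings and the decoded messages have exactly their laws in `P`.
Copies share these strings and the coins of the referee, which is harmless because only the error of
each single copy is bounded. Truncation to `F` never spoils a correct value. -/
theorem computesCopies_blockProtocol [Fintype P.MA] [Fintype P.MB] {f : X → Y → Z} {ε : ℝ}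
    (hP : P.Computes f ε) (hF : ∀ x y, f x y ∈ F)
    (hlawA : ∀ x i, (P.lawAC.prod dartLaw).map (fun r => (r.1, decA (msgA x r, r) i)) =
      chanLaw P.lawAC (msgProb P.lawA P.alice (x i)))
    (hlawB : ∀ y i, (P.lawBC.prod dartLaw).map (fun r => (r.1, decB (msgB y r, r) i)) =
      chanLaw P.lawBC (msgProb P.lawB P.bob (y i))) :
    (blockProtocol P F z₀ hmsgA hmsgB hdecA hdecB hencA hencB).ComputesCopies f ε := by
  intro x y i
  refine le_trans (ENNReal.toReal_mono (measure_ne_top _ _) ?_) (hP (x i) (y i))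
  have h1 := coinLaw_output
    (blockProtocol P F z₀ hmsgA hmsgB hdecA hdecB hencA hencB).toSMPProtocol x y
    {z | z i ≠ f (x i) (y i)}
  have h2 := coinLaw_output P (x i) (y i) {z | z ≠ f (x i) (y i)}
  refine (h1.trans_le ?_).trans_eq h2.symm
  set bad := P.referee ⁻¹' {z | z ≠ f (x i) (y i)} with hbad
  have hbm : MeasurableSet bad := P.measurable_referee trivial
  set gA : (P.RAC × I × (ℕ → I × I)) × KA → P.RAC × P.MA :=
    fun a => (a.1.1, decA (a.2, a.1) i) with hgA
  set gB : (P.RBC × I × (ℕ → I × I)) × KB → P.RBC × P.MB :=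
    fun b => (b.1.1, decB (b.2, b.1) i) with hgB
  have hgAm : Measurable gA := by fun_prop
  have hgBm : Measurable gB := by fun_prop
  have hA : (jointLaw (Measure.dirac ()) (P.lawAC.prod dartLaw) (fun x r => msgA x r.2) x).map gA =
      jointLaw P.lawA P.lawAC P.alice (x i) := by
    have hm := hmsgA x
    rw [jointLaw_eq_chanLaw P.measurable_alice, ← hlawA x i, jointLaw_dirac _ _ hmsgA,
      Measure.map_map hgAm (by fun_prop)]
    rfl
  have hB : (jointLaw (Measure.dirac ()) (P.lawBC.prod dartLaw) (fun y r => msgB y r.2) y).map gB =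
      jointLaw P.lawB P.lawBC P.bob (y i) := by
    have hm := hmsgB y
    rw [jointLaw_eq_chanLaw P.measurable_bob, ← hlawB y i, jointLaw_dirac _ _ hmsgB,
      Measure.map_map hgBm (by fun_prop)]
    rfl
  have hpB := isProbabilityMeasure_jointLaw (lawR := P.lawB) (lawS := P.lawBC)
    P.measurable_bob (y i)
  rw [← hA, errProb, errProb, lintegral_map (measurable_lintegral_bad hbm _) hgAm]
  refine lintegral_mono fun a => ?_
  rw [← hB, lintegral_map (measurable_prob_bad_right hbm _) hgBm]
  refine lintegral_mono fun b => measure_mono fun c hc h => hc ?_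
  change (truncate F z₀ _ : Z) = _
  have h' : P.referee (decA (a.2, a.1) i, decB (b.2, b.1) i, c, a.1.1, b.1.1) = f (x i) (y i) := h
  exact (congrArg (fun z => (truncate F z₀ z : Z)) h').trans (truncate_of_mem z₀ (hF _ _))

theorem avgCost_blockProtocol_le [Nonempty X] [Nonempty Y] {cA cB : ℝ≥0∞}
    (hA : ∀ x, ∫⁻ r, ((encA (msgA x r)).length : ℝ≥0∞) ∂P.lawAC.prod dartLaw ≤ cA)
    (hB : ∀ y, ∫⁻ r, ((encB (msgB y r)).length : ℝ≥0∞) ∂P.lawBC.prod dartLaw ≤ cB) :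
    (blockProtocol P F z₀ hmsgA hmsgB hdecA hdecB hencA hencB).avgCost ≤ cA + cB := by
  rw [avgCost_eq_add]
  refine add_le_add (iSup_le fun x => ?_) (iSup_le fun y => ?_)
  · have h1 := lintegral_jointLaw_alice
      (blockProtocol P F z₀ hmsgA hmsgB hdecA hdecB hencA hencB).toSMPProtocol x
      (F := fun m => ((encA m).length : ℝ≥0∞)) .of_discrete
    have hF : Measurable fun z : (P.RAC × I × (ℕ → I × I)) × KA =>
        ((encA z.2).length : ℝ≥0∞) :=
      (Measurable.of_discrete (f := fun m => ((encA m).length : ℝ≥0∞))).comp measurable_snd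
    refine (h1.symm.trans (Eq.trans ?_ (lintegral_map hF
      (measurable_id.prodMk (hmsgA x))))).trans_le (hA x)
    exact congrArg (lintegral · _) (jointLaw_dirac () (P.lawAC.prod dartLaw) hmsgA x)
  · have h1 := lintegral_jointLaw_bob
      (blockProtocol P F z₀ hmsgA hmsgB hdecA hdecB hencA hencB).toSMPProtocol y
      (F := fun m => ((encB m).length : ℝ≥0∞)) .of_discrete
    have hF : Measurable fun z : (P.RBC × I × (ℕ → I × I)) × KB =>
        ((encB z.2).length : ℝ≥0∞) :=
      (Measurable.of_discrete (f := fun m => ((encB m).length : ℝ≥0∞))).comp measurable_snd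
    refine (h1.symm.trans (Eq.trans ?_ (lintegral_map hF
      (measurable_id.prodMk (hmsgB y))))).trans_le (hB y)
    exact congrArg (lintegral · _) (jointLaw_dirac () (P.lawBC.prod dartLaw) hmsgB y)

end Block

lemma avgInfo_le_capacity {X S M : Type*} [Fintype X] [Fintype M] [MeasurableSpace S]
    (ν : Measure S) [IsProbabilityMeasure ν] {p : X → S → M → ℝ} (hp : IsChannel p) {μ : X → ℝ}
    (hμ : μ ∈ stdSimplex ℝ X) : avgInfo ν μ p ≤ (capacity ν p).toReal * log 2 := by
  have hfin : capacity ν p ≠ ∞ := ne_top_of_le_ne_top ENNReal.ofReal_ne_top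
    (capacity_le_ofReal fun μ hμ => hp.avgInfo_le_log_card ν hμ)
  have h : ENNReal.ofReal (avgInfo ν μ p) / ENNReal.ofReal (log 2) ≤ capacity ν p :=
    le_iSup₂_of_le μ hμ le_rfl
  rw [← ENNReal.ofReal_div_of_pos log_two_pos, ENNReal.ofReal_le_iff_le_toReal hfin] at h
  exact (div_le_iff₀ log_two_pos).1 h

/-! ### Asymptotic cost per copy -/

section Amortized

variable {X Y Z : Type*} [Fintype X] [Nonempty X] [MeasurableSpace X] [DiscreteMeasurableSpace X]
  [Fintype Y] [Nonempty Y] [MeasurableSpace Y] [DiscreteMeasurableSpace Y] {f : X → Y → Z} {ε : ℝ}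

/-- The part of the length of a message for `n` copies that is sublinear in `n`. -/
def blockOverhead (X : Type*) [Fintype X] (b n : ℕ) : ℝ :=
  Fintype.card X * n.size + codeOverhead b

lemma tendsto_blockOverhead_div (X : Type*) [Fintype X] (b : ℕ) :
    Tendsto (fun n : ℕ => blockOverhead X b n / n) atTop (𝓝 0) := by
  have hinv : Tendsto (fun n : ℕ => 1 / (n : ℝ)) atTop (𝓝 0) := tendsto_one_div_atTop_nhds_zero_nat
  have hlog : Tendsto (fun n : ℕ => log n / n) atTop (𝓝 0) :=
    Real.isLittleO_log_id_atTop.tendsto_div_nhds_zero.comp tendsto_natCast_atTop_atTop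
  have hsize : Tendsto (fun n : ℕ => (n.size : ℝ) / n) atTop (𝓝 0) := by
    have h1 : Tendsto (fun n : ℕ => (log n / n) / log 2 + 1 / (n : ℝ)) atTop (𝓝 0) := by
      simpa using (hlog.div_const (log 2)).add hinv
    refine squeeze_zero (fun n => by positivity) (fun n => ?_) h1
    refine (div_le_div_of_nonneg_right (size_le_log n) n.cast_nonneg).trans_eq ?_
    rw [add_div, div_right_comm]
  have h2 := (hsize.const_mul (Fintype.card X : ℝ)).add (hinv.const_mul (codeOverhead b))
  rw [mul_zero, mul_zero, add_zero] at h2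
  refine h2.congr fun n => ?_
  rw [blockOverhead]
  ring

theorem avgCommCopies_le (P : SMPProtocol X Y Z) [Fintype P.MA] [Fintype P.MB]
    (hP : P.Computes f ε) {b n : ℕ} (hb : 0 < b) (hn : 0 < n) :
    avgCommCopies f ε n ≤ ENNReal.ofReal (blockOverhead X b n) +
      ENNReal.ofReal (blockOverhead Y b n) +
        ENNReal.ofReal ((1 + 1 / b) ^ 2) * P.infoCost * n := by
  classical
  -- So `k * n.size` bits suffice to name an empirical distribution over `k` letters.
  have hpow : ∀ k : ℕ, (n + 1) ^ k ≤ 2 ^ (k * n.size) := fun k => by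
    rw [mul_comm, pow_mul]
    exact Nat.pow_le_pow_left (Nat.lt_size_self n) k
  have hcA := isChannel_msgProb (lawR := P.lawA) P.measurable_alice
  have hcB := isChannel_msgProb (lawR := P.lawB) P.measurable_bob
  obtain ⟨msgA, decA, encA, hmsgA, hdecA, hencA, hlawA, hlenA⟩ := exists_word_simulation P.lawAC
    hcA (fun μ hμ => avgInfo_le_capacity P.lawAC hcA hμ) hb hn (hpow _)
  obtain ⟨msgB, decB, encB, hmsgB, hdecB, hencB, hlawB, hlenB⟩ := exists_word_simulation P.lawBC
    hcB (fun μ hμ => avgInfo_le_capacity P.lawBC hcB hμ) hb hn (hpow _)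
  set F : Finset Z := Finset.univ.image fun z : X × Y => f z.1 z.2 with hF
  have hFm : ∀ x y, f x y ∈ F := fun x y => Finset.mem_image.2 ⟨(x, y), Finset.mem_univ _, rfl⟩
  have hcomp := computesCopies_blockProtocol P F
    ⟨_, hFm (Classical.arbitrary X) (Classical.arbitrary Y)⟩ hmsgA hmsgB hdecA hdecB hencA hencB hP
    hFm hlawA hlawB
  have hle : avgCommCopies f ε n ≤ _ :=
    iInf₂_le (f := fun (P : AvgSMPProtocol (Fin n → X) (Fin n → Y) (Fin n → Z))
      (_ : P.ComputesCopies f ε) => P.avgCost) _ hcomp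
  refine hle.trans ((avgCost_blockProtocol_le P F _ hmsgA hmsgB hdecA hdecB hencA hencB hlenA
    hlenB).trans ?_)
  have key : ∀ (k : ℕ) (c : ℝ≥0∞), c ≠ ∞ → ENNReal.ofReal (((k * n.size : ℕ) : ℝ) +
      codeOverhead b + (1 + 1 / b) ^ 2 / log 2 * (n * (c.toReal * log 2))) ≤
      ENNReal.ofReal (k * n.size + codeOverhead b) + ENNReal.ofReal ((1 + 1 / b) ^ 2) * c * n := by
    intro k c hc
    refine ENNReal.ofReal_add_le.trans_eq ?_
    have h1 : (1 + 1 / (b : ℝ)) ^ 2 / log 2 * (n * (c.toReal * log 2)) =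
        (1 + 1 / b) ^ 2 * c.toReal * n := by
      have := log_two_pos.ne'
      field_simp
    rw [h1, ENNReal.ofReal_mul (by positivity), ENNReal.ofReal_mul (by positivity),
      ENNReal.ofReal_toReal hc, ENNReal.ofReal_natCast, Nat.cast_mul]
  refine (add_le_add (key _ _ ?_) (key _ _ ?_)).trans_eq ?_
  · exact ne_top_of_le_ne_top ENNReal.ofReal_ne_top
      (capacity_le_ofReal fun μ hμ => hcA.avgInfo_le_log_card _ hμ)
  · exact ne_top_of_le_ne_top ENNReal.ofReal_ne_top
      (capacity_le_ofReal fun μ hμ => hcB.avgInfo_le_log_card _ hμ)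
  · rw [infoCost_eq_capacity P, blockOverhead, blockOverhead]
    ring

/-- For fixed `b` the overhead vanishes as `n` grows; only afterwards does `b` tend to infinity,
since `codeOverhead b` is unbounded in `b`. -/
theorem limsup_avgCommCopies_div_le (P : SMPProtocol X Y Z) [Fintype P.MA] [Fintype P.MB]
    (hP : P.Computes f ε) :
    limsup (fun n : ℕ => avgCommCopies f ε n / n) atTop ≤ P.infoCost := by
  have key : ∀ b : ℕ, 0 < b → limsup (fun n : ℕ => avgCommCopies f ε n / n) atTop ≤
      ENNReal.ofReal ((1 + 1 / b) ^ 2) * P.infoCost := by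
    intro b hb
    have hlim : Tendsto (fun n : ℕ => ENNReal.ofReal (blockOverhead X b n / n) +
        ENNReal.ofReal (blockOverhead Y b n / n) + ENNReal.ofReal ((1 + 1 / b) ^ 2) * P.infoCost)
        atTop (𝓝 (ENNReal.ofReal ((1 + 1 / b) ^ 2) * P.infoCost)) := by
      have h := ((ENNReal.tendsto_ofReal (tendsto_blockOverhead_div X b)).add
        (ENNReal.tendsto_ofReal (tendsto_blockOverhead_div Y b))).add
        (tendsto_const_nhds (x := ENNReal.ofReal ((1 + 1 / b) ^ 2) * P.infoCost))
      simpa using h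
    rw [← hlim.limsup_eq]
    refine limsup_le_limsup ?_
    filter_upwards [eventually_gt_atTop 0] with n hn
    have hn' : (0 : ℝ) < n := by exact_mod_cast hn
    have h0 : (n : ℝ≥0∞) ≠ 0 := by exact_mod_cast hn.ne'
    rw [ENNReal.div_le_iff h0 (ENNReal.natCast_ne_top n), ENNReal.ofReal_div_of_pos hn',
      ENNReal.ofReal_div_of_pos hn', ENNReal.ofReal_natCast, add_mul, add_mul,
      ENNReal.div_mul_cancel h0 (ENNReal.natCast_ne_top n),
      ENNReal.div_mul_cancel h0 (ENNReal.natCast_ne_top n)]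
    exact avgCommCopies_le P hP hb hn
  have hlim : Tendsto (fun b : ℕ => ENNReal.ofReal ((1 + 1 / b) ^ 2) * P.infoCost) atTop
      (𝓝 P.infoCost) := by
    have h1 : Tendsto (fun b : ℕ => (1 + 1 / (b : ℝ)) ^ 2) atTop (𝓝 1) := by
      simpa using (tendsto_one_div_atTop_nhds_zero_nat.const_add (1 : ℝ)).pow 2
    have h2 := ENNReal.Tendsto.mul_const (b := P.infoCost) (ENNReal.tendsto_ofReal h1)
      (Or.inl (by simp))
    simpa using h2
  exact ge_of_tendsto hlim ((eventually_gt_atTop 0).mono key)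

end Amortized

end

end SMP

theorem mainTheorem9 {X Y Z : Type*}
    [Finite X] [Nonempty X] [MeasurableSpace X] [DiscreteMeasurableSpace X]
    [Finite Y] [Nonempty Y] [MeasurableSpace Y] [DiscreteMeasurableSpace Y]
    (f : X → Y → Z) (ε : ℝ) (hε : ε ∈ Set.Ioo (0 : ℝ) (1 / 2)) :
    infoComplexity f ε = amortizedComm f ε ∧
      Tendsto (fun n : ℕ => avgCommCopies f ε n / n) atTop (𝓝 (amortizedComm f ε)) := by
  have := Fintype.ofFinite X
  have := Fintype.ofFinite Y
  have hsup : amortizedComm f ε ≤ infoComplexity f ε := by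
    refine le_iInf fun P => le_iInf fun _ => le_iInf fun _ => le_iInf fun hP => ?_
    have := Fintype.ofFinite P.MA
    have := Fintype.ofFinite P.MB
    exact SMP.limsup_avgCommCopies_div_le P hP
  -- This bound holds for every positive `n`, so it controls the lower limit; that is what turns the
  -- upper limit into a limit.
  have hinf : infoComplexity f ε ≤ liminf (fun n : ℕ => avgCommCopies f ε n / n) atTop :=
    le_liminf_of_le (by isBoundedDefault) ((eventually_gt_atTop 0).mono fun n hn =>
      SMP.infoComplexity_le_avgCommCopies_div f hε.1 hn)
  have h : infoComplexity f ε = amortizedComm f ε :=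
    le_antisymm (hinf.trans (liminf_le_limsup)) hsup
  exact ⟨h, tendsto_of_le_liminf_of_limsup_le (h ▸ hinf) le_rfl⟩
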